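/- Let $n_x,n_y,K\in\mathbb N$ and $\lambda>0$. Consider the linear Gaussian system $$\begin{bmatrix}X_{k+1}\\Y_{k+1}\end{bmatrix}=A\begin{bmatrix}X_k\\Y_k\end{bmatrix}+W_k,\qquad X_k\in\mathbb R^{n_x},\ Y_k\in\mathbb R^{n_y},$$ where the $W_k$ are i.i.d. $\mathcal N(0,Q)$, independent of $(X_0,Y_0)\sim\mathcal N(m_0,P_{0|-1})$, with $Q$ and $P_{0|-1}$ positive definite. Write $Y^k=(Y_0,\dots,Y_k)$ and $Z^k=(Z_0,\dots,Z_k)$. A sampling policy consists of measurable functions $f_k(Z^{k-1})$ (a symmetric positive definite matrix) and $g_k(Z^{k-1})\in\mathbb R^{n_x}$. The sampler discards the sample ($N_k=0$, $Z_k=\emptyset$) if $\epsilon_k\le\exp\bigl(-\tfrac12(X_k-g_k)^\top f_k^{-1}(X_k-g_k)\bigr)$, where the $\epsilon_k$ are i.i.d. uniform on $[0,1]$ and independent of the system, and otherwise keeps it ($N_k=1$, $Z_k=X_k$). **Belief recursion.** Define $\tilde x_{k|k-1},\tilde y^{k|k-1},P_{k|k-1}$ as functions of $Z^{k-1}$ as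 follows, with blocks $P^{xx},P^{xy},P^{yx},P^{yy}$ corresponding to $(X_k,Y^k)$. They start from the mean and covariance of $(X_0,Y_0)$. * If $N_k=0$, then, with $D_k=P_{k|k-1}\begin{bmatrix}f_k^{-1}&0\\0&0\end{bmatrix}$, the filtered mean is $(D_k+I)^{-1}\bigl(D_k\begin{bmatrix}g_k\\0\end{bmatrix}+\begin{bmatrix}\tilde x_{k|k-1}\\\tilde y^{k|k-1}\end{bmatrix}\bigr)$ and $P_{k|k}=(D_k+I)^{-1}P_{k|k-1}$. * If $N_k=1$, then $\tilde x_{k|k}=Z_k$ and $\tilde y^{k|k}=\tilde y^{k|k-1}+P^{yx}_{k|k-1}(P^{xx}_{k|k-1})^{-1}(Z_k-\tilde x_{k|k-1})$. The only nonzero block of $P_{k|k}$ is $P^{yy}_{k|k}=P^{yy}_{k|k-1}-P^{yx}_{k|k-1}(P^{xx}_{k|k-1})^{-1}P^{xy}_{k|k-1}$. * The prediction for time $k+1$ has as its mean the image of the filtered mean under the linear map $\mathcal A_{k+1}:(x_k,y^k)\mapsto(A(x_k,y_k),y^k)$, and $P_{k+1|k}=\mathcal A_{k+1}P_{k|k}\mathcal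 A_{k+1}^\top+\Sigma_{k+1}$, where $\Sigma_{k+1}$ equals $Q$ on the coordinates of $(X_{k+1},Y_{k+1})$ and $0$ elsewhere. **Loss.** For $x\in\mathbb R^{n_x}$ and positive definite $P$ put $q=\sqrt{\tfrac{|f|}{|f+P^{xx}|}}\exp\bigl(-\tfrac12(g-x)^\top(f+P^{xx})^{-1}(g-x)\bigr)$ and $$\begin{aligned}l_k(f,g,x,P)={}&q\operatorname{tr}\bigl(f(f+P^{xx})^{-1}P^{xx}\bigr)+\lambda\log\sqrt{|P^{yy}|}-\lambda(1-q)\log\sqrt{|P^{yy}-P^{yx}(P^{xx})^{-1}P^{xy}|}\\&-\lambda q\log\sqrt{|P^{yy}-P^{yx}(f+P^{xx})^{-1}P^{xy}|}.\end{aligned}$$ Let $L(f,g)=\mathsf E\bigl[\sum_{k=0}^K l_k(f_k,g_k,\tilde x_{k|k-1},P_{k|k-1})\bigr]$. A policy is called optimal if it minimizes $L$ over all policies. **Optimality equation.** $V_{K+1}=0$ and, for $0\le k\le K$, $$V_k(\tilde x_{k|k-1},P_{k|k-1})=\inf_{f,g}\Bigl\{l_k(f,g,\tilde x_{k|k-1},P_{k|k-1})+\mathsf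 E\bigl[V_{k+1}(\tilde x_{k+1|k},P_{k+1|k})\,\big|\,Z^{k-1}\bigr]\Bigr\},\tag{B}$$ where $f$ is positive definite, $g\in\mathbb R^{n_x}$, the conditional law of $X_k$ is $\mathcal N(\tilde x_{k|k-1},P^{xx}_{k|k-1})$, the sample is discarded according to $(f,g)$, and $(\tilde x_{k+1|k},P_{k+1|k})$ is given by the belief recursion. (B) is required for all values of $\tilde x_{k|k-1}$ and $\tilde y^{k|k-1}$ and all positive definite $P_{k|k-1}$. **Theorem.** 1. For every policy and every $k\le K$, the conditional law of $(X_k,Y^k)$ given $Z^{k-1}$ is almost surely Gaussian with mean $(\tilde x_{k|k-1},\tilde y^{k|k-1})$ and covariance $P_{k|k-1}$. 2. If the evolution of $Y$ does not depend on $X$ (the $yx$-block of $A$ vanishes), then for every policy $L(f,g)$ is the minimum over all measurable reconstructions $\tilde X_k=\tilde\pi_k(Z^k)$ of $\sum_{k=0}^K\mathsf E\bigl[(X_k-\tilde X_k)^\top(X_k-\tilde X_k)\bigr]+\lambda I(Z^K;Y^K)$, and $\tilde X_k=\tilde x_{k|k}$ attains it. 3. $l_k\ge0$ for positive definite $P$.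 Equation (B) has a $[0,\infty]$-valued solution $V_k$ that depends on the belief only through $(\tilde x_{k|k-1},P_{k|k-1})$. Every such solution is finite for $k\le K$ at positive definite $P$, and $V_0(\tilde x_{0|-1},P_{0|-1})=\inf_{f,g}L(f,g)$. 4. A policy is optimal if and only if, for every $k\le K$, almost surely $(f_k(Z^{k-1}),g_k(Z^{k-1}))$ attains the infimum in (B) at the current predicted belief. 5. All measurable feedback laws $f_k(\tilde x_{k|k-1},P_{k|k-1})$, $g_k(\tilde x_{k|k-1},P_{k|k-1})$ generate policies, the infimum of $L$ over these policies is again $V_0(\tilde x_{0|-1},P_{0|-1})$, and if an optimal policy exists, then there is an optimal policy of this feedback form. -/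

import Mathlib

open MeasureTheory ProbabilityTheory Matrix
open scoped ENNReal

namespace PrivacySampling

/-- Gaussian law on `ι → ℝ` with mean `m` and covariance matrix `P` (for positive semidefinite
`P`), transported from Mathlib's Gaussian on the Euclidean space. -/
noncomputable def gaussianVec {ι : Type*} [Fintype ι] [DecidableEq ι]
    (m : ι → ℝ) (P : Matrix ι ι ℝ) : Measure (ι → ℝ) :=
  (multivariateGaussian (WithLp.toLp 2 m) P).map (WithLp.ofLp (p := 2))

/-- Coordinates of `(X_k, Y_k)`. -/
abbrev StateIdx (nx ny : ℕ) := Fin nx ⊕ Fin ny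

/-- Coordinates of `(X_k, Y^k)`, where `Y^k = (Y_0, …, Y_k)`; the pair `(t, j)` is the
`j`-th coordinate of `Y_t`. -/
abbrev HistIdx (nx ny k : ℕ) := Fin nx ⊕ (Fin (k + 1) × Fin ny)

/-- Values of the sampler's output `Z_k`: `Sum.inl x` is the transmitted state `x`, and
`Sum.inr ()` is the symbol `∅` of a discarded sample. -/
abbrev Obs (nx : ℕ) := (Fin nx → ℝ) ⊕ Unit

/-- Parameters of `(X_{k+1}, Y_{k+1}) = A (X_k, Y_k) + W_k`, where the `W_k` are i.i.d. centred
Gaussian with covariance `Q`, and `(X_0, Y_0)` is Gaussian with mean `m₀` and covariance `P₀`. -/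
structure LinGaussSystem (nx ny : ℕ) where
  A : Matrix (StateIdx nx ny) (StateIdx nx ny) ℝ
  Q : Matrix (StateIdx nx ny) (StateIdx nx ny) ℝ
  m₀ : StateIdx nx ny → ℝ
  P₀ : Matrix (StateIdx nx ny) (StateIdx nx ny) ℝ
  Q_posDef : Q.PosDef
  P₀_posDef : P₀.PosDef

/-- The parameters of one stage of the Gaussian-shaped sampling policy: the shape `f`, a symmetric
positive definite matrix, and the centre `g`. -/
structure StageParam (nx : ℕ) where
  f : Matrix (Fin nx) (Fin nx) ℝ
  g : Fin nx → ℝ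
  f_posDef : f.PosDef

/-- `π(N = 0 | x) = exp (-(x - g)ᵀ f⁻¹ (x - g) / 2)`. -/
noncomputable def StageParam.discardProb {nx : ℕ} (a : StageParam nx) (x : Fin nx → ℝ) : ℝ :=
  Real.exp (-(1 / 2) * ((x - a.g) ⬝ᵥ (a.f⁻¹ *ᵥ (x - a.g))))

/-- A sampling policy: at each time `k`, the parameters `(f_k, g_k)` are measurable functions of
the past output `Z^{k-1} = (Z_0, …, Z_{k-1})`. -/
structure Policy (nx : ℕ) where
  act : (k : ℕ) → (Fin k → Obs nx) → StageParam nx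
  measurable_f : ∀ k i j, Measurable fun z => (act k z).f i j
  measurable_g : ∀ k, Measurable fun z => (act k z).g

/-- A reconstruction policy: at each time `k`, the reconstruction of `X_k` is a measurable function
of `Z^k = (Z_0, …, Z_k)`. -/
structure Recon (nx : ℕ) where
  est : (k : ℕ) → (Fin (k + 1) → Obs nx) → (Fin nx → ℝ)
  measurable_est : ∀ k, Measurable (est k)

/-! ### The Gaussian belief recursions -/

/-- Mean and covariance matrix of a Gaussian law of `(X_k, Y^k)`. -/
structure Belief (nx ny k : ℕ) where
  mean : HistIdx nx ny k → ℝ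
  cov : Matrix (HistIdx nx ny k) (HistIdx nx ny k) ℝ

/-- The `x`-part of the mean. -/
def Belief.x {nx ny k : ℕ} (b : Belief nx ny k) : Fin nx → ℝ := fun i => b.mean (Sum.inl i)

/-- The `y`-part of the mean. -/
def Belief.y {nx ny k : ℕ} (b : Belief nx ny k) : Fin (k + 1) × Fin ny → ℝ :=
  fun j => b.mean (Sum.inr j)

/-- The matrix of the linear map `(x_k, y^k) ↦ (A (x_k, y_k), y^k)`, with values in the space of
`(x_{k+1}, y^{k+1})`. -/
def stepMatrix {nx ny : ℕ} (A : Matrix (StateIdx nx ny) (StateIdx nx ny) ℝ) (k : ℕ) :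
    Matrix (HistIdx nx ny (k + 1)) (HistIdx nx ny k) ℝ
  | Sum.inl i, Sum.inl j => A (Sum.inl i) (Sum.inl j)
  | Sum.inl i, Sum.inr (t, j) => if t = Fin.last k then A (Sum.inl i) (Sum.inr j) else 0
  | Sum.inr (s, i), Sum.inl j =>
      if s = Fin.last (k + 1) then A (Sum.inr i) (Sum.inl j) else 0
  | Sum.inr (s, i), Sum.inr (t, j) =>
      if s = Fin.last (k + 1) then (if t = Fin.last k then A (Sum.inr i) (Sum.inr j) else 0)
      else if s = t.castSucc ∧ i = j then 1 else 0

/-- The covariance matrix of the noise `(W_k, 0)` that enters `(X_{k+1}, Y^{k+1})`: it is `Q` on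
the coordinates of `(X_{k+1}, Y_{k+1})` and zero elsewhere. -/
def stepNoise {nx ny : ℕ} (Q : Matrix (StateIdx nx ny) (StateIdx nx ny) ℝ) (k : ℕ) :
    Matrix (HistIdx nx ny (k + 1)) (HistIdx nx ny (k + 1)) ℝ
  | Sum.inl i, Sum.inl j => Q (Sum.inl i) (Sum.inl j)
  | Sum.inl i, Sum.inr (t, j) => if t = Fin.last (k + 1) then Q (Sum.inl i) (Sum.inr j) else 0
  | Sum.inr (s, i), Sum.inl j => if s = Fin.last (k + 1) then Q (Sum.inr i) (Sum.inl j) else 0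
  | Sum.inr (s, i), Sum.inr (t, j) =>
      if s = Fin.last (k + 1) ∧ t = Fin.last (k + 1) then Q (Sum.inr i) (Sum.inr j) else 0

/-- The initial belief: mean and covariance of `(X_0, Y_0)`. -/
def LinGaussSystem.initBelief {nx ny : ℕ} (S : LinGaussSystem nx ny) : Belief nx ny 0 where
  mean := fun i => S.m₀ (Sum.map id Prod.snd i)
  cov := S.P₀.submatrix (Sum.map id Prod.snd) (Sum.map id Prod.snd)

/-- Time update, from the belief about `(X_k, Y^k)` given `Z^k` to the belief about
`(X_{k+1}, Y^{k+1})` given `Z^k`. -/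
def LinGaussSystem.predict {nx ny : ℕ} (S : LinGaussSystem nx ny) {k : ℕ} (b : Belief nx ny k) :
    Belief nx ny (k + 1) where
  mean := stepMatrix S.A k *ᵥ b.mean
  cov := stepMatrix S.A k * b.cov * (stepMatrix S.A k)ᵀ + stepNoise S.Q k

/-- Measurement update, from the belief about `(X_k, Y^k)` given `Z^{k-1}` to the belief given
`Z^k`, when the parameters `a = (f_k, g_k)` are used and `Z_k` is observed. -/
noncomputable def Belief.update {nx ny k : ℕ} (b : Belief nx ny k) (a : StageParam nx) :
    Obs nx → Belief nx ny k
  | Sum.inr _ =>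
      let D : Matrix (HistIdx nx ny k) (HistIdx nx ny k) ℝ :=
        b.cov * Matrix.fromBlocks a.f⁻¹ 0 0 0
      { mean := (D + 1)⁻¹ *ᵥ (D *ᵥ Sum.elim a.g 0 + b.mean)
        cov := (D + 1)⁻¹ * b.cov }
  | Sum.inl x =>
      { mean := Sum.elim x
          (b.y + (b.cov.toBlocks₂₁ * b.cov.toBlocks₁₁⁻¹) *ᵥ (x - b.x))
        cov := Matrix.fromBlocks 0 0 0
          (b.cov.toBlocks₂₂ - b.cov.toBlocks₂₁ * b.cov.toBlocks₁₁⁻¹ * b.cov.toBlocks₁₂) }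

/-- The predicted belief `(x̃_{k|k-1}, ỹ^{k|k-1}, P_{k|k-1})` as a function of `Z^{k-1}`. -/
noncomputable def LinGaussSystem.predBelief {nx ny : ℕ} (S : LinGaussSystem nx ny)
    (p : Policy nx) : (k : ℕ) → (Fin k → Obs nx) → Belief nx ny k
  | 0, _ => S.initBelief
  | k + 1, z =>
      S.predict ((S.predBelief p k fun i => z i.castSucc).update
        (p.act k fun i => z i.castSucc) (z (Fin.last k)))

/-- The filtered belief `(x̃_{k|k}, ỹ^{k|k}, P_{k|k})` as a function of `Z^k`. -/
noncomputable def LinGaussSystem.filtBelief {nx ny : ℕ} (S : LinGaussSystem nx ny)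
    (p : Policy nx) (k : ℕ) (z : Fin (k + 1) → Obs nx) : Belief nx ny k :=
  (S.predBelief p k fun i => z i.castSucc).update
    (p.act k fun i => z i.castSucc) (z (Fin.last k))

/-! ### The controlled stochastic system -/

/-- `S₀` has the law of `(X_0, Y_0)`, the `W_k` are i.i.d. `N(0, Q)`, the randomization variables
`ε_k` of the sampler are i.i.d. uniform on `[0, 1]`, and all of them are mutually independent. -/
structure IsDriving {nx ny : ℕ} (S : LinGaussSystem nx ny) {Ω : Type*} [MeasurableSpace Ω]
    (μ : Measure Ω) (S₀ : Ω → StateIdx nx ny → ℝ) (W : ℕ → Ω → StateIdx nx ny → ℝ)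
    (ε : ℕ → Ω → ℝ) : Prop where
  measurable_init : Measurable S₀
  measurable_noise : ∀ k, Measurable (W k)
  measurable_unif : ∀ k, Measurable (ε k)
  law_init : μ.map S₀ = gaussianVec S.m₀ S.P₀
  law_noise : ∀ k, μ.map (W k) = gaussianVec 0 S.Q
  law_unif : ∀ k, μ.map (ε k) = volume.restrict (Set.Icc (0 : ℝ) 1)
  indep_noise : iIndepFun W μ
  indep_unif : iIndepFun ε μ
  indep_noise_unif : IndepFun (fun ω k => W k ω) (fun ω k => ε k ω) μ
  indep_init : IndepFun S₀ (fun ω => ((fun k => W k ω), (fun k => ε k ω))) μ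

section Dynamics

variable {nx ny : ℕ} (S : LinGaussSystem nx ny) {Ω : Type*}
  (S₀ : Ω → StateIdx nx ny → ℝ) (W : ℕ → Ω → StateIdx nx ny → ℝ) (ε : ℕ → Ω → ℝ)

/-- The process `(X_k, Y_k)`. -/
def LinGaussSystem.state : ℕ → Ω → StateIdx nx ny → ℝ
  | 0, ω => S₀ ω
  | k + 1, ω => S.A *ᵥ LinGaussSystem.state k ω + W k ω

/-- The observable state `X_k`. -/
def LinGaussSystem.X (k : ℕ) (ω : Ω) : Fin nx → ℝ := fun i => S.state S₀ W k ω (Sum.inl i)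

/-- The private state `Y_k`. -/
def LinGaussSystem.Y (k : ℕ) (ω : Ω) : Fin ny → ℝ := fun j => S.state S₀ W k ω (Sum.inr j)

/-- The vector `(X_k, Y^k)`. -/
def LinGaussSystem.XYhist (k : ℕ) (ω : Ω) : HistIdx nx ny k → ℝ :=
  Sum.elim (S.X S₀ W k ω) (fun tj => S.Y S₀ W tj.1 ω tj.2)

open Classical in
/-- The output history `(Z_0, …, Z_{k-1})` under the policy `p`: the sample `X_k` is discarded
exactly when `ε_k ≤ π_k(N_k = 0 | X_k, Z^{k-1})`. -/
noncomputable def LinGaussSystem.output (p : Policy nx) : (k : ℕ) → Ω → (Fin k → Obs nx)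
  | 0, _ => Fin.elim0
  | k + 1, ω =>
      Fin.snoc (α := fun _ => Obs nx) (LinGaussSystem.output p k ω)
        (if ε k ω ≤ (p.act k (LinGaussSystem.output p k ω)).discardProb (S.X S₀ W k ω)
          then Sum.inr () else Sum.inl (S.X S₀ W k ω))

variable [MeasurableSpace Ω] (μ : Measure Ω)

/-- The mutual information `I(Z^K; Y^K)`, the Kullback–Leibler divergence of the joint law from
the product of the marginal laws. -/
noncomputable def LinGaussSystem.leakage (K : ℕ) (p : Policy nx) : ℝ≥0∞ :=
  InformationTheory.klDiv
    (μ.map fun ω => (S.output S₀ W ε p (K + 1) ω, fun t : Fin (K + 1) => S.Y S₀ W t ω))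
    ((μ.map (S.output S₀ W ε p (K + 1))).prod
      (μ.map fun ω => fun t : Fin (K + 1) => S.Y S₀ W t ω))

/-- The objective `∑_{k=0}^K E[(X_k - X̃_k)ᵀ (X_k - X̃_k)] + λ I(Z^K; Y^K)`. -/
noncomputable def LinGaussSystem.objective (lam : ℝ) (K : ℕ) (p : Policy nx) (r : Recon nx) :
    ℝ≥0∞ :=
  (∑ k ∈ Finset.range (K + 1), ∫⁻ ω, ENNReal.ofReal
    ((S.X S₀ W k ω - r.est k (S.output S₀ W ε p (k + 1) ω)) ⬝ᵥ
      (S.X S₀ W k ω - r.est k (S.output S₀ W ε p (k + 1) ω))) ∂μ)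
  + ENNReal.ofReal lam * S.leakage S₀ W ε μ K p

end Dynamics

/-! ### One-step loss and Bellman equation -/

/-- `P(N_k = 0 | Z^{k-1})` in terms of `x̃_{k|k-1}` and `P_{k|k-1}`. -/
noncomputable def silentProb {nx ny k : ℕ} (x : Fin nx → ℝ)
    (P : Matrix (HistIdx nx ny k) (HistIdx nx ny k) ℝ) (a : StageParam nx) : ℝ :=
  Real.sqrt (a.f.det / (a.f + P.toBlocks₁₁).det) *
    Real.exp (-(1 / 2) * ((a.g - x) ⬝ᵥ ((a.f + P.toBlocks₁₁)⁻¹ *ᵥ (a.g - x))))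

/-- The one-step loss `l_k(f_k, g_k, x̃_{k|k-1}, P_{k|k-1})`. -/
noncomputable def oneStepLoss {nx ny k : ℕ} (lam : ℝ) (x : Fin nx → ℝ)
    (P : Matrix (HistIdx nx ny k) (HistIdx nx ny k) ℝ) (a : StageParam nx) : ℝ :=
  silentProb x P a * (a.f * (a.f + P.toBlocks₁₁)⁻¹ * P.toBlocks₁₁).trace
    + lam * Real.log (Real.sqrt P.toBlocks₂₂.det)
    - lam * (1 - silentProb x P a) * Real.log (Real.sqrt
        (P.toBlocks₂₂ - P.toBlocks₂₁ * P.toBlocks₁₁⁻¹ * P.toBlocks₁₂).det)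
    - lam * silentProb x P a * Real.log (Real.sqrt
        (P.toBlocks₂₂ - P.toBlocks₂₁ * (a.f + P.toBlocks₁₁)⁻¹ * P.toBlocks₁₂).det)

/-- The total loss `L(f, g) = E[∑_{k=0}^K l_k(f_k, g_k, x̃_{k|k-1}, P_{k|k-1})]` of a policy. -/
noncomputable def LinGaussSystem.totalLoss {nx ny : ℕ} (S : LinGaussSystem nx ny) {Ω : Type*}
    (S₀ : Ω → StateIdx nx ny → ℝ) (W : ℕ → Ω → StateIdx nx ny → ℝ) (ε : ℕ → Ω → ℝ)
    [MeasurableSpace Ω] (μ : Measure Ω) (lam : ℝ) (K : ℕ) (p : Policy nx) : ℝ≥0∞ :=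
  ∑ k ∈ Finset.range (K + 1), ∫⁻ ω, ENNReal.ofReal (oneStepLoss lam
    (S.predBelief p k (S.output S₀ W ε p k ω)).x (S.predBelief p k (S.output S₀ W ε p k ω)).cov
    (p.act k (S.output S₀ W ε p k ω))) ∂μ

/-- `l_k(f, g, x̃_{k|k-1}, P_{k|k-1}) + E[V(x̃_{k+1|k}, P_{k+1|k}) | Z^{k-1}]` for the predicted
belief `b` and parameters `a = (f, g)`: under the conditional law, `X_k` is Gaussian with the mean
and covariance of the `x`-part of `b`, and the sample is discarded with the probability that `a`
prescribes. -/
noncomputable def LinGaussSystem.bellman {nx ny : ℕ} (S : LinGaussSystem nx ny) (lam : ℝ) {k : ℕ}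
    (V : (Fin nx → ℝ) → Matrix (HistIdx nx ny (k + 1)) (HistIdx nx ny (k + 1)) ℝ → ℝ≥0∞)
    (b : Belief nx ny k) (a : StageParam nx) : ℝ≥0∞ :=
  ENNReal.ofReal (oneStepLoss lam b.x b.cov a) +
    ∫⁻ x,
      (ENNReal.ofReal (a.discardProb x) *
          V (S.predict (b.update a (Sum.inr ()))).x (S.predict (b.update a (Sum.inr ()))).cov
        + ENNReal.ofReal (1 - a.discardProb x) *
          V (S.predict (b.update a (Sum.inl x))).x (S.predict (b.update a (Sum.inl x))).cov)
      ∂(gaussianVec b.x b.cov.toBlocks₁₁)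

/-- `V_0, …, V_{K+1}`, functions of the predicted mean `x̃_{k|k-1}` and covariance `P_{k|k-1}`,
solve the backward optimality equation with terminal condition `V_{K+1} = 0`. The predicted mean
`ỹ^{k|k-1}`, which enters the right-hand side through the belief recursion, is arbitrary. -/
def LinGaussSystem.SolvesBellman {nx ny : ℕ} (S : LinGaussSystem nx ny) (lam : ℝ) (K : ℕ)
    (V : (k : ℕ) → (Fin nx → ℝ) → Matrix (HistIdx nx ny k) (HistIdx nx ny k) ℝ → ℝ≥0∞) : Prop :=
  (∀ x P, V (K + 1) x P = 0) ∧
  ∀ k ≤ K, ∀ b : Belief nx ny k, b.cov.PosDef →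
    V k b.x b.cov = ⨅ a : StageParam nx, S.bellman lam (V (k + 1)) b a

/-- A feedback law: measurable functions `f_k(x̃, P)`, `g_k(x̃, P)`. -/
structure Feedback (nx ny : ℕ) where
  act : (k : ℕ) → (Fin nx → ℝ) → Matrix (HistIdx nx ny k) (HistIdx nx ny k) ℝ → StageParam nx
  measurable_f : ∀ k i j, Measurable
    fun q : (Fin nx → ℝ) × (HistIdx nx ny k → HistIdx nx ny k → ℝ) =>
      (act k q.1 (Matrix.of q.2)).f i j
  measurable_g : ∀ k, Measurable
    fun q : (Fin nx → ℝ) × (HistIdx nx ny k → HistIdx nx ny k → ℝ) =>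
      (act k q.1 (Matrix.of q.2)).g

/-- The policy `p` is generated by the feedback law `φ`: its parameters at time `k` are
`φ_k(x̃_{k|k-1}, P_{k|k-1})`, along the belief recursion that `p` itself drives. -/
def LinGaussSystem.IsGeneratedBy {nx ny : ℕ} (S : LinGaussSystem nx ny) (p : Policy nx)
    (φ : Feedback nx ny) : Prop :=
  ∀ k z, p.act k z = φ.act k (S.predBelief p k z).x (S.predBelief p k z).cov

end PrivacySampling

open PrivacySampling

/-!
The discarding probability `exp (-½ (x - g)ᵀ f⁻¹ (x - g))` has the shape of a Gaussian likelihood.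
Multiplying a Gaussian density of `(X_k, Y^k)` by it and completing the square (`silent_quadratic`,
`silent_det`) gives the silence probability `q` times another Gaussian density, whose parameters are
those of the silent update (`lintegral_discardProb_mul`). A transmission conditions a Gaussian law on
its `x`-coordinates, which removes `x` from the posterior and leaves the Schur complement
(`lintegral_gaussianVec_disintegrate`), and the time update is an affine map with independent noise
(`lintegral_predict`). Since `ε_k` and `W_k` are independent of what happened before, induction on `k`
identifies the joint law of the output and `(X_k, Y^k)` as the law of the output followed by the
Gaussian law of the predicted belief (`IsDriving.map_output_XYhist`). All integrals are taken with
values in `[0, ∞]`, so no integrability has to be established along the way.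

The stage loss is the mean squared error of the filtered mean plus `λ` times the expected decrease of
the entropy of `Y^k` (`oneStepLoss_eq`); both are nonnegative, since an observation can only decrease
the covariance. If `Y` evolves autonomously, a time update adds the same constant to the entropy of
the private history under every belief (`det_predict_toBlocks₂₂`), so the decreases telescope to the
difference between the prior entropy and the posterior entropy (`totalInfoGain_succ`). The
log-likelihood ratio of the joint law of `(Z^K, Y^K)` to the product of the marginals is this
nonnegative difference plus half the difference of two squared Mahalanobis distances with the same
finite mean. Hence the mutual information is the expected total information gain, also if that should
be infinite (`klDiv_withDensity_eq_lintegral`, `IsDriving.leakage_eq`).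

For the control problem, the predicted covariance after a stage depends on the parameters and on
whether the sample was discarded, but not on the transmitted value, and the stage cost involves the
predicted mean and the centre `g` through their difference only (`stageCost_shift`). Therefore the
value function is a function `costToGo` of the predicted covariance. It is an infimum of upper
semicontinuous functions, hence upper semicontinuous and in particular measurable
(`upperSemicontinuous_costToGo`), and nearly optimal parameters are found by searching a countable
dense set, which makes them a measurable function of the belief (`exists_measurable_stageCost_le`).
Averaging the optimality equation along a policy shows that its total loss is the optimal value plus
the expected amounts by which its stages miss the infimum (`IsDriving.totalLoss_eq`). The value of the
problem, the criterion for optimality and the sufficiency of feedback laws are read off from this.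

An optimal policy attains the infima almost surely along its own covariances, which need not give a
measurable choice of minimizers on all covariances. But if one minimizer is fixed for each covariance,
only countably many covariances can be reached from the initial one: two from each, by silence and by
a transmission. A feedback law that takes the minimizers on this countable set and a constant elsewhere
is measurable and optimal (`bestFeedback`, `IsDriving.ae_excess_bestFeedback`).
-/

set_option linter.unusedSectionVars false
set_option linter.style.haveILetI false

namespace PrivacySampling

/-! ### Matrix algebra of the Gaussian update -/

section MatrixAlgebra

variable {ι m n : Type*} [Fintype ι] [DecidableEq ι] [Fintype m] [DecidableEq m] [Fintype n]
  [DecidableEq n]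

open MatrixOrder in
theorem exists_eq_mul_transpose_of_posSemidef {A : Matrix ι ι ℝ} (hA : A.PosSemidef) :
    ∃ B : Matrix ι ι ℝ, A = B * Bᵀ := by
  obtain ⟨C, hC⟩ := CStarAlgebra.nonneg_iff_eq_star_mul_self.mp hA.nonneg
  exact ⟨Cᵀ, by simpa [star_eq_conjTranspose, conjTranspose_eq_transpose_of_trivial] using hC⟩

theorem posSemidef_congr {A : Matrix m m ℝ} (hA : A.PosSemidef) (B : Matrix n m ℝ) :
    (B * A * Bᵀ).PosSemidef := by
  simpa [conjTranspose_eq_transpose_of_trivial] using hA.mul_mul_conjTranspose_same B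

/-- In an orthonormal eigenbasis of `A` the determinant is the product of the numbers `1 + μᵢ`, where
`μᵢ ≥ 0` are the eigenvalues. -/
theorem one_le_det_one_add_of_posSemidef {A : Matrix ι ι ℝ} (hA : A.PosSemidef) :
    1 ≤ (1 + A).det := by
  have hH := hA.isHermitian
  set U : Matrix ι ι ℝ := (hH.eigenvectorUnitary : Matrix ι ι ℝ) with hU
  have hs := hH.spectral_theorem
  have hUU : U * star U = 1 := by
    simp [hU]
  have h1 : 1 + A = U * (1 + diagonal (hH.eigenvalues)) * star U := by
    have : A = U * diagonal (hH.eigenvalues) * star U := by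
      conv_lhs => rw [hs]
      simp [Unitary.conjStarAlgAut_apply, hU]
    rw [mul_add, add_mul, ← this, mul_one, hUU]
  rw [h1, det_mul_right_comm, hUU, one_mul, ← diagonal_one, diagonal_add, det_diagonal]
  exact Finset.one_le_prod fun i _ => by simpa using hA.eigenvalues_nonneg i

/-- The determinant is monotone: with `A⁻¹ = C Cᵀ` the quotient `det (A + B) / det A` is
`det (1 + Cᵀ B C)`. -/
theorem det_le_det_add_of_posSemidef {A B : Matrix ι ι ℝ} (hA : A.PosDef) (hB : B.PosSemidef) :
    A.det ≤ (A + B).det := by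
  obtain ⟨C, hC⟩ := exists_eq_mul_transpose_of_posSemidef hA.inv.posSemidef
  have hdA := hA.det_pos
  have hu : IsUnit A.det := hdA.ne'.isUnit
  have h1 : (A + B).det = A.det * (1 + Cᵀ * B * Cᵀᵀ).det := by
    have h2 : A + B = (1 + B * A⁻¹) * A := by
      rw [add_mul, one_mul, mul_assoc, nonsing_inv_mul _ hu, mul_one]
    rw [mul_assoc Cᵀ, det_one_add_mul_comm, mul_assoc B, transpose_transpose, ← hC, h2, det_mul,
      mul_comm]
  rw [h1]
  exact le_mul_of_one_le_right hdA.le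
    (one_le_det_one_add_of_posSemidef (posSemidef_congr hB Cᵀ))

theorem _root_.Matrix.PosDef.toBlocks₁₁ {P : Matrix (m ⊕ n) (m ⊕ n) ℝ} (hP : P.PosDef) :
    P.toBlocks₁₁.PosDef := hP.submatrix (e := Sum.inl) Sum.inl_injective

theorem _root_.Matrix.PosDef.toBlocks₂₂ {P : Matrix (m ⊕ n) (m ⊕ n) ℝ} (hP : P.PosDef) :
    P.toBlocks₂₂.PosDef := hP.submatrix (e := Sum.inr) Sum.inr_injective

theorem toBlocks₁₂_transpose {P : Matrix (m ⊕ n) (m ⊕ n) ℝ} (hP : P.IsHermitian) :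
    P.toBlocks₁₂ᵀ = P.toBlocks₂₁ := by
  ext i j
  exact hP.apply _ _

theorem toBlocks₂₁_transpose {P : Matrix (m ⊕ n) (m ⊕ n) ℝ} (hP : P.IsHermitian) :
    P.toBlocks₂₁ᵀ = P.toBlocks₁₂ := by
  ext i j
  exact hP.apply _ _

theorem _root_.Matrix.PosDef.transpose_eq {P : Matrix ι ι ℝ} (hP : P.PosDef) : Pᵀ = P := by
  simpa [conjTranspose_eq_transpose_of_trivial] using hP.isHermitian.eq

/-- The Schur complement of the `x`-block of a positive definite matrix is positive definite. -/
theorem schur_posDef {P : Matrix (m ⊕ n) (m ⊕ n) ℝ} (hP : P.PosDef) :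
    (P.toBlocks₂₂ - P.toBlocks₂₁ * P.toBlocks₁₁⁻¹ * P.toBlocks₁₂).PosDef := by
  have h11 := hP.toBlocks₁₁
  haveI : Invertible P.toBlocks₁₁ := h11.isUnit.invertible
  have hb : P.toBlocks₂₁ = P.toBlocks₁₂ᴴ := by
    rw [conjTranspose_eq_transpose_of_trivial, toBlocks₁₂_transpose hP.isHermitian]
  have hsd : (P.toBlocks₂₂ - P.toBlocks₂₁ * P.toBlocks₁₁⁻¹ * P.toBlocks₁₂).PosSemidef := by
    rw [hb, ← PosDef.fromBlocks₁₁ _ _ h11, ← hb, fromBlocks_toBlocks]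
    exact hP.posSemidef
  rw [hsd.posDef_iff_det_ne_zero]
  intro h0
  have := det_fromBlocks₁₁ P.toBlocks₁₁ P.toBlocks₁₂ P.toBlocks₂₁ P.toBlocks₂₂
  rw [fromBlocks_toBlocks, invOf_eq_nonsing_inv, h0, mul_zero] at this
  exact hP.det_pos.ne' this

/-- The matrix of the embedding `x ↦ (x, 0)`. -/
def embX (m n : Type*) [DecidableEq m] : Matrix (m ⊕ n) m ℝ := fromRows 1 0

theorem embX_mul_mul (F : Matrix m m ℝ) :
    embX m n * F * (embX m n)ᵀ = fromBlocks F 0 0 0 := by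
  simp [embX, transpose_fromRows, fromRows_mul, mul_fromCols,
    ← fromRows_fromCols_eq_fromBlocks]
  ext (i | i) (j | j) <;> simp

theorem embX_transpose_mul_mul (P : Matrix (m ⊕ n) (m ⊕ n) ℝ) :
    (embX m n)ᵀ * P * embX m n = P.toBlocks₁₁ := by
  ext i j
  simp [embX, mul_apply, Fintype.sum_sum_type, one_apply, toBlocks₁₁]

theorem embX_transpose_mulVec (v : m ⊕ n → ℝ) : (embX m n)ᵀ *ᵥ v = fun i => v (Sum.inl i) := by
  ext i
  simp [embX, mulVec, dotProduct, Fintype.sum_sum_type, one_apply]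

/-- Woodbury's formula for the covariance matrix after a silent stage. -/
theorem silent_cov_eq {P : Matrix (m ⊕ n) (m ⊕ n) ℝ} (hP : P.PosDef) {f : Matrix m m ℝ}
    (hf : f.PosDef) :
    (P * fromBlocks f⁻¹ 0 0 0 + 1)⁻¹ * P =
      P - P * embX m n * (f + P.toBlocks₁₁)⁻¹ * (embX m n)ᵀ * P := by
  have hPu : IsUnit P.det := hP.det_pos.ne'.isUnit
  have hfu : IsUnit f.det := hf.det_pos.ne'.isUnit
  have h := add_mul_mul_inv_eq_sub P⁻¹ (embX m n) f⁻¹ (embX m n)ᵀ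
    hP.inv.isUnit hf.inv.isUnit (by
      rw [nonsing_inv_nonsing_inv _ hPu, nonsing_inv_nonsing_inv _ hfu, embX_transpose_mul_mul]
      exact (hf.add hP.toBlocks₁₁).isUnit)
  rw [nonsing_inv_nonsing_inv _ hPu, nonsing_inv_nonsing_inv _ hfu, embX_transpose_mul_mul] at h
  rw [← h, ← embX_mul_mul]
  have : P * (embX m n * f⁻¹ * (embX m n)ᵀ) + 1 =
      P * (P⁻¹ + embX m n * f⁻¹ * (embX m n)ᵀ) := by
    rw [Matrix.mul_add, mul_nonsing_inv _ hPu, add_comm]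
  rw [this, Matrix.mul_inv_rev, Matrix.mul_assoc, nonsing_inv_mul _ hPu, Matrix.mul_one]

theorem fromBlocks_inv_posSemidef {f : Matrix m m ℝ} (hf : f.PosDef) :
    (fromBlocks f⁻¹ 0 0 0 : Matrix (m ⊕ n) (m ⊕ n) ℝ).PosSemidef := by
  rw [← embX_mul_mul]
  exact posSemidef_congr hf.inv.posSemidef _

theorem silent_prec_posDef {P : Matrix (m ⊕ n) (m ⊕ n) ℝ} (hP : P.PosDef) {f : Matrix m m ℝ}
    (hf : f.PosDef) : (P⁻¹ + fromBlocks f⁻¹ 0 0 0).PosDef :=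
  hP.inv.add_posSemidef (fromBlocks_inv_posSemidef hf)

theorem silent_cov_eq_inv {P : Matrix (m ⊕ n) (m ⊕ n) ℝ} (hP : P.PosDef) (f : Matrix m m ℝ) :
    (P * fromBlocks f⁻¹ 0 0 0 + 1)⁻¹ * P = (P⁻¹ + fromBlocks f⁻¹ 0 0 0)⁻¹ := by
  have hPu : IsUnit P.det := hP.det_pos.ne'.isUnit
  have : P * (fromBlocks f⁻¹ 0 0 0) + 1 = P * (P⁻¹ + fromBlocks f⁻¹ 0 0 0) := by
    rw [Matrix.mul_add, mul_nonsing_inv _ hPu, add_comm]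
  rw [this, Matrix.mul_inv_rev, Matrix.mul_assoc, nonsing_inv_mul _ hPu, Matrix.mul_one]

theorem silent_cov_posDef {P : Matrix (m ⊕ n) (m ⊕ n) ℝ} (hP : P.PosDef) {f : Matrix m m ℝ}
    (hf : f.PosDef) : ((P * fromBlocks f⁻¹ 0 0 0 + 1)⁻¹ * P).PosDef := by
  rw [silent_cov_eq_inv hP]
  exact (silent_prec_posDef hP hf).inv

theorem silent_gain_isUnit {P : Matrix (m ⊕ n) (m ⊕ n) ℝ} (hP : P.PosDef) {f : Matrix m m ℝ}
    (hf : f.PosDef) : IsUnit (P * fromBlocks f⁻¹ 0 0 0 + 1).det := by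
  have hPu : IsUnit P.det := hP.det_pos.ne'.isUnit
  have : P * (fromBlocks f⁻¹ 0 0 0) + 1 = P * (P⁻¹ + fromBlocks f⁻¹ 0 0 0) := by
    rw [Matrix.mul_add, mul_nonsing_inv _ hPu, add_comm]
  rw [this, det_mul]
  exact hPu.mul (silent_prec_posDef hP hf).det_pos.ne'.isUnit

/-- The mean after a silent stage, written with the Kalman gain. -/
theorem silent_mean_eq {P : Matrix (m ⊕ n) (m ⊕ n) ℝ} (hP : P.PosDef) {f : Matrix m m ℝ}
    (hf : f.PosDef) (μ : m ⊕ n → ℝ) (g : m → ℝ) :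
    (P * fromBlocks f⁻¹ 0 0 0 + 1)⁻¹ *ᵥ
        ((P * fromBlocks f⁻¹ 0 0 0) *ᵥ Sum.elim g 0 + μ) =
      μ + (P * embX m n * (f + P.toBlocks₁₁)⁻¹) *ᵥ (g - fun i => μ (Sum.inl i)) := by
  have hfu : IsUnit f.det := hf.det_pos.ne'.isUnit
  have hGu : IsUnit (f + P.toBlocks₁₁).det := (hf.add hP.toBlocks₁₁).det_pos.ne'.isUnit
  set D := P * (fromBlocks f⁻¹ 0 0 0 : Matrix (m ⊕ n) (m ⊕ n) ℝ) with hD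
  set w := (P * embX m n * (f + P.toBlocks₁₁)⁻¹) *ᵥ (g - fun i => μ (Sum.inl i)) with hw
  have hDe : D = P * embX m n * f⁻¹ * (embX m n)ᵀ := by
    rw [hD, ← embX_mul_mul]; simp only [Matrix.mul_assoc]
  have key : (D + 1) *ᵥ (μ + w) = D *ᵥ Sum.elim g 0 + μ := by
    have h1 : D *ᵥ Sum.elim g 0 = D *ᵥ μ + (P * embX m n * f⁻¹) *ᵥ
        (g - fun i => μ (Sum.inl i)) := by
      rw [hDe, ← mulVec_mulVec (Sum.elim g 0), ← mulVec_mulVec μ, embX_transpose_mulVec, embX_transpose_mulVec,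
        ← mulVec_add]
      congr 1
      ext i; simp
    have h2 : D *ᵥ w + w = (P * embX m n * f⁻¹) *ᵥ (g - fun i => μ (Sum.inl i)) := by
      rw [hw, mulVec_mulVec, ← add_mulVec]
      congr 1
      have : D * (P * embX m n * (f + P.toBlocks₁₁)⁻¹) =
          P * embX m n * f⁻¹ * P.toBlocks₁₁ * (f + P.toBlocks₁₁)⁻¹ := by
        rw [hDe, ← embX_transpose_mul_mul P]; simp only [Matrix.mul_assoc]
      rw [this]
      calc _ = P * embX m n * (f⁻¹ * (f + P.toBlocks₁₁) * (f + P.toBlocks₁₁)⁻¹) := by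
            rw [Matrix.mul_add, nonsing_inv_mul _ hfu]; simp only [Matrix.mul_assoc, Matrix.add_mul, Matrix.mul_add, Matrix.one_mul]
            rw [add_comm]
        _ = _ := by rw [Matrix.mul_assoc f⁻¹, mul_nonsing_inv _ hGu, Matrix.mul_one]
    rw [mulVec_add, add_mulVec, add_mulVec, one_mulVec, one_mulVec, h1]
    rw [← h2]; abel
  rw [← key, mulVec_mulVec, nonsing_inv_mul _ (silent_gain_isUnit hP hf), one_mulVec]

theorem silent_cov_toBlocks₁₁ {P : Matrix (m ⊕ n) (m ⊕ n) ℝ} (hP : P.PosDef) {f : Matrix m m ℝ}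
    (hf : f.PosDef) :
    ((P * fromBlocks f⁻¹ 0 0 0 + 1)⁻¹ * P).toBlocks₁₁ =
      f * (f + P.toBlocks₁₁)⁻¹ * P.toBlocks₁₁ := by
  have hGu : IsUnit (f + P.toBlocks₁₁).det := (hf.add hP.toBlocks₁₁).det_pos.ne'.isUnit
  rw [silent_cov_eq hP hf, ← embX_transpose_mul_mul (P - _)]
  have : (embX m n)ᵀ * (P - P * embX m n * (f + P.toBlocks₁₁)⁻¹ * (embX m n)ᵀ * P) * embX m n =
      P.toBlocks₁₁ - P.toBlocks₁₁ * (f + P.toBlocks₁₁)⁻¹ * P.toBlocks₁₁ := by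
    rw [show P.toBlocks₁₁ * (f + P.toBlocks₁₁)⁻¹ * P.toBlocks₁₁ = ((embX m n)ᵀ * P * embX m n) *
      (f + P.toBlocks₁₁)⁻¹ * ((embX m n)ᵀ * P * embX m n) by rw [embX_transpose_mul_mul P],
      ← show (embX m n)ᵀ * P * embX m n = P.toBlocks₁₁ from embX_transpose_mul_mul P]
    generalize (f + (embX m n)ᵀ * P * embX m n)⁻¹ = G
    simp only [Matrix.mul_sub, Matrix.sub_mul, Matrix.mul_assoc]
  rw [this]
  conv_lhs => enter [1]; rw [← Matrix.one_mul P.toBlocks₁₁, ← mul_nonsing_inv _ hGu]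
  rw [← Matrix.sub_mul, ← Matrix.sub_mul, add_sub_cancel_right]

theorem silent_cov_toBlocks₂₂ {P : Matrix (m ⊕ n) (m ⊕ n) ℝ} (hP : P.PosDef) {f : Matrix m m ℝ}
    (hf : f.PosDef) :
    ((P * fromBlocks f⁻¹ 0 0 0 + 1)⁻¹ * P).toBlocks₂₂ =
      P.toBlocks₂₂ - P.toBlocks₂₁ * (f + P.toBlocks₁₁)⁻¹ * P.toBlocks₁₂ := by
  rw [silent_cov_eq hP hf]
  have h1 : P * embX m n = fromRows P.toBlocks₁₁ P.toBlocks₂₁ := by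
    ext (i | i) j <;> simp [embX, mul_apply, Fintype.sum_sum_type, one_apply, toBlocks₁₁, toBlocks₂₁]
  have h2 : (embX m n)ᵀ * P = fromCols P.toBlocks₁₁ P.toBlocks₁₂ := by
    ext i (j | j) <;> simp [embX, mul_apply, Fintype.sum_sum_type, one_apply, toBlocks₁₁, toBlocks₁₂]
  rw [Matrix.mul_assoc (P * embX m n * _), h2, h1, fromRows_mul, fromRows_mul_fromCols]
  ext i j
  simp [toBlocks₂₂]

/-- Determinant identity of a silent stage: the ratio of the prior and the posterior normalization
constants is the ratio of those of the observation. -/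
theorem silent_det {P : Matrix (m ⊕ n) (m ⊕ n) ℝ} (hP : P.PosDef) {f : Matrix m m ℝ}
    (hf : f.PosDef) :
    ((P * fromBlocks f⁻¹ 0 0 0 + 1)⁻¹ * P).det * (f + P.toBlocks₁₁).det = P.det * f.det := by
  have hfu : IsUnit f.det := hf.det_pos.ne'.isUnit
  have hu := silent_gain_isUnit hP hf
  have h1 : (P * fromBlocks f⁻¹ 0 0 0 + 1).det * f.det = (f + P.toBlocks₁₁).det := by
    rw [← embX_mul_mul, add_comm, Matrix.mul_assoc (embX m n), ← Matrix.mul_assoc P,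
      det_one_add_mul_comm, Matrix.mul_assoc f⁻¹, ← Matrix.mul_assoc (embX m n)ᵀ, embX_transpose_mul_mul,
      mul_comm, ← det_mul, Matrix.mul_add, Matrix.mul_one, ← Matrix.mul_assoc f,
      mul_nonsing_inv _ hfu, Matrix.one_mul]
  rw [← h1, det_mul, det_nonsing_inv]
  have := Ring.inverse_mul_cancel _ hu
  linear_combination (P.det * f.det) * this

/-- Completing the square for a silent stage. -/
theorem silent_quadratic {P : Matrix (m ⊕ n) (m ⊕ n) ℝ} (hP : P.PosDef) {f : Matrix m m ℝ}
    (hf : f.PosDef) (μ v : m ⊕ n → ℝ) (g : m → ℝ) :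
    (v - μ) ⬝ᵥ (P⁻¹ *ᵥ (v - μ)) +
        ((fun i => v (Sum.inl i)) - g) ⬝ᵥ (f⁻¹ *ᵥ ((fun i => v (Sum.inl i)) - g)) =
      (v - ((P * fromBlocks f⁻¹ 0 0 0 + 1)⁻¹ *ᵥ
        ((P * fromBlocks f⁻¹ 0 0 0) *ᵥ Sum.elim g 0 + μ))) ⬝ᵥ
        (((P * fromBlocks f⁻¹ 0 0 0 + 1)⁻¹ * P)⁻¹ *ᵥ (v - ((P * fromBlocks f⁻¹ 0 0 0 + 1)⁻¹ *ᵥ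
        ((P * fromBlocks f⁻¹ 0 0 0) *ᵥ Sum.elim g 0 + μ)))) +
      (g - fun i => μ (Sum.inl i)) ⬝ᵥ
        ((f + P.toBlocks₁₁)⁻¹ *ᵥ (g - fun i => μ (Sum.inl i))) := by
  have hfu : IsUnit f.det := hf.det_pos.ne'.isUnit
  have hPu : IsUnit P.det := hP.det_pos.ne'.isUnit
  have hGp := hf.add hP.toBlocks₁₁
  have hGu : IsUnit (f + P.toBlocks₁₁).det := hGp.det_pos.ne'.isUnit
  have hΛp := silent_prec_posDef hP hf
  rw [silent_mean_eq hP hf, silent_cov_eq_inv hP, nonsing_inv_nonsing_inv _ hΛp.det_pos.ne'.isUnit]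
  set δ := g - fun i => μ (Sum.inl i) with hδ
  set u := v - μ with hu
  set Λ := P⁻¹ + fromBlocks f⁻¹ 0 0 0 with hΛ
  set w := (P * embX m n * (f + P.toBlocks₁₁)⁻¹) *ᵥ δ with hw
  have e1 : v - (μ + w) = u - w := by rw [hu]; abel
  have e2 : (fun i => v (Sum.inl i)) - g = (embX m n)ᵀ *ᵥ u - δ := by
    rw [embX_transpose_mulVec]; ext i; simp [hδ, hu]
  have e3 : Λ *ᵥ w = embX m n *ᵥ (f⁻¹ *ᵥ δ) := by
    rw [hw, mulVec_mulVec, mulVec_mulVec]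
    congr 1
    rw [hΛ, ← embX_mul_mul]
    calc (P⁻¹ + embX m n * f⁻¹ * (embX m n)ᵀ) * (P * embX m n * (f + P.toBlocks₁₁)⁻¹)
        = (P⁻¹ * P) * embX m n * (f + P.toBlocks₁₁)⁻¹ +
          embX m n * (f⁻¹ * ((embX m n)ᵀ * P * embX m n)) * (f + P.toBlocks₁₁)⁻¹ := by
            simp only [Matrix.add_mul, Matrix.mul_assoc]
      _ = embX m n * ((f⁻¹ * f + f⁻¹ * P.toBlocks₁₁) * (f + P.toBlocks₁₁)⁻¹) := by
            rw [embX_transpose_mul_mul, nonsing_inv_mul _ hPu, nonsing_inv_mul _ hfu]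
            simp only [Matrix.add_mul, Matrix.mul_add, Matrix.mul_assoc, Matrix.one_mul]
      _ = embX m n * f⁻¹ := by
            rw [← Matrix.mul_add, Matrix.mul_assoc f⁻¹, mul_nonsing_inv _ hGu, Matrix.mul_one]
  have e4 : Λ = P⁻¹ + embX m n * f⁻¹ * (embX m n)ᵀ := by rw [hΛ, embX_mul_mul]
  have hsymm : ∀ a b : m ⊕ n → ℝ, a ⬝ᵥ (Λ *ᵥ b) = b ⬝ᵥ (Λ *ᵥ a) := fun a b => by
    rw [dotProduct_mulVec, ← mulVec_transpose, hΛp.transpose_eq, dotProduct_comm]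
  have hsymf : ∀ a b : m → ℝ, a ⬝ᵥ (f⁻¹ *ᵥ b) = b ⬝ᵥ (f⁻¹ *ᵥ a) := fun a b => by
    rw [dotProduct_mulVec, ← mulVec_transpose, hf.inv.transpose_eq, dotProduct_comm]
  have hadj : ∀ (a : m ⊕ n → ℝ) (b : m → ℝ), a ⬝ᵥ (embX m n *ᵥ b) = ((embX m n)ᵀ *ᵥ a) ⬝ᵥ b :=
    fun a b => by rw [dotProduct_mulVec, ← mulVec_transpose]
  have e5 : (embX m n)ᵀ *ᵥ w = (P.toBlocks₁₁ * (f + P.toBlocks₁₁)⁻¹) *ᵥ δ := by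
    rw [hw, mulVec_mulVec, ← embX_transpose_mul_mul P]; simp only [Matrix.mul_assoc]
  have e6 : (P.toBlocks₁₁ * (f + P.toBlocks₁₁)⁻¹) *ᵥ δ = δ - f *ᵥ ((f + P.toBlocks₁₁)⁻¹ *ᵥ δ) := by
    rw [eq_sub_iff_add_eq, mulVec_mulVec, ← add_mulVec, ← Matrix.add_mul, add_comm P.toBlocks₁₁,
      mul_nonsing_inv _ hGu, one_mulVec]
  have e7 : w ⬝ᵥ (Λ *ᵥ w) = δ ⬝ᵥ (f⁻¹ *ᵥ δ) - δ ⬝ᵥ ((f + P.toBlocks₁₁)⁻¹ *ᵥ δ) := by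
    rw [e3, hadj, e5, e6, sub_dotProduct]
    congr 1
    rw [hsymf, mulVec_mulVec _ f⁻¹, nonsing_inv_mul _ hfu, one_mulVec]
  have e8 : u ⬝ᵥ (Λ *ᵥ w) = ((embX m n)ᵀ *ᵥ u) ⬝ᵥ (f⁻¹ *ᵥ δ) := by
    rw [e3, hadj]
  have e9 : u ⬝ᵥ (Λ *ᵥ u) = u ⬝ᵥ (P⁻¹ *ᵥ u) +
      ((embX m n)ᵀ *ᵥ u) ⬝ᵥ (f⁻¹ *ᵥ ((embX m n)ᵀ *ᵥ u)) := by
    rw [e4, add_mulVec, dotProduct_add, ← mulVec_mulVec, ← mulVec_mulVec, hadj]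
  rw [e1, e2]
  simp only [mulVec_sub, sub_dotProduct, dotProduct_sub]
  rw [hsymm w u, e7, e8, e9, hsymf δ]
  ring

end MatrixAlgebra

/-! ### Gaussian laws on coordinate spaces -/

section Gaussian

variable {ι κ ι' : Type*} [Fintype ι] [DecidableEq ι] [Fintype κ] [DecidableEq κ]
  [Fintype ι'] [DecidableEq ι']

theorem dotProduct_mulVec_transpose {α β : Type*} [Fintype α] [Fintype β] (x : α → ℝ)
    (R : Matrix α β ℝ) (y : β → ℝ) : x ⬝ᵥ (R *ᵥ y) = (Rᵀ *ᵥ x) ⬝ᵥ y := by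
  rw [dotProduct_mulVec, ← mulVec_transpose]

instance (m : ι → ℝ) (P : Matrix ι ι ℝ) : IsProbabilityMeasure (gaussianVec m P) := by
  unfold gaussianVec
  exact Measure.isProbabilityMeasure_map (by fun_prop)

/-- The characteristic function of a Gaussian law, whose covariance may be singular. -/
theorem integral_cexp_gaussianVec (m : ι → ℝ) {P : Matrix ι ι ℝ} (hP : P.PosSemidef)
    (t : ι → ℝ) :
    ∫ x, Complex.exp (↑(t ⬝ᵥ x) * Complex.I) ∂(gaussianVec m P) =
      Complex.exp (↑(t ⬝ᵥ m) * Complex.I - ↑(t ⬝ᵥ P *ᵥ t) / 2) := by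
  have h := charFun_multivariateGaussian (μ := WithLp.toLp 2 m) hP (WithLp.toLp 2 t)
  rw [charFun_apply] at h
  rw [gaussianVec, integral_map (by fun_prop) (by fun_prop)]
  simpa [EuclideanSpace.inner_eq_star_dotProduct, dotProduct_comm] using h

/-- A finite measure with the characteristic function of a Gaussian law is that Gaussian law. -/
theorem eq_gaussianVec_of_integral_cexp {ν : Measure (ι → ℝ)} [IsFiniteMeasure ν] {m : ι → ℝ}
    {P : Matrix ι ι ℝ} (hP : P.PosSemidef)
    (h : ∀ t : ι → ℝ, ∫ x, Complex.exp (↑(t ⬝ᵥ x) * Complex.I) ∂ν =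
      Complex.exp (↑(t ⬝ᵥ m) * Complex.I - ↑(t ⬝ᵥ P *ᵥ t) / 2)) :
    ν = gaussianVec m P := by
  have h1 : ν.map (WithLp.toLp 2) = multivariateGaussian (WithLp.toLp 2 m) P := by
    refine Measure.ext_of_charFun ?_
    ext t
    rw [charFun_multivariateGaussian hP, charFun_apply, integral_map (by fun_prop) (by fun_prop)]
    have := h t.ofLp
    simpa [EuclideanSpace.inner_eq_star_dotProduct, dotProduct_comm] using this
  rw [gaussianVec, ← h1, Measure.map_map (by fun_prop) (by fun_prop)]
  simp [Function.comp_def]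

/-- A linear combination of two independent Gaussian vectors is Gaussian. -/
theorem gaussianVec_prod_map (m : ι → ℝ) {P : Matrix ι ι ℝ} (hP : P.PosSemidef)
    (m' : κ → ℝ) {P' : Matrix κ κ ℝ} (hP' : P'.PosSemidef)
    (M : Matrix ι' ι ℝ) (N : Matrix ι' κ ℝ) (c : ι' → ℝ) :
    ((gaussianVec m P).prod (gaussianVec m' P')).map
        (fun p => M *ᵥ p.1 + N *ᵥ p.2 + c) =
      gaussianVec (M *ᵥ m + N *ᵥ m' + c) (M * P * Mᵀ + N * P' * Nᵀ) := by
  have hmeas : Measurable fun p : (ι → ℝ) × (κ → ℝ) => M *ᵥ p.1 + N *ᵥ p.2 + c := by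
    refine Continuous.measurable ?_
    fun_prop
  haveI : IsProbabilityMeasure (((gaussianVec m P).prod (gaussianVec m' P')).map
        (fun p => M *ᵥ p.1 + N *ᵥ p.2 + c)) := Measure.isProbabilityMeasure_map hmeas.aemeasurable
  refine eq_gaussianVec_of_integral_cexp ((posSemidef_congr hP M).add (posSemidef_congr hP' N)) ?_
  intro t
  rw [integral_map hmeas.aemeasurable (by fun_prop)]
  have h1 : ∀ p : (ι → ℝ) × (κ → ℝ),
      Complex.exp (↑(t ⬝ᵥ (M *ᵥ p.1 + N *ᵥ p.2 + c)) * Complex.I) =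
      Complex.exp (↑((Mᵀ *ᵥ t) ⬝ᵥ p.1) * Complex.I) *
        Complex.exp (↑((Nᵀ *ᵥ t) ⬝ᵥ p.2) * Complex.I) * Complex.exp (↑(t ⬝ᵥ c) * Complex.I) := by
    intro p
    rw [← Complex.exp_add, ← Complex.exp_add, dotProduct_add, dotProduct_add, dotProduct_mulVec_transpose t M,
      dotProduct_mulVec_transpose t N]
    congr 1
    push_cast
    ring
  simp_rw [h1]
  rw [integral_mul_const, integral_prod_mul
    (f := fun x : ι → ℝ => Complex.exp (↑((Mᵀ *ᵥ t) ⬝ᵥ x) * Complex.I))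
    (g := fun x : κ → ℝ => Complex.exp (↑((Nᵀ *ᵥ t) ⬝ᵥ x) * Complex.I)),
    integral_cexp_gaussianVec m hP, integral_cexp_gaussianVec m' hP', ← Complex.exp_add,
    ← Complex.exp_add]
  congr 1
  rw [add_mulVec, dotProduct_add, ← mulVec_mulVec, ← mulVec_mulVec, ← mulVec_mulVec,
    ← mulVec_mulVec, dotProduct_add, dotProduct_add, dotProduct_mulVec_transpose t M,
    dotProduct_mulVec_transpose t N, dotProduct_mulVec_transpose t M,
    dotProduct_mulVec_transpose t N]
  push_cast
  ring

/-- The image of a Gaussian vector under an affine map is Gaussian. -/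
theorem gaussianVec_map (m : ι → ℝ) {P : Matrix ι ι ℝ} (hP : P.PosSemidef)
    (M : Matrix ι' ι ℝ) (c : ι' → ℝ) :
    (gaussianVec m P).map (fun x => M *ᵥ x + c) = gaussianVec (M *ᵥ m + c) (M * P * Mᵀ) := by
  have h := gaussianVec_prod_map m hP (0 : Fin 0 → ℝ) PosSemidef.one M 0 c
  have h2 : (fun p : (ι → ℝ) × (Fin 0 → ℝ) => M *ᵥ p.1 + (0 : Matrix ι' (Fin 0) ℝ) *ᵥ p.2 + c) =
      (fun x => M *ᵥ x + c) ∘ Prod.fst := by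
    ext p; simp
  rw [h2, ← Measure.map_map (by fun_prop) (by fun_prop), Measure.map_fst_prod] at h
  simpa using h

theorem gaussianVec_zero_one :
    gaussianVec (0 : ι → ℝ) (1 : Matrix ι ι ℝ) = Measure.pi fun _ => gaussianReal 0 1 := by
  rw [gaussianVec, WithLp.toLp_zero, multivariateGaussian_zero_one, ← map_pi_eq_stdGaussian,
    Measure.map_map (by fun_prop) (by fun_prop)]
  simp [Function.comp_def]

/-- The density of the Gaussian law with mean `m` and covariance matrix `P`. -/
noncomputable def gaussianDensity (m : ι → ℝ) (P : Matrix ι ι ℝ) (x : ι → ℝ) : ℝ :=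
  (Real.sqrt (2 * Real.pi) ^ Fintype.card ι * Real.sqrt P.det)⁻¹ *
    Real.exp (-(1 / 2) * ((x - m) ⬝ᵥ (P⁻¹ *ᵥ (x - m))))

theorem gaussianDensity_pos {P : Matrix ι ι ℝ} (hP : P.PosDef) (m x : ι → ℝ) :
    0 < gaussianDensity m P x := by
  have := Real.sqrt_pos.mpr hP.det_pos
  unfold gaussianDensity
  positivity

theorem measurable_gaussianDensity (m : ι → ℝ) (P : Matrix ι ι ℝ) :
    Measurable (gaussianDensity m P) := by
  refine Continuous.measurable ?_
  unfold gaussianDensity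
  fun_prop

/-- Both `volume` and the standard Gaussian law are products. The reciprocal densities are integrated
against the Gaussian product measure, where the coordinates are independent random variables, which
gives `volume` as a measure with a density; that density is then inverted. -/
theorem pi_gaussianReal_eq_withDensity :
    (Measure.pi fun _ : ι => gaussianReal 0 1) =
      volume.withDensity fun x : ι → ℝ => ∏ i, gaussianPDF 0 1 (x i) := by
  have hm : Measurable (gaussianPDF 0 1) := measurable_gaussianPDF 0 1
  have hne : ∀ x, gaussianPDF 0 1 x ≠ 0 := fun x => (gaussianPDF_pos 0 one_ne_zero x).ne'
  have hnt : ∀ x, gaussianPDF 0 1 x ≠ ∞ := fun x => ENNReal.ofReal_ne_top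
  have hg : gaussianReal 0 1 = volume.withDensity (gaussianPDF 0 1) :=
    gaussianReal_of_var_ne_zero 0 one_ne_zero
  have h1 : (volume : Measure (ι → ℝ)) = (Measure.pi fun _ : ι => gaussianReal 0 1).withDensity
      (fun x => ∏ i, (gaussianPDF 0 1 (x i))⁻¹) := by
    refine Measure.pi_eq fun s hs => ?_
    rw [withDensity_apply _ (MeasurableSet.univ_pi hs), ← lintegral_indicator
      (MeasurableSet.univ_pi hs)]
    have h2 : ∀ x : ι → ℝ, (Set.univ.pi s).indicator
        (fun x => ∏ i, (gaussianPDF 0 1 (x i))⁻¹) x =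
        ∏ i, (s i).indicator (fun y => (gaussianPDF 0 1 y)⁻¹) (x i) := by
      intro x
      by_cases hx : x ∈ Set.univ.pi s
      · rw [Set.indicator_of_mem hx]
        refine Finset.prod_congr rfl fun i _ => ?_
        rw [Set.indicator_of_mem (hx i trivial)]
      · rw [Set.indicator_of_notMem hx]
        simp only [Set.mem_pi, Set.mem_univ, true_implies, not_forall] at hx
        obtain ⟨i, hi⟩ := hx
        rw [Finset.prod_eq_zero (Finset.mem_univ i)]
        rw [Set.indicator_of_notMem hi]
    simp_rw [h2]
    have hmi : ∀ i, Measurable ((s i).indicator (fun y => (gaussianPDF 0 1 y)⁻¹)) :=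
      fun i => hm.inv.indicator (hs i)
    rw [lintegral_prod_eq_prod_lintegral_of_indepFun Finset.univ
      (fun i (x : ι → ℝ) => (s i).indicator (fun y => (gaussianPDF 0 1 y)⁻¹) (x i))
      (iIndepFun_pi fun i => (hmi i).aemeasurable) (fun i => (hmi i).comp (measurable_pi_apply i))]
    refine Finset.prod_congr rfl fun i _ => ?_
    have h3 := (measurePreserving_eval (fun _ : ι => gaussianReal 0 1) i)
    rw [h3.lintegral_comp (hmi i), lintegral_indicator (hs i), ← withDensity_apply _ (hs i), hg,
      withDensity_inv_same hm (by simp [hne]) (by simp [hnt])]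
  have hmp : Measurable fun x : ι → ℝ => ∏ i, (gaussianPDF 0 1 (x i))⁻¹ :=
    Finset.measurable_prod _ fun i _ => hm.inv.comp (measurable_pi_apply i)
  have h4 := withDensity_inv_same (μ := Measure.pi fun _ : ι => gaussianReal 0 1) hmp
    (.of_forall fun x => Finset.prod_ne_zero_iff.mpr fun i _ => ENNReal.inv_ne_zero.mpr (hnt _))
    (.of_forall fun x => (ENNReal.prod_lt_top fun i _ =>
      (ENNReal.inv_ne_top.mpr (hne _)).lt_top).ne)
  rw [← h1] at h4
  rw [← h4]
  congr 1
  ext x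
  rw [ENNReal.prod_inv_distrib fun i _ j _ _ => Or.inl (ENNReal.inv_ne_zero.mpr (hnt _))]
  simp

theorem gaussianVec_zero_one_eq_withDensity :
    gaussianVec (0 : ι → ℝ) (1 : Matrix ι ι ℝ) =
      volume.withDensity fun x => ENNReal.ofReal (gaussianDensity 0 1 x) := by
  rw [gaussianVec_zero_one, pi_gaussianReal_eq_withDensity]
  congr 1
  ext x
  simp only [gaussianPDF]
  rw [← ENNReal.ofReal_prod_of_nonneg fun i _ => gaussianPDFReal_nonneg _ _ _]
  congr 1
  simp only [gaussianPDFReal, gaussianDensity, Finset.prod_mul_distrib, Finset.prod_const,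
    ← Real.exp_sum, Finset.card_univ]
  simp [dotProduct, Finset.mul_sum]
  rw [← mul_inv, mul_comm (Real.sqrt Real.pi), inv_pow]
  congr 2
  rw [← Finset.sum_neg_distrib]
  exact Finset.sum_congr rfl fun i _ => by ring

/-- The Gaussian law with a positive definite covariance matrix has the usual density. -/
theorem gaussianVec_eq_withDensity (m : ι → ℝ) {P : Matrix ι ι ℝ} (hP : P.PosDef) :
    gaussianVec m P = volume.withDensity fun x => ENNReal.ofReal (gaussianDensity m P x) := by
  obtain ⟨B, hB⟩ := exists_eq_mul_transpose_of_posSemidef hP.posSemidef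
  have hdet : P.det = B.det * B.det := by rw [hB, det_mul, det_transpose]
  have hB0 : B.det ≠ 0 := fun h => hP.det_pos.ne' (by rw [hdet, h, zero_mul])
  have hBu : IsUnit B.det := hB0.isUnit
  have hmap : gaussianVec m P = (gaussianVec 0 1).map (fun x => B *ᵥ x + m) := by
    rw [gaussianVec_map 0 PosSemidef.one, mulVec_zero, zero_add, mul_one, hB]
  have hmB : Measurable fun x : ι → ℝ => B *ᵥ x + m := by
    refine Continuous.measurable ?_
    fun_prop
  have hρ : ∀ (m : ι → ℝ) (P : Matrix ι ι ℝ),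
      Measurable fun x => ENNReal.ofReal (gaussianDensity m P x) :=
    fun m P => (measurable_gaussianDensity m P).ennreal_ofReal
  have hvol := Real.map_matrix_volume_pi_eq_smul_volume_pi hB0
  have hvol2 : (volume : Measure (ι → ℝ)) =
      ENNReal.ofReal |B.det| • Measure.map (toLin' B) volume := by
    rw [hvol, smul_smul, ← ENNReal.ofReal_mul (abs_nonneg _), ← abs_mul, mul_inv_cancel₀ hB0]
    simp
  have hmL : Measurable (toLin' B) := by
    refine Continuous.measurable ?_
    change Continuous fun x => B *ᵥ x
    fun_prop
  refine Measure.ext_of_lintegral _ fun h hh => ?_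
  have hhB : Measurable fun x => h (B *ᵥ x + m) := hh.comp hmB
  have hG : Measurable fun x => ENNReal.ofReal (gaussianDensity m P (x + m)) * h (x + m) :=
    ((hρ m P).comp (measurable_add_const m)).mul (hh.comp (measurable_add_const m))
  have hGB : Measurable fun x =>
      ENNReal.ofReal (gaussianDensity m P (B *ᵥ x + m)) * h (B *ᵥ x + m) :=
    ((hρ m P).comp hmB).mul hhB
  have hR : ∫⁻ y, h y ∂(volume.withDensity fun x => ENNReal.ofReal (gaussianDensity m P x)) =
      ∫⁻ x, ENNReal.ofReal |B.det| *
        (ENNReal.ofReal (gaussianDensity m P (B *ᵥ x + m)) * h (B *ᵥ x + m)) := by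
    rw [lintegral_withDensity_eq_lintegral_mul _ (hρ m P) hh,
      ← lintegral_add_right_eq_self _ m, lintegral_const_mul _ hGB]
    conv_lhs => rw [hvol2]
    rw [lintegral_smul_measure, smul_eq_mul]
    congr 1
    exact lintegral_map hG hmL
  rw [hR, hmap, lintegral_map hh hmB, gaussianVec_zero_one_eq_withDensity,
    lintegral_withDensity_eq_lintegral_mul _ (hρ 0 1) hhB]
  refine lintegral_congr fun x => ?_
  simp only [Pi.mul_apply]
  rw [← mul_assoc, ← ENNReal.ofReal_mul (abs_nonneg _)]
  congr 2
  have hq : (B *ᵥ x) ⬝ᵥ (P⁻¹ *ᵥ (B *ᵥ x)) = x ⬝ᵥ x := by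
    rw [hB, Matrix.mul_inv_rev, ← mulVec_mulVec _ Bᵀ⁻¹, mulVec_mulVec _ B⁻¹,
      nonsing_inv_mul _ hBu, one_mulVec, dotProduct_mulVec_transpose, mulVec_mulVec,
      transpose_nonsing_inv, transpose_transpose, nonsing_inv_mul _ hBu, one_mulVec]
  have hs : Real.sqrt P.det = |B.det| := by rw [hdet, Real.sqrt_mul_self_eq_abs]
  simp only [gaussianDensity, add_sub_cancel_right, hq, hs, sub_zero, inv_one, one_mulVec, det_one,
    Real.sqrt_one, mul_one]
  have : |B.det| ≠ 0 := abs_ne_zero.mpr hB0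
  field_simp

/-- Second moments of a Gaussian law. -/
theorem integral_mul_gaussianVec (m : ι → ℝ) {P : Matrix ι ι ℝ} (hP : P.PosSemidef) (i j : ι) :
    Integrable (fun x => (x i - m i) * (x j - m j)) (gaussianVec m P) ∧
      ∫ x, (x i - m i) * (x j - m j) ∂(gaussianVec m P) = P i j := by
  have hL2 : ∀ i, MemLp (fun x : EuclideanSpace ℝ ι => x i)
      2 (multivariateGaussian (WithLp.toLp 2 m) P) := fun i => by
    have h := (IsGaussian.memLp_two_id (μ := multivariateGaussian (WithLp.toLp 2 m) P))
    exact (EuclideanSpace.proj (𝕜 := ℝ) i).comp_memLp' h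
  have hint : ∀ i, ∫ x : EuclideanSpace ℝ ι, x i ∂(multivariateGaussian (WithLp.toLp 2 m) P) =
      m i := fun i => by
    have h := (EuclideanSpace.proj (𝕜 := ℝ) i).integral_comp_id_comm
      (IsGaussian.integrable_id (μ := multivariateGaussian (WithLp.toLp 2 m) P))
    rw [integral_id_multivariateGaussian] at h
    simpa using h
  have hc := covariance_eval_multivariateGaussian (μ := WithLp.toLp 2 m) hP i j
  rw [covariance, hint, hint] at hc
  have hI : Integrable (fun x : EuclideanSpace ℝ ι => (x i - m i) * (x j - m j))
      (multivariateGaussian (WithLp.toLp 2 m) P) :=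
    ((hL2 i).sub (memLp_const _)).integrable_mul ((hL2 j).sub (memLp_const _))
  unfold gaussianVec
  refine ⟨?_, ?_⟩
  · rw [integrable_map_measure (by fun_prop) (by fun_prop)]
    exact hI
  · rw [integral_map (by fun_prop) (by fun_prop)]
    exact hc

theorem integral_sub_gaussianVec (m : ι → ℝ) (P : Matrix ι ι ℝ) (i : ι) :
    Integrable (fun x => x i - m i) (gaussianVec m P) ∧
      ∫ x, (x i - m i) ∂(gaussianVec m P) = 0 := by
  have hI : Integrable (fun x : EuclideanSpace ℝ ι => x i)
      (multivariateGaussian (WithLp.toLp 2 m) P) := by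
    exact (EuclideanSpace.proj (𝕜 := ℝ) i).integrable_comp
      (IsGaussian.integrable_id (μ := multivariateGaussian (WithLp.toLp 2 m) P))
  have h := (EuclideanSpace.proj (𝕜 := ℝ) i).integral_comp_id_comm
      (IsGaussian.integrable_id (μ := multivariateGaussian (WithLp.toLp 2 m) P))
  rw [integral_id_multivariateGaussian] at h
  have hm : Measurable fun x : ι → ℝ => x i - m i := (measurable_pi_apply i).sub_const _
  unfold gaussianVec
  refine ⟨?_, ?_⟩
  · rw [integrable_map_measure hm.aestronglyMeasurable (by fun_prop)]
    exact hI.sub (integrable_const _)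
  · rw [integral_map (by fun_prop) hm.aestronglyMeasurable, integral_sub hI (integrable_const _)]
    simp only [integral_const, probReal_univ, one_smul]
    rw [sub_eq_zero]
    simpa using h

/-- The mean of a quadratic form of a centred Gaussian vector. -/
theorem integral_quadratic_gaussianVec (m : ι → ℝ) {P : Matrix ι ι ℝ} (hP : P.PosSemidef)
    (R : Matrix ι ι ℝ) :
    Integrable (fun x => (x - m) ⬝ᵥ (R *ᵥ (x - m))) (gaussianVec m P) ∧
      ∫ x, (x - m) ⬝ᵥ (R *ᵥ (x - m)) ∂(gaussianVec m P) = (R * P).trace := by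
  have h1 : ∀ x : ι → ℝ, (x - m) ⬝ᵥ (R *ᵥ (x - m)) =
      ∑ i, ∑ j, R i j * ((x i - m i) * (x j - m j)) := by
    intro x
    simp only [dotProduct, mulVec, Finset.mul_sum, Pi.sub_apply]
    exact Finset.sum_congr rfl fun i _ => Finset.sum_congr rfl fun j _ => by ring
  simp_rw [h1]
  have hI : ∀ i j, Integrable (fun x => R i j * ((x i - m i) * (x j - m j))) (gaussianVec m P) :=
    fun i j => (integral_mul_gaussianVec m hP i j).1.const_mul _
  refine ⟨integrable_finsetSum _ fun i _ => integrable_finsetSum _ fun j _ => hI i j, ?_⟩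
  rw [integral_finsetSum _ fun i _ => integrable_finsetSum _ fun j _ => hI i j]
  simp only [trace, diag, mul_apply]
  refine Finset.sum_congr rfl fun i _ => ?_
  rw [integral_finsetSum _ fun j _ => hI i j]
  refine Finset.sum_congr rfl fun j _ => ?_
  rw [integral_const_mul, (integral_mul_gaussianVec m hP i j).2]
  have := hP.isHermitian.apply i j
  simp only [star_trivial] at this
  rw [this]

/-- The mean square distance of a Gaussian vector from a point. -/
theorem lintegral_dist_sq_gaussianVec (m : ι → ℝ) {P : Matrix ι ι ℝ} (hP : P.PosSemidef)
    (c : ι → ℝ) :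
    ∫⁻ x, ENNReal.ofReal ((x - c) ⬝ᵥ (x - c)) ∂(gaussianVec m P) =
      ENNReal.ofReal (P.trace + (m - c) ⬝ᵥ (m - c)) := by
  have h1 : ∀ x : ι → ℝ, (x - c) ⬝ᵥ (x - c) =
      (x - m) ⬝ᵥ ((1 : Matrix ι ι ℝ) *ᵥ (x - m)) + ∑ i, 2 * (m i - c i) * (x i - m i) +
        (m - c) ⬝ᵥ (m - c) := by
    intro x
    simp only [one_mulVec, dotProduct, Pi.sub_apply, ← Finset.sum_add_distrib]
    exact Finset.sum_congr rfl fun i _ => by ring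
  have hq := integral_quadratic_gaussianVec m hP 1
  have hI : ∀ i, Integrable (fun x => 2 * (m i - c i) * (x i - m i)) (gaussianVec m P) :=
    fun i => (integral_sub_gaussianVec m P i).1.const_mul _
  have hIs : Integrable (fun x => ∑ i, 2 * (m i - c i) * (x i - m i)) (gaussianVec m P) :=
    integrable_finsetSum _ fun i _ => hI i
  have hIt : Integrable (fun x : ι → ℝ => (x - c) ⬝ᵥ (x - c)) (gaussianVec m P) := by
    rw [funext h1]
    exact (hq.1.add hIs).add (integrable_const _)
  rw [← ofReal_integral_eq_lintegral_ofReal hIt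
    (.of_forall fun x => Finset.sum_nonneg fun i _ => mul_self_nonneg _)]
  congr 1
  rw [funext h1, integral_add (by exact hq.1.add hIs) (integrable_const _), integral_add hq.1 hIs, hq.2,
    integral_finsetSum _ fun i _ => hI i]
  simp [integral_const_mul, (integral_sub_gaussianVec m P _).2]

end Gaussian

/-! ### One stage of the belief recursion -/

section Stage

variable {nx ny k : ℕ}

theorem StageParam.discardProb_nonneg (a : StageParam nx) (x : Fin nx → ℝ) :
    0 ≤ a.discardProb x := (Real.exp_pos _).le

theorem StageParam.discardProb_le_one (a : StageParam nx) (x : Fin nx → ℝ) :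
    a.discardProb x ≤ 1 := by
  have h := a.f_posDef.inv.posSemidef.dotProduct_mulVec_nonneg (x - a.g)
  rw [star_trivial] at h
  exact Real.exp_le_one_iff.mpr (by linarith)

theorem StageParam.measurable_discardProb (a : StageParam nx) : Measurable a.discardProb := by
  refine Continuous.measurable ?_
  unfold StageParam.discardProb
  fun_prop

theorem silentProb_nonneg (x : Fin nx → ℝ) (P : Matrix (HistIdx nx ny k) (HistIdx nx ny k) ℝ)
    (a : StageParam nx) : 0 ≤ silentProb x P a :=
  mul_nonneg (Real.sqrt_nonneg _) (Real.exp_pos _).le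

theorem silentProb_le_one (x : Fin nx → ℝ) {P : Matrix (HistIdx nx ny k) (HistIdx nx ny k) ℝ}
    (hP : P.PosDef) (a : StageParam nx) : silentProb x P a ≤ 1 := by
  have hG := a.f_posDef.add hP.toBlocks₁₁
  have h := hG.inv.posSemidef.dotProduct_mulVec_nonneg (a.g - x)
  rw [star_trivial] at h
  refine mul_le_one₀ (Real.sqrt_le_one.mpr ?_) (Real.exp_pos _).le
    (Real.exp_le_one_iff.mpr (by linarith))
  exact (div_le_one hG.det_pos).mpr
    (det_le_det_add_of_posSemidef a.f_posDef hP.toBlocks₁₁.posSemidef)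

theorem Belief.update_silent_mean (b : Belief nx ny k) (a : StageParam nx) :
    (b.update a (Sum.inr ())).mean = (b.cov * fromBlocks a.f⁻¹ 0 0 0 + 1)⁻¹ *ᵥ
      ((b.cov * fromBlocks a.f⁻¹ 0 0 0) *ᵥ Sum.elim a.g 0 + b.mean) := rfl

theorem Belief.update_silent_cov (b : Belief nx ny k) (a : StageParam nx) :
    (b.update a (Sum.inr ())).cov = (b.cov * fromBlocks a.f⁻¹ 0 0 0 + 1)⁻¹ * b.cov := rfl

theorem Belief.update_sent_mean (b : Belief nx ny k) (a : StageParam nx) (x : Fin nx → ℝ) :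
    (b.update a (Sum.inl x)).mean =
      Sum.elim x (b.y + (b.cov.toBlocks₂₁ * b.cov.toBlocks₁₁⁻¹) *ᵥ (x - b.x)) := rfl

theorem Belief.update_sent_cov (b : Belief nx ny k) (a : StageParam nx) (x : Fin nx → ℝ) :
    (b.update a (Sum.inl x)).cov = fromBlocks 0 0 0
      (b.cov.toBlocks₂₂ - b.cov.toBlocks₂₁ * b.cov.toBlocks₁₁⁻¹ * b.cov.toBlocks₁₂) := rfl

/-- Bayes' rule for a silent stage, at the level of densities. -/
theorem discardProb_mul_gaussianDensity {b : Belief nx ny k} (hb : b.cov.PosDef)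
    (a : StageParam nx) (v : HistIdx nx ny k → ℝ) :
    a.discardProb (fun i => v (Sum.inl i)) * gaussianDensity b.mean b.cov v =
      silentProb b.x b.cov a * gaussianDensity (b.update a (Sum.inr ())).mean
        (b.update a (Sum.inr ())).cov v := by
  have hq := silent_quadratic hb a.f_posDef b.mean v a.g
  rw [← b.update_silent_cov a, ← b.update_silent_mean a] at hq
  have hd := silent_det hb a.f_posDef
  rw [← b.update_silent_cov a] at hd
  have hP' : (b.update a (Sum.inr ())).cov.PosDef := silent_cov_posDef hb a.f_posDef
  have hG := a.f_posDef.add hb.toBlocks₁₁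
  have hs : Real.sqrt (b.update a (Sum.inr ())).cov.det *
      Real.sqrt (a.f + b.cov.toBlocks₁₁).det = Real.sqrt b.cov.det * Real.sqrt a.f.det := by
    rw [← Real.sqrt_mul hP'.det_pos.le, hd, Real.sqrt_mul hb.det_pos.le]
  have h1 := Real.sqrt_pos.mpr hP'.det_pos
  have h2 := Real.sqrt_pos.mpr hG.det_pos
  have h3 := Real.sqrt_pos.mpr hb.det_pos
  have hx : b.x = fun i => b.mean (Sum.inl i) := rfl
  unfold StageParam.discardProb gaussianDensity silentProb
  rw [hx, Real.sqrt_div a.f_posDef.det_pos.le]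
  have he : Real.exp (-(1 / 2) * (((fun i => v (Sum.inl i)) - a.g) ⬝ᵥ
        (a.f⁻¹ *ᵥ ((fun i => v (Sum.inl i)) - a.g)))) *
      Real.exp (-(1 / 2) * ((v - b.mean) ⬝ᵥ (b.cov⁻¹ *ᵥ (v - b.mean)))) =
      Real.exp (-(1 / 2) * ((a.g - fun i => b.mean (Sum.inl i)) ⬝ᵥ
        ((a.f + b.cov.toBlocks₁₁)⁻¹ *ᵥ (a.g - fun i => b.mean (Sum.inl i))))) *
      Real.exp (-(1 / 2) * ((v - (b.update a (Sum.inr ())).mean) ⬝ᵥ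
        ((b.update a (Sum.inr ())).cov⁻¹ *ᵥ (v - (b.update a (Sum.inr ())).mean)))) := by
    rw [← Real.exp_add, ← Real.exp_add]
    congr 1
    linear_combination (-(1 / 2) : ℝ) * hq
  have hc : (Real.sqrt (2 * Real.pi) ^ Fintype.card (HistIdx nx ny k) *
        Real.sqrt b.cov.det)⁻¹ =
      Real.sqrt a.f.det / Real.sqrt (a.f + b.cov.toBlocks₁₁).det *
        (Real.sqrt (2 * Real.pi) ^ Fintype.card (HistIdx nx ny k) *
        Real.sqrt (b.update a (Sum.inr ())).cov.det)⁻¹ := by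
    have h0 : 0 < Real.sqrt (2 * Real.pi) ^ Fintype.card (HistIdx nx ny k) := by positivity
    field_simp
    linear_combination hs
  rw [hc]
  linear_combination (Real.sqrt a.f.det / Real.sqrt (a.f + b.cov.toBlocks₁₁).det *
        (Real.sqrt (2 * Real.pi) ^ Fintype.card (HistIdx nx ny k) *
        Real.sqrt (b.update a (Sum.inr ())).cov.det)⁻¹) * he

theorem Belief.update_silent_posDef {b : Belief nx ny k} (hb : b.cov.PosDef) (a : StageParam nx) :
    (b.update a (Sum.inr ())).cov.PosDef := silent_cov_posDef hb a.f_posDef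

/-- Bayes' rule for a silent stage. -/
theorem lintegral_discardProb_mul {b : Belief nx ny k} (hb : b.cov.PosDef) (a : StageParam nx)
    {h : (HistIdx nx ny k → ℝ) → ℝ≥0∞} (hh : Measurable h) :
    ∫⁻ v, ENNReal.ofReal (a.discardProb fun i => v (Sum.inl i)) * h v
        ∂(gaussianVec b.mean b.cov) =
      ENNReal.ofReal (silentProb b.x b.cov a) *
        ∫⁻ v, h v ∂(gaussianVec (b.update a (Sum.inr ())).mean (b.update a (Sum.inr ())).cov) := by
  have hd : Measurable fun v : HistIdx nx ny k → ℝ =>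
      ENNReal.ofReal (a.discardProb fun i => v (Sum.inl i)) :=
    (a.measurable_discardProb.comp (by fun_prop)).ennreal_ofReal
  have hρ : ∀ (m : HistIdx nx ny k → ℝ) P,
      Measurable fun x => ENNReal.ofReal (gaussianDensity m P x) :=
    fun m P => (measurable_gaussianDensity m P).ennreal_ofReal
  have hdh : Measurable fun v : HistIdx nx ny k → ℝ =>
      ENNReal.ofReal (a.discardProb fun i => v (Sum.inl i)) * h v := hd.mul hh
  rw [gaussianVec_eq_withDensity _ hb,
    gaussianVec_eq_withDensity _ (Belief.update_silent_posDef hb a),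
    lintegral_withDensity_eq_lintegral_mul _ (hρ _ _) hdh,
    lintegral_withDensity_eq_lintegral_mul _ (hρ _ _) hh,
    ← lintegral_const_mul _ ((hρ _ _).mul hh)]
  refine lintegral_congr fun v => ?_
  simp only [Pi.mul_apply]
  rw [← mul_assoc, ← mul_assoc, mul_comm (ENNReal.ofReal (gaussianDensity _ _ _)),
    ← ENNReal.ofReal_mul (a.discardProb_nonneg _), discardProb_mul_gaussianDensity hb,
    ENNReal.ofReal_mul (silentProb_nonneg _ _ _)]

theorem Belief.update_sent_posSemidef {b : Belief nx ny k} (hb : b.cov.PosDef)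
    (a : StageParam nx) (x : Fin nx → ℝ) : (b.update a (Sum.inl x)).cov.PosSemidef := by
  rw [Belief.update_sent_cov]
  have h := posSemidef_congr (schur_posDef hb).posSemidef
    (fromRows 0 1 : Matrix (HistIdx nx ny k) (Fin (k + 1) × Fin ny) ℝ)
  convert h using 1
  ext (i | i) (j | j) <;> simp [mul_apply, transpose_apply, one_apply]

theorem Belief.update_posSemidef {b : Belief nx ny k} (hb : b.cov.PosDef)
    (a : StageParam nx) (o : Obs nx) : (b.update a o).cov.PosSemidef := by
  rcases o with x | ⟨⟩
  · exact Belief.update_sent_posSemidef hb a x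
  · exact (Belief.update_silent_posDef hb a).posSemidef

theorem Belief.update_toBlocks₂₂_posDef {b : Belief nx ny k} (hb : b.cov.PosDef)
    (a : StageParam nx) (o : Obs nx) : (b.update a o).cov.toBlocks₂₂.PosDef := by
  rcases o with x | ⟨⟩
  · rw [Belief.update_sent_cov, toBlocks_fromBlocks₂₂]
    exact schur_posDef hb
  · exact (Belief.update_silent_posDef hb a).toBlocks₂₂

/-- A Gaussian law on `(x, y)` disintegrates into the law of `x` and the conditional law, which is
the belief after a transmission of `x`. -/
theorem lintegral_gaussianVec_disintegrate {b : Belief nx ny k} (hb : b.cov.PosDef)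
    (a : StageParam nx) {h : (Fin nx → ℝ) × (HistIdx nx ny k → ℝ) → ℝ≥0∞} (hh : Measurable h) :
    ∫⁻ v, h (fun i => v (Sum.inl i), v) ∂(gaussianVec b.mean b.cov) =
      ∫⁻ x, ∫⁻ v, h (x, v) ∂(gaussianVec (b.update a (Sum.inl x)).mean
        (b.update a (Sum.inl x)).cov) ∂(gaussianVec b.x b.cov.toBlocks₁₁) := by
  set K := b.cov.toBlocks₂₁ * b.cov.toBlocks₁₁⁻¹ with hK
  set C := b.cov.toBlocks₂₂ - K * b.cov.toBlocks₁₂ with hC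
  have hCp : C.PosDef := schur_posDef hb
  set M : Matrix (HistIdx nx ny k) (Fin nx) ℝ := fromRows 1 K with hM
  set N : Matrix (HistIdx nx ny k) (Fin (k + 1) × Fin ny) ℝ := fromRows 0 1 with hN
  have h11 := hb.toBlocks₁₁
  have hu : IsUnit b.cov.toBlocks₁₁.det := h11.det_pos.ne'.isUnit
  have hKP : K * b.cov.toBlocks₁₁ = b.cov.toBlocks₂₁ := by
    rw [hK, Matrix.mul_assoc, nonsing_inv_mul _ hu, Matrix.mul_one]
  have hPK : b.cov.toBlocks₁₁ * Kᵀ = b.cov.toBlocks₁₂ := by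
    have h := congrArg Matrix.transpose hKP
    rwa [toBlocks₂₁_transpose hb.isHermitian, transpose_mul, h11.transpose_eq] at h
  have hcov : M * b.cov.toBlocks₁₁ * Mᵀ + N * C * Nᵀ = b.cov := by
    rw [hM, hN, fromRows_mul 1 K, fromRows_mul 0 1, transpose_fromRows, transpose_fromRows,
      fromRows_mul_fromCols, fromRows_mul_fromCols, fromBlocks_add, ← fromBlocks_toBlocks b.cov]
    simp only [toBlocks_fromBlocks₁₁, transpose_one, transpose_zero, Matrix.one_mul,
      Matrix.mul_one, Matrix.zero_mul, Matrix.mul_zero, add_zero, hPK, hKP]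
    have h22 : b.cov.toBlocks₂₁ * Kᵀ = K * b.cov.toBlocks₁₂ := by
      rw [← hKP, Matrix.mul_assoc, hPK]
    congr 1
    rw [hC, h22]; abel
  have hmean : M *ᵥ b.x + N *ᵥ (b.y - K *ᵥ b.x) + 0 = b.mean := by
    ext (i | i) <;> simp [hM, hN, Belief.x, Belief.y]
  -- `(x, y)` is `(x, K x + r)` with a residual `r` of covariance `C` that is independent of `x`
  have hlaw := gaussianVec_prod_map b.x h11.posSemidef (b.y - K *ᵥ b.x) hCp.posSemidef M N 0
  rw [hcov, hmean] at hlaw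
  have hmeas : Measurable fun p : (Fin nx → ℝ) × (Fin (k + 1) × Fin ny → ℝ) =>
      M *ᵥ p.1 + N *ᵥ p.2 + 0 := by
    refine Continuous.measurable ?_
    fun_prop
  have hmx : Measurable fun v : HistIdx nx ny k → ℝ => (fun i => v (Sum.inl i), v) :=
    Measurable.prodMk (by fun_prop) measurable_id
  have hx : ∀ p : (Fin nx → ℝ) × (Fin (k + 1) × Fin ny → ℝ),
      (fun i => (M *ᵥ p.1 + N *ᵥ p.2 + 0) (Sum.inl i)) = p.1 := by
    intro p; ext i; simp [hM, hN]
  have hhx : Measurable fun v : HistIdx nx ny k → ℝ => h (fun i => v (Sum.inl i), v) :=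
    hh.comp hmx
  have hhp : Measurable fun p : (Fin nx → ℝ) × (Fin (k + 1) × Fin ny → ℝ) =>
      h (fun i => (M *ᵥ p.1 + N *ᵥ p.2 + 0) (Sum.inl i), M *ᵥ p.1 + N *ᵥ p.2 + 0) :=
    hhx.comp hmeas
  rw [← hlaw, lintegral_map hhx hmeas, lintegral_prod _ hhp.aemeasurable]
  refine lintegral_congr fun x => ?_
  simp only
  have hup : gaussianVec (b.update a (Sum.inl x)).mean (b.update a (Sum.inl x)).cov =
      (gaussianVec (b.y - K *ᵥ b.x) C).map (fun y => N *ᵥ y + M *ᵥ x) := by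
    rw [gaussianVec_map _ hCp.posSemidef]
    congr 1
    · rw [Belief.update_sent_mean, ← hK]
      ext (i | i) <;> simp [hM, hN, mulVec_sub]; ring
    · rw [Belief.update_sent_cov, ← hK, ← hC, hN, fromRows_mul, transpose_fromRows,
        fromRows_mul_fromCols]
      simp
  rw [hup, lintegral_map (by fun_prop) (by
    refine Continuous.measurable ?_
    fun_prop)]
  refine lintegral_congr fun y => ?_
  have hxy := hx (x, y)
  simp only [add_zero] at hxy ⊢
  rw [hxy, add_comm]

/-- The matrix of the map by which the noise `W_k` enters `(X_{k+1}, Y^{k+1})`. -/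
def noiseEmb (nx ny k : ℕ) : Matrix (HistIdx nx ny (k + 1)) (StateIdx nx ny) ℝ
  | Sum.inl i, Sum.inl j => if i = j then 1 else 0
  | Sum.inl _, Sum.inr _ => 0
  | Sum.inr _, Sum.inl _ => 0
  | Sum.inr (s, i), Sum.inr j => if s = Fin.last (k + 1) ∧ i = j then 1 else 0

theorem stepNoise_eq (Q : Matrix (StateIdx nx ny) (StateIdx nx ny) ℝ) :
    stepNoise Q k = noiseEmb nx ny k * Q * (noiseEmb nx ny k)ᵀ := by
  ext (i | ⟨s, i⟩) (j | ⟨t, j⟩) <;>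
    simp [stepNoise, noiseEmb, mul_apply, Fintype.sum_sum_type]
  · by_cases h : t = Fin.last (k + 1) <;> simp [h]
  · by_cases h : s = Fin.last (k + 1) <;> simp [h]
  · by_cases h : t = Fin.last (k + 1) <;> by_cases h' : s = Fin.last (k + 1) <;> simp [h, h']

variable (S : LinGaussSystem nx ny)

/-- The time update computes the law of `(X_{k+1}, Y^{k+1})` from the law of `(X_k, Y^k)`. -/
theorem lintegral_predict {b : Belief nx ny k} (hb : b.cov.PosSemidef)
    {h : (HistIdx nx ny (k + 1) → ℝ) → ℝ≥0∞} (hh : Measurable h) :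
    ∫⁻ v, ∫⁻ w, h (stepMatrix S.A k *ᵥ v + noiseEmb nx ny k *ᵥ w) ∂(gaussianVec 0 S.Q)
        ∂(gaussianVec b.mean b.cov) =
      ∫⁻ v, h v ∂(gaussianVec (S.predict b).mean (S.predict b).cov) := by
  have hlaw := gaussianVec_prod_map b.mean hb (0 : StateIdx nx ny → ℝ) S.Q_posDef.posSemidef
    (stepMatrix S.A k) (noiseEmb nx ny k) 0
  have hmeas : Measurable fun p : (HistIdx nx ny k → ℝ) × (StateIdx nx ny → ℝ) =>
      stepMatrix S.A k *ᵥ p.1 + noiseEmb nx ny k *ᵥ p.2 + 0 := by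
    refine Continuous.measurable ?_
    fun_prop
  rw [← stepNoise_eq, mulVec_zero, add_zero, add_zero] at hlaw
  change _ = gaussianVec (S.predict b).mean (S.predict b).cov at hlaw
  have hhp : Measurable fun p : (HistIdx nx ny k → ℝ) × (StateIdx nx ny → ℝ) =>
      h (stepMatrix S.A k *ᵥ p.1 + noiseEmb nx ny k *ᵥ p.2 + 0) := hh.comp hmeas
  rw [← hlaw, lintegral_map hh hmeas, lintegral_prod _ hhp.aemeasurable]
  simp

/-- The covariance of `(X_k, Y^k)` may be singular in the `x`-directions after a transmission, but the
noise covers the new coordinates, and `P^{yy}_{k|k}` covers the old coordinates of the private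
history. -/
theorem predict_posDef {b : Belief nx ny k} (hb : b.cov.PosSemidef)
    (hy : b.cov.toBlocks₂₂.PosDef) : (S.predict b).cov.PosDef := by
  have h1 := posSemidef_congr hb (stepMatrix S.A k)
  have h2 := posSemidef_congr S.Q_posDef.posSemidef (noiseEmb nx ny k)
  refine PosDef.of_dotProduct_mulVec_pos ?_ fun u hu => ?_
  · have := (h1.add h2).isHermitian
    rwa [← stepNoise_eq] at this
  change 0 < star u ⬝ᵥ ((stepMatrix S.A k * b.cov * (stepMatrix S.A k)ᵀ + stepNoise S.Q k) *ᵥ u)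
  rw [stepNoise_eq, add_mulVec, dotProduct_add, star_trivial]
  have e1 : ∀ {α : Type} [Fintype α] (R : Matrix (HistIdx nx ny (k + 1)) α ℝ) (P : Matrix α α ℝ),
      u ⬝ᵥ ((R * P * Rᵀ) *ᵥ u) = (Rᵀ *ᵥ u) ⬝ᵥ (P *ᵥ (Rᵀ *ᵥ u)) := fun R P => by
    rw [← mulVec_mulVec, ← mulVec_mulVec, dotProduct_mulVec_transpose]
  rw [e1, e1]
  have n1 := hb.dotProduct_mulVec_nonneg ((stepMatrix S.A k)ᵀ *ᵥ u)
  rw [star_trivial] at n1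
  -- a direction that the noise does not see lives on the old coordinates of the private history
  by_cases hE : (noiseEmb nx ny k)ᵀ *ᵥ u = 0
  · have hu1 : ∀ i, u (Sum.inl i) = 0 := fun i => by
      have := congrFun hE (Sum.inl i)
      simpa [mulVec, dotProduct, Fintype.sum_sum_type, noiseEmb] using this
    have hu2 : ∀ j, u (Sum.inr (Fin.last (k + 1), j)) = 0 := fun j => by
      have := congrFun hE (Sum.inr j)
      simpa [mulVec, dotProduct, Fintype.sum_sum_type, Fintype.sum_prod_type, noiseEmb,
        Fin.sum_univ_castSucc, (Fin.castSucc_lt_last _).ne] using this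
    set u' : Fin (k + 1) × Fin ny → ℝ := fun p => u (Sum.inr (p.1.castSucc, p.2)) with hu'
    have hMu : (stepMatrix S.A k)ᵀ *ᵥ u = (Sum.elim 0 u' : HistIdx nx ny k → ℝ) := by
      ext (i | ⟨t, i⟩)
      · simp [mulVec, dotProduct, Fintype.sum_sum_type, Fintype.sum_prod_type, stepMatrix,
          hu1, hu2]
      · simp [mulVec, dotProduct, Fintype.sum_sum_type, Fintype.sum_prod_type, stepMatrix,
          Fin.sum_univ_castSucc, (Fin.castSucc_lt_last _).ne, hu1, hu2, hu']
        rw [← Fin.sum_univ_castSucc (fun s : Fin (k + 1) =>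
          ∑ x, if s = t ∧ x = i then u (Sum.inr (s.castSucc, x)) else 0)]
        simp [ite_and]
    have hu'0 : u' ≠ 0 := by
      intro h0
      refine hu (funext fun i => ?_)
      rcases i with i | ⟨s, i⟩
      · exact hu1 i
      · induction s using Fin.lastCases with
        | last => exact hu2 i
        | cast s => exact congrFun h0 (s, i)
    have hpos := hy.dotProduct_mulVec_pos hu'0
    rw [star_trivial] at hpos
    have e2 : (Sum.elim 0 u' : HistIdx nx ny k → ℝ) ⬝ᵥ (b.cov *ᵥ Sum.elim 0 u') =
        u' ⬝ᵥ (b.cov.toBlocks₂₂ *ᵥ u') := by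
      simp [dotProduct, mulVec, Fintype.sum_sum_type, toBlocks₂₂]
    rw [hE, hMu, e2]
    simpa using hpos
  · have := S.Q_posDef.dotProduct_mulVec_pos hE
    rw [star_trivial] at this
    linarith

theorem predict_update_posDef {b : Belief nx ny k} (hb : b.cov.PosDef) (a : StageParam nx)
    (o : Obs nx) : (S.predict (b.update a o)).cov.PosDef :=
  predict_posDef S (Belief.update_posSemidef hb a o) (Belief.update_toBlocks₂₂_posDef hb a o)

theorem initBelief_posDef : S.initBelief.cov.PosDef := by
  refine S.P₀_posDef.submatrix ?_
  rintro (i | ⟨s, i⟩) (j | ⟨t, j⟩) h <;> simp at h ⊢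
  · exact h
  · exact ⟨Subsingleton.elim _ _, h⟩

/-- The marginal law of `X_k` under a belief: integrals of functions of the `x`-coordinates. -/
theorem lintegral_gaussianVec_fst {b : Belief nx ny k} (hb : b.cov.PosDef)
    {h : (Fin nx → ℝ) → ℝ≥0∞} (hh : Measurable h) :
    ∫⁻ v, h (fun i => v (Sum.inl i)) ∂(gaussianVec b.mean b.cov) =
      ∫⁻ x, h x ∂(gaussianVec b.x b.cov.toBlocks₁₁) := by
  have := lintegral_gaussianVec_disintegrate hb ⟨1, 0, PosDef.one⟩ (hh.comp measurable_fst)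
  simpa using this

theorem lintegral_discardProb {b : Belief nx ny k} (hb : b.cov.PosDef) (a : StageParam nx) :
    ∫⁻ x, ENNReal.ofReal (a.discardProb x) ∂(gaussianVec b.x b.cov.toBlocks₁₁) =
      ENNReal.ofReal (silentProb b.x b.cov a) := by
  rw [← lintegral_gaussianVec_fst hb a.measurable_discardProb.ennreal_ofReal]
  simpa using lintegral_discardProb_mul hb a measurable_one

theorem lintegral_one_sub_discardProb {b : Belief nx ny k} (hb : b.cov.PosDef)
    (a : StageParam nx) :
    ∫⁻ x, ENNReal.ofReal (1 - a.discardProb x) ∂(gaussianVec b.x b.cov.toBlocks₁₁) =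
      ENNReal.ofReal (1 - silentProb b.x b.cov a) := by
  simp_rw [fun x => ENNReal.ofReal_sub 1 (a.discardProb_nonneg x)]
  rw [lintegral_sub a.measurable_discardProb.ennreal_ofReal, lintegral_discardProb hb,
    ENNReal.ofReal_sub _ (silentProb_nonneg _ _ _)]
  · simp
  · rw [lintegral_discardProb hb]; exact ENNReal.ofReal_ne_top
  · exact .of_forall fun x => ENNReal.ofReal_le_ofReal (a.discardProb_le_one x)

end Stage

/-! ### Measurability of the belief recursion -/

section Measurability

variable {α : Type*} [MeasurableSpace α] {ι m n l : Type*} [Fintype ι] [DecidableEq ι] [Fintype m]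
  [DecidableEq m] [Fintype n] [DecidableEq n]

/-- Entrywise measurability of a matrix-valued function. -/
def EntryMeasurable {m n : Type*} (M : α → Matrix m n ℝ) : Prop :=
  ∀ i j, Measurable fun z => M z i j

theorem EntryMeasurable.mul {M : α → Matrix l m ℝ} {N : α → Matrix m n ℝ}
    (hM : EntryMeasurable M) (hN : EntryMeasurable N) : EntryMeasurable fun z => M z * N z :=
  fun i j => by
    simp only [mul_apply]
    exact Finset.measurable_sum _ fun x _ => (hM i x).mul (hN x j)

theorem EntryMeasurable.add {M N : α → Matrix m n ℝ}
    (hM : EntryMeasurable M) (hN : EntryMeasurable N) : EntryMeasurable fun z => M z + N z :=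
  fun i j => (hM i j).add (hN i j)

theorem EntryMeasurable.sub {M N : α → Matrix m n ℝ}
    (hM : EntryMeasurable M) (hN : EntryMeasurable N) : EntryMeasurable fun z => M z - N z :=
  fun i j => (hM i j).sub (hN i j)

theorem EntryMeasurable.const (M : Matrix m n ℝ) : EntryMeasurable fun _ : α => M :=
  fun _ _ => measurable_const

theorem EntryMeasurable.fromBlocks {m' n' : Type*} {A : α → Matrix m n ℝ} {B : α → Matrix m n' ℝ}
    {C : α → Matrix m' n ℝ} {D : α → Matrix m' n' ℝ} (hA : EntryMeasurable A)
    (hB : EntryMeasurable B) (hC : EntryMeasurable C) (hD : EntryMeasurable D) :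
    EntryMeasurable fun z => Matrix.fromBlocks (A z) (B z) (C z) (D z) := by
  rintro (i | i) (j | j)
  exacts [hA i j, hB i j, hC i j, hD i j]

theorem EntryMeasurable.det {M : α → Matrix ι ι ℝ} (hM : EntryMeasurable M) :
    Measurable fun z => (M z).det := by
  simp only [det_apply]
  exact Finset.measurable_sum _ fun σ _ =>
    (Finset.measurable_prod _ fun i _ => hM _ _).const_smul _

theorem EntryMeasurable.inv {M : α → Matrix ι ι ℝ} (hM : EntryMeasurable M) :
    EntryMeasurable fun z => (M z)⁻¹ := by
  intro i j
  simp only [inv_def, Matrix.smul_apply, Ring.inverse_eq_inv', smul_eq_mul, adjugate_apply]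
  refine hM.det.inv.mul (EntryMeasurable.det fun i' j' => ?_)
  by_cases h : i' = j
  · simp only [h, updateRow_self]
    exact measurable_const
  · simp only [updateRow_ne h]
    exact hM _ _

theorem EntryMeasurable.mulVec {M : α → Matrix l m ℝ} {v : α → m → ℝ}
    (hM : EntryMeasurable M) (hv : Measurable v) : Measurable fun z => M z *ᵥ v z :=
  measurable_pi_lambda _ fun i => by
    simp only [Matrix.mulVec, dotProduct]
    exact Finset.measurable_sum _ fun x _ => (hM i x).mul ((measurable_pi_apply x).comp hv)

theorem measurable_dotProduct {v w : α → m → ℝ} (hv : Measurable v) (hw : Measurable w) :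
    Measurable fun z => v z ⬝ᵥ w z := by
  simp only [dotProduct]
  exact Finset.measurable_sum _ fun x _ =>
    ((measurable_pi_apply x).comp hv).mul ((measurable_pi_apply x).comp hw)

/-- Joint measurability of the Gaussian density in its parameters and its argument. -/
theorem measurable_gaussianDensity_comp {μ v : α → ι → ℝ} {P : α → Matrix ι ι ℝ}
    (hμ : Measurable μ) (hP : EntryMeasurable P) (hv : Measurable v) :
    Measurable fun z => gaussianDensity (μ z) (P z) (v z) := by
  unfold gaussianDensity
  exact (measurable_const.mul hP.det.sqrt).inv.mul
    ((measurable_const.mul (measurable_dotProduct (hv.sub hμ) (hP.inv.mulVec (hv.sub hμ)))).exp)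

/-- A Gaussian law depends measurably on its parameters, since its density does. -/
theorem measurable_gaussianVec {μ : α → ι → ℝ} {P : α → Matrix ι ι ℝ}
    (hμ : Measurable μ) (hP : EntryMeasurable P) (hpos : ∀ z, (P z).PosDef) :
    Measurable fun z => gaussianVec (μ z) (P z) := by
  refine Measure.measurable_of_measurable_coe _ fun s hs => ?_
  have h : ∀ z, gaussianVec (μ z) (P z) s =
      ∫⁻ x in s, ENNReal.ofReal (gaussianDensity (μ z) (P z) x) := fun z => by
    rw [gaussianVec_eq_withDensity _ (hpos z), withDensity_apply _ hs]
  simp_rw [h]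
  refine Measurable.lintegral_prod_right'
    (f := fun q : α × (ι → ℝ) => ENNReal.ofReal (gaussianDensity (μ q.1) (P q.1) q.2)) ?_
  exact (measurable_gaussianDensity_comp (hμ.comp measurable_fst)
    (fun i j => (hP i j).comp measurable_fst) measurable_snd).ennreal_ofReal

/-- The Markov kernel of Gaussian laws with measurable parameters. -/
noncomputable def gaussianKernel (μ : α → ι → ℝ) (P : α → Matrix ι ι ℝ)
    (hμ : Measurable μ) (hP : EntryMeasurable P) (hpos : ∀ z, (P z).PosDef) :
    Kernel α (ι → ℝ) where
  toFun z := gaussianVec (μ z) (P z)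
  measurable' := measurable_gaussianVec hμ hP hpos

instance (μ : α → ι → ℝ) (P : α → Matrix ι ι ℝ)
    (hμ : Measurable μ) (hP : EntryMeasurable P) (hpos : ∀ z, (P z).PosDef) :
    IsMarkovKernel (gaussianKernel μ P hμ hP hpos) :=
  ⟨fun z => inferInstanceAs (IsProbabilityMeasure (gaussianVec (μ z) (P z)))⟩

variable {nx ny k : ℕ}

/-- Measurability of a belief as a function of the data. -/
structure MeasurableBelief (b : α → Belief nx ny k) : Prop where
  mean : Measurable fun z => (b z).mean
  cov : EntryMeasurable fun z => (b z).cov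

/-- The transmitted state, and `0` if the sample is discarded. -/
def Obs.value (o : Obs nx) : Fin nx → ℝ := Sum.elim id 0 o

theorem Obs.measurable_value : Measurable (Obs.value (nx := nx)) :=
  Measurable.sumElim measurable_id measurable_const

theorem measurableSet_silent : MeasurableSet {o : Obs nx | o = Sum.inr ()} := by
  convert measurableSet_range_inr (α := Fin nx → ℝ) (β := Unit) using 1
  ext o
  rcases o with x | ⟨⟩ <;> simp

theorem Belief.update_eq_ite (b : Belief nx ny k) (a : StageParam nx) (o : Obs nx)
    [Decidable (o = Sum.inr ())] :
    b.update a o = if o = Sum.inr () then b.update a (Sum.inr ()) else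
      b.update a (Sum.inl o.value) := by
  rcases o with x | ⟨⟩
  · rw [if_neg Sum.inl_ne_inr]
    rfl
  · simp

theorem MeasurableBelief.x {b : α → Belief nx ny k} (hb : MeasurableBelief b) :
    Measurable fun z => (b z).x :=
  measurable_pi_lambda _ fun i => (measurable_pi_apply (Sum.inl i)).comp hb.mean

theorem MeasurableBelief.y {b : α → Belief nx ny k} (hb : MeasurableBelief b) :
    Measurable fun z => (b z).y :=
  measurable_pi_lambda _ fun i => (measurable_pi_apply (Sum.inr i)).comp hb.mean

theorem MeasurableBelief.update_silent {b : α → Belief nx ny k} (hb : MeasurableBelief b)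
    {a : α → StageParam nx} (hf : EntryMeasurable fun z => (a z).f)
    (hg : Measurable fun z => (a z).g) :
    MeasurableBelief fun z => (b z).update (a z) (Sum.inr ()) := by
  have hD : EntryMeasurable fun z => (b z).cov *
      (Matrix.fromBlocks (a z).f⁻¹ 0 0 0 : Matrix (HistIdx nx ny k) (HistIdx nx ny k) ℝ) :=
    hb.cov.mul (hf.inv.fromBlocks (.const 0) (.const 0) (.const 0))
  have hg' : Measurable fun z => (Sum.elim (a z).g 0 : HistIdx nx ny k → ℝ) :=
    measurable_pi_lambda _ (by
      rintro (i | i)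
      · exact (measurable_pi_apply i).comp hg
      · exact measurable_const)
  refine ⟨?_, ?_⟩
  · simp only [Belief.update_silent_mean]
    exact (hD.add (.const 1)).inv.mulVec ((hD.mulVec hg').add hb.mean)
  · simp only [Belief.update_silent_cov]
    exact (hD.add (.const 1)).inv.mul hb.cov

theorem MeasurableBelief.update_sent {b : α → Belief nx ny k} (hb : MeasurableBelief b)
    (a : α → StageParam nx) {x : α → Fin nx → ℝ} (hx : Measurable x) :
    MeasurableBelief fun z => (b z).update (a z) (Sum.inl (x z)) := by
  have h11 : EntryMeasurable fun z => (b z).cov.toBlocks₁₁ := fun i j => hb.cov _ _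
  have h12 : EntryMeasurable fun z => (b z).cov.toBlocks₁₂ := fun i j => hb.cov _ _
  have h21 : EntryMeasurable fun z => (b z).cov.toBlocks₂₁ := fun i j => hb.cov _ _
  have h22 : EntryMeasurable fun z => (b z).cov.toBlocks₂₂ := fun i j => hb.cov _ _
  refine ⟨?_, ?_⟩
  · simp only [Belief.update_sent_mean]
    have hy := hb.y.add ((h21.mul h11.inv).mulVec (hx.sub hb.x))
    refine measurable_pi_lambda _ ?_
    rintro (i | i)
    · exact (measurable_pi_apply i).comp hx
    · exact (measurable_pi_apply i).comp hy
  · simp only [Belief.update_sent_cov]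
    exact (EntryMeasurable.const 0).fromBlocks (.const 0) (.const 0)
      (h22.sub ((h21.mul h11.inv).mul h12))

theorem MeasurableBelief.update {b : α → Belief nx ny k} (hb : MeasurableBelief b)
    {a : α → StageParam nx} (hf : EntryMeasurable fun z => (a z).f)
    (hg : Measurable fun z => (a z).g) {o : α → Obs nx} (ho : Measurable o) :
    MeasurableBelief fun z => (b z).update (a z) (o z) := by
  classical
  have h1 := hb.update_silent hf hg
  have h2 := hb.update_sent a (Obs.measurable_value.comp ho)
  have hs : MeasurableSet {z | o z = Sum.inr ()} := ho measurableSet_silent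
  simp only [Belief.update_eq_ite _ _ (o _)]
  refine ⟨?_, fun i j => ?_⟩
  · simp only [apply_ite Belief.mean]
    exact Measurable.ite hs h1.mean h2.mean
  · simp only [apply_ite Belief.cov, apply_ite (fun M : Matrix _ _ ℝ => M i j)]
    exact Measurable.ite hs (h1.cov i j) (h2.cov i j)

theorem MeasurableBelief.predict (S : LinGaussSystem nx ny) {b : α → Belief nx ny k}
    (hb : MeasurableBelief b) : MeasurableBelief fun z => S.predict (b z) :=
  ⟨(EntryMeasurable.const _).mulVec hb.mean,
    (((EntryMeasurable.const _).mul hb.cov).mul (.const _)).add (.const _)⟩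

variable (S : LinGaussSystem nx ny)

theorem measurable_init {k : ℕ} :
    Measurable fun (z : Fin (k + 1) → Obs nx) (i : Fin k) => z i.castSucc :=
  measurable_pi_lambda _ fun i => measurable_pi_apply i.castSucc

theorem measurableBelief_predBelief (p : Policy nx) : ∀ k, MeasurableBelief (S.predBelief p k)
  | 0 => ⟨measurable_const, fun _ _ => measurable_const⟩
  | k + 1 => by
      have ih := measurableBelief_predBelief p k
      have ih' : MeasurableBelief fun z : Fin (k + 1) → Obs nx =>
          S.predBelief p k fun i => z i.castSucc :=
        ⟨ih.mean.comp measurable_init, fun i j => (ih.cov i j).comp measurable_init⟩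
      exact MeasurableBelief.predict S (ih'.update
        (fun i j => (p.measurable_f k i j).comp measurable_init)
        ((p.measurable_g k).comp measurable_init) (measurable_pi_apply (Fin.last k)))

theorem measurableBelief_filtBelief (p : Policy nx) (k : ℕ) :
    MeasurableBelief (S.filtBelief p k) := by
  have ih := measurableBelief_predBelief S p k
  have ih' : MeasurableBelief fun z : Fin (k + 1) → Obs nx =>
      S.predBelief p k fun i => z i.castSucc :=
    ⟨ih.mean.comp measurable_init, fun i j => (ih.cov i j).comp measurable_init⟩
  exact (ih'.update
    (fun i j => (p.measurable_f k i j).comp measurable_init)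
    ((p.measurable_g k).comp measurable_init) (measurable_pi_apply (Fin.last k)))

theorem predBelief_posDef (p : Policy nx) (k : ℕ) (z : Fin k → Obs nx) :
    (S.predBelief p k z).cov.PosDef := by
  induction k with
  | zero => exact initBelief_posDef S
  | succ k ih => exact predict_update_posDef S (ih _) _ _

/-- The predicted belief generated by a feedback law. -/
noncomputable def fbBelief (φ : Feedback nx ny) : (k : ℕ) → (Fin k → Obs nx) → Belief nx ny k
  | 0, _ => S.initBelief
  | k + 1, z =>
      S.predict ((fbBelief φ k fun i => z i.castSucc).update
        (φ.act k (fbBelief φ k fun i => z i.castSucc).x (fbBelief φ k fun i => z i.castSucc).cov)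
        (z (Fin.last k)))

theorem Feedback.entryMeasurable_f (φ : Feedback nx ny) {b : α → Belief nx ny k}
    (hb : MeasurableBelief b) : EntryMeasurable fun z => (φ.act k (b z).x (b z).cov).f :=
  fun i j => (φ.measurable_f k i j).comp
    (hb.x.prodMk (measurable_pi_lambda _ fun i => measurable_pi_lambda _ fun j => hb.cov i j))

theorem Feedback.measurable_g_comp (φ : Feedback nx ny) {b : α → Belief nx ny k}
    (hb : MeasurableBelief b) : Measurable fun z => (φ.act k (b z).x (b z).cov).g :=
  (φ.measurable_g k).comp
    (hb.x.prodMk (measurable_pi_lambda _ fun i => measurable_pi_lambda _ fun j => hb.cov i j))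

theorem measurableBelief_fbBelief (φ : Feedback nx ny) : ∀ k, MeasurableBelief (fbBelief S φ k)
  | 0 => ⟨measurable_const, fun _ _ => measurable_const⟩
  | k + 1 => by
      have ih := measurableBelief_fbBelief φ k
      have ih' : MeasurableBelief fun z : Fin (k + 1) → Obs nx =>
          fbBelief S φ k fun i => z i.castSucc :=
        ⟨ih.mean.comp measurable_init, fun i j => (ih.cov i j).comp measurable_init⟩
      exact MeasurableBelief.predict S (ih'.update (φ.entryMeasurable_f ih')
        (φ.measurable_g_comp ih') (measurable_pi_apply (Fin.last k)))

/-- Every feedback law generates a policy. -/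
theorem exists_isGeneratedBy (φ : Feedback nx ny) : ∃ p : Policy nx, S.IsGeneratedBy p φ := by
  let p : Policy nx :=
    { act := fun k z => φ.act k (fbBelief S φ k z).x (fbBelief S φ k z).cov
      measurable_f := fun k => φ.entryMeasurable_f (measurableBelief_fbBelief S φ k)
      measurable_g := fun k => φ.measurable_g_comp (measurableBelief_fbBelief S φ k) }
  have hp : ∀ k z, S.predBelief p k z = fbBelief S φ k z := by
    intro k
    induction k with
    | zero => intro z; rfl
    | succ k ih =>
      intro z
      simp only [LinGaussSystem.predBelief, fbBelief, ih]
      rfl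
  exact ⟨p, fun k z => by rw [hp]⟩

end Measurability

/-! ### Independence of the past from the present randomness -/

section Independence

/-- If `X` is independent of `Y` and `(X, Y)` is independent of `Z`, then `X` is independent of
`(Y, Z)`. -/
theorem indepFun_prodMk_right_of_indepFun {Ω α β γ : Type*} [MeasurableSpace Ω]
    [MeasurableSpace α] [MeasurableSpace β] [MeasurableSpace γ] {μ : Measure Ω}
    [IsProbabilityMeasure μ] {X : Ω → α} {Y : Ω → β} {Z : Ω → γ} (hX : Measurable X)
    (hY : Measurable Y) (hZ : Measurable Z) (h1 : IndepFun X Y μ)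
    (h2 : IndepFun (fun ω => (X ω, Y ω)) Z μ) : IndepFun X (fun ω => (Y ω, Z ω)) μ := by
  have hYZ : IndepFun Y Z μ := h2.comp measurable_snd measurable_id
  rw [indepFun_iff_map_prod_eq_prod_map_map hX.aemeasurable (hY.prodMk hZ).aemeasurable]
  rw [indepFun_iff_map_prod_eq_prod_map_map hX.aemeasurable hY.aemeasurable] at h1
  rw [indepFun_iff_map_prod_eq_prod_map_map (hX.prodMk hY).aemeasurable hZ.aemeasurable, h1] at h2
  rw [indepFun_iff_map_prod_eq_prod_map_map hY.aemeasurable hZ.aemeasurable] at hYZ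
  haveI := Measure.isProbabilityMeasure_map (μ := μ) hX.aemeasurable
  haveI := Measure.isProbabilityMeasure_map (μ := μ) hY.aemeasurable
  haveI := Measure.isProbabilityMeasure_map (μ := μ) hZ.aemeasurable
  have h3 : (fun ω => (X ω, Y ω, Z ω)) =
      MeasurableEquiv.prodAssoc ∘ (fun ω => ((X ω, Y ω), Z ω)) := rfl
  rw [h3, ← Measure.map_map MeasurableEquiv.prodAssoc.measurable ((hX.prodMk hY).prodMk hZ), h2,
    hYZ, Measure.prodAssoc_prod]

variable {nx ny : ℕ} (S : LinGaussSystem nx ny) {Ω : Type*}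
  {S₀ : Ω → StateIdx nx ny → ℝ} {W : ℕ → Ω → StateIdx nx ny → ℝ} {ε : ℕ → Ω → ℝ}

theorem measurable_state [MeasurableSpace Ω] (h0 : Measurable S₀) {k : ℕ}
    (hW : ∀ j < k, Measurable (W j)) : Measurable (S.state S₀ W k) := by
  induction k with
  | zero => exact h0
  | succ k ih =>
    have h1 := ih fun j hj => hW j (by omega)
    exact ((EntryMeasurable.const S.A).mulVec h1).add (hW k (by omega))

theorem measurable_X [MeasurableSpace Ω] (h0 : Measurable S₀) {k : ℕ}
    (hW : ∀ j < k, Measurable (W j)) : Measurable (S.X S₀ W k) :=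
  measurable_pi_lambda _ fun _ => (measurable_pi_apply _).comp (measurable_state S h0 hW)

theorem measurable_Y [MeasurableSpace Ω] (h0 : Measurable S₀) {k : ℕ}
    (hW : ∀ j < k, Measurable (W j)) : Measurable (S.Y S₀ W k) :=
  measurable_pi_lambda _ fun _ => (measurable_pi_apply _).comp (measurable_state S h0 hW)

theorem measurable_XYhist [MeasurableSpace Ω] (h0 : Measurable S₀) {k : ℕ}
    (hW : ∀ j < k, Measurable (W j)) : Measurable (S.XYhist S₀ W k) := by
  refine measurable_pi_lambda _ ?_
  rintro (i | ⟨t, j⟩)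
  · exact (measurable_pi_apply i).comp (measurable_X S h0 hW)
  · exact (measurable_pi_apply j).comp (measurable_Y S h0 fun j hj => hW j (by omega))

theorem measurable_discardProb_comp {α : Type*} [MeasurableSpace α] {a : α → StageParam nx}
    (hf : EntryMeasurable fun z => (a z).f) (hg : Measurable fun z => (a z).g)
    {x : α → Fin nx → ℝ} (hx : Measurable x) : Measurable fun z => (a z).discardProb (x z) := by
  unfold StageParam.discardProb
  exact (measurable_const.mul (measurable_dotProduct (hx.sub hg)
    (hf.inv.mulVec (hx.sub hg)))).exp

theorem measurable_snoc_comp {α β : Type*} [MeasurableSpace α] [MeasurableSpace β] {k : ℕ}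
    {z : α → Fin k → β} (hz : Measurable z) {o : α → β} (ho : Measurable o) :
    Measurable fun a => (Fin.snoc (α := fun _ => β) (z a) (o a) : Fin (k + 1) → β) := by
  refine measurable_pi_lambda _ fun i => ?_
  induction i using Fin.lastCases with
  | last => simpa using ho
  | cast i =>
    simp only [Fin.snoc_castSucc]
    exact (measurable_pi_apply i).comp hz

theorem measurable_output [MeasurableSpace Ω] (p : Policy nx) (h0 : Measurable S₀) {k : ℕ}
    (hW : ∀ j, j + 1 < k → Measurable (W j)) (hε : ∀ j < k, Measurable (ε j)) :
    Measurable (S.output S₀ W ε p k) := by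
  induction k with
  | zero => exact measurable_const
  | succ k ih =>
    have h1 := ih (fun j hj => hW j (by omega)) (fun j hj => hε j (by omega))
    have hX : Measurable (S.X S₀ W k) := measurable_X S h0 fun j hj => hW j (by omega)
    have hd : Measurable fun ω => (p.act k (S.output S₀ W ε p k ω)).discardProb (S.X S₀ W k ω) :=
      measurable_discardProb_comp (fun i j => (p.measurable_f k i j).comp h1)
        ((p.measurable_g k).comp h1) hX
    exact measurable_snoc_comp h1 (Measurable.ite (measurableSet_le (hε k (by omega)) hd)
      measurable_const (measurable_inl.comp hX))

theorem measurable_output_prodMk {mΩ : MeasurableSpace Ω} (p : Policy nx) (h0 : Measurable S₀)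
    {k : ℕ} (hW : ∀ j < k, Measurable (W j)) (hε : ∀ j < k, Measurable (ε j)) :
    Measurable fun ω => (S.output S₀ W ε p k ω, S.XYhist S₀ W k ω) :=
  (measurable_output S p h0 (fun j hj => hW j (by omega)) hε).prodMk (measurable_XYhist S h0 hW)

theorem measurable_output_succ_prodMk {mΩ : MeasurableSpace Ω} (p : Policy nx)
    (h0 : Measurable S₀) {k : ℕ} (hW : ∀ j < k, Measurable (W j))
    (hε : ∀ j < k + 1, Measurable (ε j)) :
    Measurable fun ω => (S.output S₀ W ε p (k + 1) ω, S.XYhist S₀ W k ω) :=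
  (measurable_output S p h0 (fun j hj => hW j (by omega)) hε).prodMk (measurable_XYhist S h0 hW)

variable [MeasurableSpace Ω] {μ : Measure Ω} [IsProbabilityMeasure μ] {S}

theorem IsDriving.measurable_output (hd : IsDriving S μ S₀ W ε) (p : Policy nx) (k : ℕ) :
    Measurable (S.output S₀ W ε p k) :=
  PrivacySampling.measurable_output S p hd.measurable_init (fun j _ => hd.measurable_noise j)
    fun j _ => hd.measurable_unif j

theorem IsDriving.measurable_XYhist (hd : IsDriving S μ S₀ W ε) (k : ℕ) :
    Measurable (S.XYhist S₀ W k) :=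
  PrivacySampling.measurable_XYhist S hd.measurable_init fun j _ => hd.measurable_noise j

/-- A function that is measurable with respect to independent data is independent. -/
theorem indepFun_of_measurable_comap {α β γ : Type*} [MeasurableSpace α] [mβ : MeasurableSpace β]
    [MeasurableSpace γ] {X : Ω → α} {Y : Ω → β} {Z : Ω → γ} (h : IndepFun X Y μ)
    (hZ : Measurable[mβ.comap Y] Z) : IndepFun Z X μ := by
  rw [IndepFun_iff_Indep] at h ⊢
  exact indep_of_indep_of_le_left h.symm hZ.comap_le

/-- The randomization variable `ε_k` is independent of the past outputs and the states. -/
theorem IsDriving.indepFun_unif (hd : IsDriving S μ S₀ W ε) (p : Policy nx) (k : ℕ) :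
    IndepFun (fun ω => (S.output S₀ W ε p k ω, S.XYhist S₀ W k ω)) (ε k) μ := by
  set past : Ω → (Finset.range k → ℝ) := fun ω j => ε j ω with hpast
  have hpm : Measurable past := measurable_pi_lambda _ fun j => hd.measurable_unif j
  have hWm : Measurable fun ω j => W j ω := measurable_pi_lambda _ fun j => hd.measurable_noise j
  have hεm : Measurable fun ω j => ε j ω := measurable_pi_lambda _ fun j => hd.measurable_unif j
  have h1 : IndepFun (ε k) past μ := by
    have := hd.indep_unif.indepFun_finset {k} (Finset.range k) (by simp) hd.measurable_unif
    exact this.comp (φ := fun v : ({k} : Finset ℕ) → ℝ => v ⟨k, by simp⟩) (ψ := id)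
      (measurable_pi_apply _) measurable_id
  have h2 : IndepFun (ε k) (fun ω => (past ω, fun j => W j ω)) μ := by
    refine indepFun_prodMk_right_of_indepFun (hd.measurable_unif k) hpm hWm h1 ?_
    refine hd.indep_noise_unif.symm.comp (φ := fun e : ℕ → ℝ =>
      (e k, fun j : Finset.range k => e j)) (ψ := id) ?_ measurable_id
    exact (measurable_pi_apply k).prodMk (measurable_pi_lambda _ fun j => measurable_pi_apply _)
  have h3 : IndepFun (ε k) (fun ω => ((past ω, fun j => W j ω), S₀ ω)) μ := by
    refine indepFun_prodMk_right_of_indepFun (hd.measurable_unif k) (hpm.prodMk hWm)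
      hd.measurable_init h2 ?_
    refine hd.indep_init.symm.comp (φ := fun e : (ℕ → StateIdx nx ny → ℝ) × (ℕ → ℝ) =>
      (e.2 k, (fun j : Finset.range k => e.2 j), e.1)) (ψ := id) ?_ measurable_id
    exact ((measurable_pi_apply k).comp measurable_snd).prodMk
      ((measurable_pi_lambda _ fun j => (measurable_pi_apply _).comp measurable_snd).prodMk
        measurable_fst)
  refine indepFun_of_measurable_comap h3 ?_
  set T : Ω → ((Finset.range k → ℝ) × (ℕ → StateIdx nx ny → ℝ)) × (StateIdx nx ny → ℝ) :=
    fun ω => ((past ω, fun j => W j ω), S₀ ω) with hT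
  have hcm : Measurable[MeasurableSpace.comap T inferInstance] T := comap_measurable T
  have c0 : Measurable[MeasurableSpace.comap T inferInstance] S₀ := measurable_snd.comp hcm
  have cW : ∀ j < k, Measurable[MeasurableSpace.comap T inferInstance] (W j) := fun j _ =>
    (measurable_pi_apply j).comp (measurable_snd.comp (measurable_fst.comp hcm))
  have cε : ∀ j < k, Measurable[MeasurableSpace.comap T inferInstance] (ε j) := fun j hj =>
    (measurable_pi_apply (⟨j, by simpa using hj⟩ : Finset.range k)).comp
      (measurable_fst.comp (measurable_fst.comp hcm))
  exact measurable_output_prodMk S p c0 cW cε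

/-- The noise `W_k` is independent of the outputs up to time `k` and the states up to time `k`. -/
theorem IsDriving.indepFun_noise (hd : IsDriving S μ S₀ W ε) (p : Policy nx) (k : ℕ) :
    IndepFun (fun ω => (S.output S₀ W ε p (k + 1) ω, S.XYhist S₀ W k ω)) (W k) μ := by
  set past : Ω → (Finset.range k → StateIdx nx ny → ℝ) := fun ω j => W j ω with hpast
  have hpm : Measurable past := measurable_pi_lambda _ fun j => hd.measurable_noise j
  have hWm : Measurable fun ω j => W j ω := measurable_pi_lambda _ fun j => hd.measurable_noise j
  have hεm : Measurable fun ω j => ε j ω := measurable_pi_lambda _ fun j => hd.measurable_unif j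
  have h1 : IndepFun (W k) past μ := by
    have := hd.indep_noise.indepFun_finset {k} (Finset.range k) (by simp) hd.measurable_noise
    exact this.comp (φ := fun v : ({k} : Finset ℕ) → StateIdx nx ny → ℝ => v ⟨k, by simp⟩)
      (ψ := id) (measurable_pi_apply _) measurable_id
  have h2 : IndepFun (W k) (fun ω => (past ω, fun j => ε j ω)) μ := by
    refine indepFun_prodMk_right_of_indepFun (hd.measurable_noise k) hpm hεm h1 ?_
    refine hd.indep_noise_unif.comp (φ := fun e : ℕ → StateIdx nx ny → ℝ =>
      (e k, fun j : Finset.range k => e j)) (ψ := id) ?_ measurable_id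
    exact (measurable_pi_apply k).prodMk (measurable_pi_lambda _ fun j => measurable_pi_apply _)
  have h3 : IndepFun (W k) (fun ω => ((past ω, fun j => ε j ω), S₀ ω)) μ := by
    refine indepFun_prodMk_right_of_indepFun (hd.measurable_noise k) (hpm.prodMk hεm)
      hd.measurable_init h2 ?_
    refine hd.indep_init.symm.comp (φ := fun e : (ℕ → StateIdx nx ny → ℝ) × (ℕ → ℝ) =>
      (e.1 k, (fun j : Finset.range k => e.1 j), e.2)) (ψ := id) ?_ measurable_id
    exact ((measurable_pi_apply k).comp measurable_fst).prodMk
      ((measurable_pi_lambda _ fun j => (measurable_pi_apply _).comp measurable_fst).prodMk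
        measurable_snd)
  refine indepFun_of_measurable_comap h3 ?_
  set T : Ω → ((Finset.range k → StateIdx nx ny → ℝ) × (ℕ → ℝ)) × (StateIdx nx ny → ℝ) :=
    fun ω => ((past ω, fun j => ε j ω), S₀ ω) with hT
  have hcm : Measurable[MeasurableSpace.comap T inferInstance] T := comap_measurable T
  have cW : ∀ j < k, Measurable[MeasurableSpace.comap T inferInstance] (W j) := fun j hj =>
    (measurable_pi_apply (⟨j, by simpa using hj⟩ : Finset.range k)).comp
      (measurable_fst.comp (measurable_fst.comp hcm))
  have c0 : Measurable[MeasurableSpace.comap T inferInstance] S₀ := measurable_snd.comp hcm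
  have cε : ∀ j < k + 1, Measurable[MeasurableSpace.comap T inferInstance] (ε j) := fun j _ =>
    (measurable_pi_apply j).comp (measurable_snd.comp (measurable_fst.comp hcm))
  exact measurable_output_succ_prodMk S p c0 cW cε

end Independence

/-! ### The conditional law of `(X_k, Y^k)` given the output -/

section ConditionalLaw

variable {nx ny : ℕ} {S : LinGaussSystem nx ny} {Ω : Type*}
  {S₀ : Ω → StateIdx nx ny → ℝ} {W : ℕ → Ω → StateIdx nx ny → ℝ} {ε : ℕ → Ω → ℝ}
  [MeasurableSpace Ω] {μ : Measure Ω} [IsProbabilityMeasure μ]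

theorem XYhist_succ (S₀ : Ω → StateIdx nx ny → ℝ) (W : ℕ → Ω → StateIdx nx ny → ℝ) (k : ℕ)
    (ω : Ω) :
    S.XYhist S₀ W (k + 1) ω =
      stepMatrix S.A k *ᵥ S.XYhist S₀ W k ω + noiseEmb nx ny k *ᵥ W k ω := by
  ext i
  rcases i with i | ⟨s, i⟩
  · simp [LinGaussSystem.XYhist, LinGaussSystem.X, LinGaussSystem.Y, LinGaussSystem.state, mulVec,
      dotProduct, stepMatrix, noiseEmb, Fintype.sum_sum_type, Fintype.sum_prod_type]
  · induction s using Fin.lastCases with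
    | last =>
      simp [LinGaussSystem.XYhist, LinGaussSystem.X, LinGaussSystem.Y, LinGaussSystem.state, mulVec,
        dotProduct, stepMatrix, noiseEmb, Fintype.sum_sum_type, Fintype.sum_prod_type]
    | cast s =>
      simp [LinGaussSystem.XYhist, LinGaussSystem.X, LinGaussSystem.Y, mulVec,
        dotProduct, stepMatrix, noiseEmb, Fintype.sum_sum_type, Fintype.sum_prod_type,
        (Fin.castSucc_lt_last _).ne, ite_and]

theorem IsDriving.map_XYhist_zero (hd : IsDriving S μ S₀ W ε) :
    μ.map (S.XYhist S₀ W 0) = gaussianVec S.initBelief.mean S.initBelief.cov := by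
  set M : Matrix (HistIdx nx ny 0) (StateIdx nx ny) ℝ :=
    (1 : Matrix (StateIdx nx ny) (StateIdx nx ny) ℝ).submatrix (Sum.map id Prod.snd) id with hM
  have hMv : ∀ v : StateIdx nx ny → ℝ, M *ᵥ v = fun i => v (Sum.map id Prod.snd i) := by
    intro v; ext i
    simp [hM, mulVec, dotProduct, one_apply]
  have h1 : S.XYhist S₀ W 0 = (fun v => M *ᵥ v + 0) ∘ S₀ := by
    ext ω i
    simp only [Function.comp_apply, add_zero, hMv]
    rcases i with i | ⟨t, j⟩
    · rfl
    · have : t = 0 := Subsingleton.elim (α := Fin 1) _ _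
      subst this; rfl
  have hmeas : Measurable fun v : StateIdx nx ny → ℝ => M *ᵥ v + 0 := by
    refine Continuous.measurable ?_
    fun_prop
  rw [h1, ← Measure.map_map hmeas hd.measurable_init, hd.law_init,
    gaussianVec_map _ S.P₀_posDef.posSemidef]
  congr 1
  · rw [hMv, add_zero]; rfl
  · ext i j
    simp [hM, mul_apply, one_apply, LinGaussSystem.initBelief]

theorem lintegral_uniform_ite {c : ℝ} (h0 : 0 ≤ c) (h1 : c ≤ 1) (A B : ℝ≥0∞) :
    ∫⁻ e in Set.Icc (0 : ℝ) 1, (if e ≤ c then A else B) =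
      ENNReal.ofReal c * A + ENNReal.ofReal (1 - c) * B := by
  have h : (fun e : ℝ => if e ≤ c then A else B) =
      fun e => (Set.Iic c).indicator (fun _ => A) e + (Set.Ioi c).indicator (fun _ => B) e := by
    ext e
    by_cases he : e ≤ c
    · simp [he]
    · simp [he, not_le.mp he]
  rw [h, lintegral_add_left (measurable_const.indicator measurableSet_Iic),
    lintegral_indicator_const measurableSet_Iic, lintegral_indicator_const measurableSet_Ioi,
    Measure.restrict_apply measurableSet_Iic, Measure.restrict_apply measurableSet_Ioi]
  have e1 : Set.Iic c ∩ Set.Icc 0 1 = Set.Icc 0 c := by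
    ext e; simp only [Set.mem_inter_iff, Set.mem_Iic, Set.mem_Icc]
    exact ⟨fun h => ⟨h.2.1, h.1⟩, fun h => ⟨h.2, h.1, h.2.trans h1⟩⟩
  have e2 : Set.Ioi c ∩ Set.Icc 0 1 = Set.Ioc c 1 := by
    ext e; simp only [Set.mem_inter_iff, Set.mem_Ioi, Set.mem_Icc, Set.mem_Ioc]
    exact ⟨fun h => ⟨h.1, h.2.2⟩, fun h => ⟨h.1, h0.trans h.1.le, h.2⟩⟩
  rw [e1, e2, Real.volume_Icc, Real.volume_Ioc, sub_zero, mul_comm A, mul_comm B]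

/-- The integral of `h` over the law of `(Z_k, X_k, Y^k)` when `(X_k, Y^k)` has the Gaussian law of
the belief `b` and the sample is discarded according to the parameters `a`. -/
noncomputable def stageIntegral {k : ℕ} (b : Belief nx ny k) (a : StageParam nx)
    (h : Obs nx → (HistIdx nx ny k → ℝ) → ℝ≥0∞) : ℝ≥0∞ :=
  ENNReal.ofReal (silentProb b.x b.cov a) *
      ∫⁻ v, h (Sum.inr ()) v
        ∂(gaussianVec (b.update a (Sum.inr ())).mean (b.update a (Sum.inr ())).cov) +
    ∫⁻ x, ENNReal.ofReal (1 - a.discardProb x) *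
        ∫⁻ v, h (Sum.inl x) v
          ∂(gaussianVec (b.update a (Sum.inl x)).mean (b.update a (Sum.inl x)).cov)
      ∂(gaussianVec b.x b.cov.toBlocks₁₁)

/-- Bayes' rule for both outcomes of a stage: the sample `x` is discarded with probability
`a.discardProb x`, and the posterior law is the Gaussian law of the updated belief. -/
theorem lintegral_stage {k : ℕ} {b : Belief nx ny k} (hb : b.cov.PosDef) (a : StageParam nx)
    {h : Obs nx → (HistIdx nx ny k → ℝ) → ℝ≥0∞}
    (hh : Measurable fun q : Obs nx × (HistIdx nx ny k → ℝ) => h q.1 q.2) :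
    ∫⁻ v, (ENNReal.ofReal (a.discardProb fun i => v (Sum.inl i)) * h (Sum.inr ()) v +
        ENNReal.ofReal (1 - a.discardProb fun i => v (Sum.inl i)) *
          h (Sum.inl fun i => v (Sum.inl i)) v) ∂(gaussianVec b.mean b.cov) =
      stageIntegral b a h := by
  have hs : Measurable fun v => h (Sum.inr ()) v := hh.comp (measurable_const.prodMk measurable_id)
  have hx : Measurable fun v : HistIdx nx ny k → ℝ => fun i => v (Sum.inl i) := by fun_prop
  have ht : Measurable fun q : (Fin nx → ℝ) × (HistIdx nx ny k → ℝ) =>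
      ENNReal.ofReal (1 - a.discardProb q.1) * h (Sum.inl q.1) q.2 :=
    (measurable_const.sub (a.measurable_discardProb.comp measurable_fst)).ennreal_ofReal.mul
      (hh.comp ((measurable_inl.comp measurable_fst).prodMk measurable_snd))
  have hds : Measurable fun v : HistIdx nx ny k → ℝ =>
      ENNReal.ofReal (a.discardProb fun i => v (Sum.inl i)) * h (Sum.inr ()) v :=
    (a.measurable_discardProb.comp hx).ennreal_ofReal.mul hs
  rw [lintegral_add_left hds,
    lintegral_discardProb_mul hb a hs, stageIntegral]
  congr 1
  have := lintegral_gaussianVec_disintegrate hb a ht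
  simp only at this
  rw [this]
  refine lintegral_congr fun x => ?_
  rw [lintegral_const_mul]
  exact hh.comp (measurable_const.prodMk measurable_id)

/-- The kernel of predicted Gaussian laws. -/
noncomputable def predKernel (S : LinGaussSystem nx ny) (p : Policy nx) (k : ℕ) :
    Kernel (Fin k → Obs nx) (HistIdx nx ny k → ℝ) :=
  gaussianKernel (fun z => (S.predBelief p k z).mean) (fun z => (S.predBelief p k z).cov)
    (measurableBelief_predBelief S p k).mean (measurableBelief_predBelief S p k).cov
    (predBelief_posDef S p k)

instance (p : Policy nx) (k : ℕ) : IsMarkovKernel (predKernel S p k) := by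
  unfold predKernel; infer_instance

theorem predKernel_apply (p : Policy nx) (k : ℕ) (z : Fin k → Obs nx) :
    predKernel S p k z = gaussianVec (S.predBelief p k z).mean (S.predBelief p k z).cov := rfl

theorem predBelief_snoc (p : Policy nx) (k : ℕ) (z : Fin k → Obs nx) (o : Obs nx) :
    S.predBelief p (k + 1) (Fin.snoc (α := fun _ => Obs nx) z o) =
      S.predict ((S.predBelief p k z).update (p.act k z) o) := by
  simp [LinGaussSystem.predBelief]

theorem filtBelief_snoc (p : Policy nx) (k : ℕ) (z : Fin k → Obs nx) (o : Obs nx) :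
    S.filtBelief p k (Fin.snoc (α := fun _ => Obs nx) z o) =
      (S.predBelief p k z).update (p.act k z) o := by
  simp [LinGaussSystem.filtBelief]

/-- If the belief recursion gives the conditional law given `Z^{k-1}`, then it gives the joint law
of `Z^k` and `(X_k, Y^k)`. -/
theorem IsDriving.lintegral_stage_of_compProd (hd : IsDriving S μ S₀ W ε) (p : Policy nx) (k : ℕ)
    (hk : μ.map (fun ω => (S.output S₀ W ε p k ω, S.XYhist S₀ W k ω)) =
      μ.map (S.output S₀ W ε p k) ⊗ₘ predKernel S p k)
    {h : (Fin (k + 1) → Obs nx) × (HistIdx nx ny k → ℝ) → ℝ≥0∞} (hh : Measurable h) :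
    ∫⁻ ω, h (S.output S₀ W ε p (k + 1) ω, S.XYhist S₀ W k ω) ∂μ =
      ∫⁻ z, stageIntegral (S.predBelief p k z) (p.act k z)
        (fun o v => h (Fin.snoc (α := fun _ => Obs nx) z o, v)) ∂(μ.map (S.output S₀ W ε p k)) := by
  classical
  have hom := hd.measurable_output p k
  have hvm := hd.measurable_XYhist k
  have hzx : Measurable fun q : (Fin k → Obs nx) × (HistIdx nx ny k → ℝ) =>
      fun i => q.2 (Sum.inl i) := by fun_prop
  have hdm : Measurable fun q : (Fin k → Obs nx) × (HistIdx nx ny k → ℝ) =>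
      (p.act k q.1).discardProb fun i => q.2 (Sum.inl i) :=
    measurable_discardProb_comp (fun i j => (p.measurable_f k i j).comp measurable_fst)
      ((p.measurable_g k).comp measurable_fst) hzx
  have hs : Measurable fun q : (Fin k → Obs nx) × (HistIdx nx ny k → ℝ) =>
      h (Fin.snoc (α := fun _ => Obs nx) q.1 (Sum.inr ()), q.2) :=
    hh.comp ((measurable_snoc_comp measurable_fst measurable_const).prodMk measurable_snd)
  have ht : Measurable fun q : (Fin k → Obs nx) × (HistIdx nx ny k → ℝ) =>
      h (Fin.snoc (α := fun _ => Obs nx) q.1 (Sum.inl fun i => q.2 (Sum.inl i)), q.2) :=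
    hh.comp ((measurable_snoc_comp measurable_fst (measurable_inl.comp hzx)).prodMk measurable_snd)
  obtain ⟨G, hG⟩ : ∃ G : ((Fin k → Obs nx) × (HistIdx nx ny k → ℝ)) × ℝ → ℝ≥0∞, G = fun q =>
    if q.2 ≤ (p.act k q.1.1).discardProb (fun i => q.1.2 (Sum.inl i)) then
      h (Fin.snoc (α := fun _ => Obs nx) q.1.1 (Sum.inr ()), q.1.2) else
      h (Fin.snoc (α := fun _ => Obs nx) q.1.1 (Sum.inl fun i => q.1.2 (Sum.inl i)), q.1.2) :=
    ⟨_, rfl⟩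
  have hGm : Measurable G := by
    rw [hG]
    exact Measurable.ite
      (measurableSet_le measurable_snd (hdm.comp measurable_fst)) (hs.comp measurable_fst)
      (ht.comp measurable_fst)
  have hpair : Measurable fun ω => (S.output S₀ W ε p k ω, S.XYhist S₀ W k ω) := hom.prodMk hvm
  have h1 : ∀ ω, h (S.output S₀ W ε p (k + 1) ω, S.XYhist S₀ W k ω) =
      G ((S.output S₀ W ε p k ω, S.XYhist S₀ W k ω), ε k ω) := by
    intro ω
    have hX : (fun i => S.XYhist S₀ W k ω (Sum.inl i)) = S.X S₀ W k ω := rfl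
    rw [hG]
    simp only [hX, LinGaussSystem.output]
    split_ifs <;> rfl
  have hind := (indepFun_iff_map_prod_eq_prod_map_map hpair.aemeasurable
    (hd.measurable_unif k).aemeasurable).mp (hd.indepFun_unif p k)
  haveI := Measure.isProbabilityMeasure_map (μ := μ) hom.aemeasurable
  haveI := Measure.isProbabilityMeasure_map (μ := μ) (hd.measurable_unif k).aemeasurable
  rw [lintegral_congr h1, ← lintegral_map (f := G) hGm (hpair.prodMk (hd.measurable_unif k)), hind,
    lintegral_prod _ hGm.aemeasurable, hd.law_unif k, hk]
  have h2 : ∀ q : (Fin k → Obs nx) × (HistIdx nx ny k → ℝ),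
      ∫⁻ e in Set.Icc (0 : ℝ) 1, G (q, e) =
        ENNReal.ofReal ((p.act k q.1).discardProb fun i => q.2 (Sum.inl i)) *
          h (Fin.snoc (α := fun _ => Obs nx) q.1 (Sum.inr ()), q.2) +
        ENNReal.ofReal (1 - (p.act k q.1).discardProb fun i => q.2 (Sum.inl i)) *
          h (Fin.snoc (α := fun _ => Obs nx) q.1 (Sum.inl fun i => q.2 (Sum.inl i)), q.2) := by
    intro q
    rw [← lintegral_uniform_ite (StageParam.discardProb_nonneg _ _)
      (StageParam.discardProb_le_one _ _)]
    subst hG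
    congr! with e
  have h3 : Measurable fun q : (Fin k → Obs nx) × (HistIdx nx ny k → ℝ) =>
      ENNReal.ofReal ((p.act k q.1).discardProb fun i => q.2 (Sum.inl i)) *
          h (Fin.snoc (α := fun _ => Obs nx) q.1 (Sum.inr ()), q.2) +
        ENNReal.ofReal (1 - (p.act k q.1).discardProb fun i => q.2 (Sum.inl i)) *
          h (Fin.snoc (α := fun _ => Obs nx) q.1 (Sum.inl fun i => q.2 (Sum.inl i)), q.2) :=
    (hdm.ennreal_ofReal.mul hs).add ((measurable_const.sub hdm).ennreal_ofReal.mul ht)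
  rw [lintegral_congr h2, Measure.lintegral_compProd h3]
  refine lintegral_congr fun z => ?_
  exact lintegral_stage (predBelief_posDef S p k z) (p.act k z)
    (h := fun o v => h (Fin.snoc (α := fun _ => Obs nx) z o, v))
    (hh.comp ((measurable_snoc_comp measurable_const measurable_fst).prodMk measurable_snd))

/-- Within a stage integral, the next state may be integrated out with the law of the predicted
belief. -/
theorem stageIntegral_predict {k : ℕ} {b : Belief nx ny k} (hb : b.cov.PosDef) (a : StageParam nx)
    {h : Obs nx → (HistIdx nx ny (k + 1) → ℝ) → ℝ≥0∞}
    (hh : Measurable fun q : Obs nx × (HistIdx nx ny (k + 1) → ℝ) => h q.1 q.2) :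
    stageIntegral b a (fun o v =>
        ∫⁻ w, h o (stepMatrix S.A k *ᵥ v + noiseEmb nx ny k *ᵥ w) ∂(gaussianVec 0 S.Q)) =
      stageIntegral b a (fun o _ => ∫⁻ v, h o v ∂(gaussianVec (S.predict (b.update a o)).mean
        (S.predict (b.update a o)).cov)) := by
  have ho : ∀ o, Measurable (h o) := fun o => hh.comp (measurable_const.prodMk measurable_id)
  have h1 : ∀ o, ∫⁻ v, ∫⁻ w, h o (stepMatrix S.A k *ᵥ v + noiseEmb nx ny k *ᵥ w)
      ∂(gaussianVec 0 S.Q) ∂(gaussianVec (b.update a o).mean (b.update a o).cov) =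
      ∫⁻ _, ∫⁻ v, h o v ∂(gaussianVec (S.predict (b.update a o)).mean
        (S.predict (b.update a o)).cov) ∂(gaussianVec (b.update a o).mean (b.update a o).cov) :=
    fun o => by
      rw [lintegral_predict S (Belief.update_posSemidef hb a o) (ho o)]
      simp
  unfold stageIntegral
  simp only [h1]

/-- The belief recursion gives the joint law of the output and `(X_k, Y^k)`. -/
theorem IsDriving.map_output_XYhist (hd : IsDriving S μ S₀ W ε) (p : Policy nx) (k : ℕ) :
    μ.map (fun ω => (S.output S₀ W ε p k ω, S.XYhist S₀ W k ω)) =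
      μ.map (S.output S₀ W ε p k) ⊗ₘ predKernel S p k := by
  induction k with
  | zero =>
    have hom := hd.measurable_output p 0
    have hvm := hd.measurable_XYhist 0
    haveI := Measure.isProbabilityMeasure_map (μ := μ) hom.aemeasurable
    refine Measure.ext_of_lintegral _ fun h hh => ?_
    have hz : ∀ ω, S.output S₀ W ε p 0 ω = Fin.elim0 := fun ω => rfl
    rw [lintegral_map hh (hom.prodMk hvm), Measure.lintegral_compProd hh,
      lintegral_map (hh.lintegral_kernel_prod_right' (κ := predKernel S p 0)) hom]
    simp only [hz, predKernel_apply, lintegral_const, measure_univ, mul_one,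
      LinGaussSystem.predBelief]
    rw [← hd.map_XYhist_zero, lintegral_map (by fun_prop) hvm]
  | succ k ih =>
    have hom := hd.measurable_output p (k + 1)
    have hvm := hd.measurable_XYhist k
    have hvm' := hd.measurable_XYhist (k + 1)
    have hpair : Measurable fun ω => (S.output S₀ W ε p (k + 1) ω, S.XYhist S₀ W k ω) :=
      hom.prodMk hvm
    haveI := Measure.isProbabilityMeasure_map (μ := μ) hom.aemeasurable
    haveI := Measure.isProbabilityMeasure_map (μ := μ) (hd.measurable_noise k).aemeasurable
    haveI := Measure.isProbabilityMeasure_map (μ := μ) hpair.aemeasurable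
    refine Measure.ext_of_lintegral _ fun h hh => ?_
    have hK : Measurable fun z => ∫⁻ v, h (z, v) ∂(predKernel S p (k + 1) z) :=
      hh.lintegral_kernel_prod_right' (κ := predKernel S p (k + 1))
    rw [lintegral_map hh (hom.prodMk hvm'), Measure.lintegral_compProd hh, lintegral_map hK hom]
    set G : ((Fin (k + 1) → Obs nx) × (HistIdx nx ny k → ℝ)) × (StateIdx nx ny → ℝ) → ℝ≥0∞ :=
      fun q => h (q.1.1, stepMatrix S.A k *ᵥ q.1.2 + noiseEmb nx ny k *ᵥ q.2) with hG
    have hGm : Measurable G := by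
      refine hh.comp ((measurable_fst.comp measurable_fst).prodMk ?_)
      exact ((EntryMeasurable.const _).mulVec (measurable_snd.comp measurable_fst)).add
        ((EntryMeasurable.const _).mulVec measurable_snd)
    have hind := (indepFun_iff_map_prod_eq_prod_map_map hpair.aemeasurable
      (hd.measurable_noise k).aemeasurable).mp (hd.indepFun_noise p k)
    have hL : ∫⁻ ω, h (S.output S₀ W ε p (k + 1) ω, S.XYhist S₀ W (k + 1) ω) ∂μ =
        ∫⁻ ω, ∫⁻ w, G ((S.output S₀ W ε p (k + 1) ω, S.XYhist S₀ W k ω), w)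
          ∂(gaussianVec 0 S.Q) ∂μ := by
      simp_rw [XYhist_succ]
      change ∫⁻ ω, G ((S.output S₀ W ε p (k + 1) ω, S.XYhist S₀ W k ω), W k ω) ∂μ = _
      rw [← lintegral_map hGm (hpair.prodMk (hd.measurable_noise k)), hind,
        lintegral_prod _ hGm.aemeasurable, hd.law_noise k,
        lintegral_map (hGm.lintegral_prod_right' (ν := gaussianVec 0 S.Q)) hpair]
    rw [hL, hd.lintegral_stage_of_compProd p k ih
        (h := fun q => ∫⁻ w, G (q, w) ∂(gaussianVec 0 S.Q))
        (hGm.lintegral_prod_right' (ν := gaussianVec 0 S.Q)),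
      hd.lintegral_stage_of_compProd p k ih
        (h := fun q => ∫⁻ v, h (q.1, v) ∂(predKernel S p (k + 1) q.1)) (hK.comp measurable_fst)]
    refine lintegral_congr fun z => ?_
    simp only [hG, predKernel_apply, predBelief_snoc]
    exact stageIntegral_predict (predBelief_posDef S p k z) (p.act k z)
      (h := fun o v => h (Fin.snoc (α := fun _ => Obs nx) z o, v))
      (hh.comp ((measurable_snoc_comp measurable_const measurable_fst).prodMk measurable_snd))

/-- The joint law of `Z^k` and `(X_k, Y^k)`. -/
theorem IsDriving.lintegral_output_succ_XYhist (hd : IsDriving S μ S₀ W ε) (p : Policy nx) (k : ℕ)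
    {h : (Fin (k + 1) → Obs nx) × (HistIdx nx ny k → ℝ) → ℝ≥0∞} (hh : Measurable h) :
    ∫⁻ ω, h (S.output S₀ W ε p (k + 1) ω, S.XYhist S₀ W k ω) ∂μ =
      ∫⁻ z, stageIntegral (S.predBelief p k z) (p.act k z)
        (fun o v => h (Fin.snoc (α := fun _ => Obs nx) z o, v)) ∂(μ.map (S.output S₀ W ε p k)) :=
  hd.lintegral_stage_of_compProd p k (hd.map_output_XYhist p k) hh

/-- The belief recursion computes the conditional law of `(X_k, Y^k)` given `Z^{k-1}`. -/
theorem IsDriving.condDistrib_XYhist (hd : IsDriving S μ S₀ W ε) (p : Policy nx) (k : ℕ) :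
    ∀ᵐ z ∂(μ.map (S.output S₀ W ε p k)),
      condDistrib (S.XYhist S₀ W k) (S.output S₀ W ε p k) μ z =
        gaussianVec (S.predBelief p k z).mean (S.predBelief p k z).cov :=
  condDistrib_ae_eq_of_measure_eq_compProd _ (hd.measurable_XYhist k).aemeasurable
    (hd.map_output_XYhist p k)

end ConditionalLaw

/-! ### The one-step loss as error plus information gain -/

section Loss

variable {nx ny k : ℕ}

/-- `log √|P^{yy}|`, which is the differential entropy of `Y^k` under the belief up to an additive
constant. -/
noncomputable def Belief.entropyY (b : Belief nx ny k) : ℝ :=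
  Real.log (Real.sqrt b.cov.toBlocks₂₂.det)

/-- The information about `Y^k` gained by an observation. -/
noncomputable def infoGain (b : Belief nx ny k) (a : StageParam nx) (o : Obs nx) : ℝ :=
  b.entropyY - (b.update a o).entropyY

theorem infoGain_nonneg {b : Belief nx ny k} (hb : b.cov.PosDef) (a : StageParam nx)
    (o : Obs nx) : 0 ≤ infoGain b a o := by
  have hpos := (Belief.update_toBlocks₂₂_posDef hb a o).det_pos
  refine sub_nonneg.mpr (Real.log_le_log (Real.sqrt_pos.mpr hpos) (Real.sqrt_le_sqrt ?_))
  -- an observation subtracts a positive semidefinite matrix from the covariance of `Y^k`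
  have key : ∀ F : Matrix (Fin nx) (Fin nx) ℝ, F.PosSemidef →
      (b.cov.toBlocks₂₁ * F * b.cov.toBlocks₁₂).PosSemidef := fun F hF => by
    rw [← toBlocks₂₁_transpose hb.1]
    exact posSemidef_congr hF _
  rcases o with x | ⟨⟩
  · have h := det_le_det_add_of_posSemidef (Belief.update_toBlocks₂₂_posDef hb a (Sum.inl x))
      (key _ hb.toBlocks₁₁.inv.posSemidef)
    rw [Belief.update_sent_cov, toBlocks_fromBlocks₂₂, sub_add_cancel] at h
    rwa [Belief.update_sent_cov, toBlocks_fromBlocks₂₂]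
  · have h := det_le_det_add_of_posSemidef (Belief.update_toBlocks₂₂_posDef hb a (Sum.inr ()))
      (key _ (a.f_posDef.add hb.toBlocks₁₁).inv.posSemidef)
    rw [Belief.update_silent_cov, silent_cov_toBlocks₂₂ hb a.f_posDef, sub_add_cancel] at h
    rwa [Belief.update_silent_cov, silent_cov_toBlocks₂₂ hb a.f_posDef]

/-- The mean squared error of the filtered mean after a silent stage. -/
noncomputable def silentError (b : Belief nx ny k) (a : StageParam nx) : ℝ :=
  (b.update a (Sum.inr ())).cov.toBlocks₁₁.trace

theorem silentError_nonneg {b : Belief nx ny k} (hb : b.cov.PosDef) (a : StageParam nx) :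
    0 ≤ silentError b a :=
  (Belief.update_silent_posDef hb a).toBlocks₁₁.posSemidef.trace_nonneg

theorem oneStepLoss_eq (lam : ℝ) {b : Belief nx ny k} (hb : b.cov.PosDef) (a : StageParam nx)
    (x : Fin nx → ℝ) :
    oneStepLoss lam b.x b.cov a = silentProb b.x b.cov a * silentError b a +
      lam * (silentProb b.x b.cov a * infoGain b a (Sum.inr ()) +
        (1 - silentProb b.x b.cov a) * infoGain b a (Sum.inl x)) := by
  unfold oneStepLoss silentError infoGain Belief.entropyY
  rw [Belief.update_silent_cov, Belief.update_sent_cov, silent_cov_toBlocks₁₁ hb a.f_posDef,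
    silent_cov_toBlocks₂₂ hb a.f_posDef, toBlocks_fromBlocks₂₂]
  ring

theorem oneStepLoss_nonneg {lam : ℝ} (hlam : 0 ≤ lam) (x : Fin nx → ℝ)
    {P : Matrix (HistIdx nx ny k) (HistIdx nx ny k) ℝ} (hP : P.PosDef) (a : StageParam nx) :
    0 ≤ oneStepLoss lam x P a := by
  set b : Belief nx ny k := ⟨Sum.elim x 0, P⟩ with hb
  have h := oneStepLoss_eq lam (b := b) hP a 0
  have hq := silentProb_nonneg b.x b.cov a
  have hq1 := sub_nonneg.mpr (silentProb_le_one b.x (P := b.cov) hP a)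
  have h1 := silentError_nonneg (b := b) hP a
  have h2 := infoGain_nonneg (b := b) hP a
  rw [show x = b.x from rfl, show P = b.cov from rfl, h]
  have := h2 (Sum.inr ())
  have := h2 (Sum.inl 0)
  positivity

/-- The loss of a stage, split into the two terms of the objective. -/
theorem ofReal_oneStepLoss {lam : ℝ} (hlam : 0 ≤ lam) {b : Belief nx ny k} (hb : b.cov.PosDef)
    (a : StageParam nx) (x : Fin nx → ℝ) :
    ENNReal.ofReal (oneStepLoss lam b.x b.cov a) =
      ENNReal.ofReal (silentProb b.x b.cov a) * ENNReal.ofReal (silentError b a) +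
      ENNReal.ofReal lam *
        (ENNReal.ofReal (silentProb b.x b.cov a) * ENNReal.ofReal (infoGain b a (Sum.inr ())) +
        ENNReal.ofReal (1 - silentProb b.x b.cov a) *
          ENNReal.ofReal (infoGain b a (Sum.inl x))) := by
  have hq := silentProb_nonneg b.x b.cov a
  have hq1 := sub_nonneg.mpr (silentProb_le_one b.x hb a)
  have h1 := silentError_nonneg hb a
  have h2 := infoGain_nonneg hb a (Sum.inr ())
  have h3 := infoGain_nonneg hb a (Sum.inl x)
  rw [oneStepLoss_eq lam hb a x, ENNReal.ofReal_add (by positivity) (by positivity),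
    ENNReal.ofReal_mul hq, ENNReal.ofReal_mul hlam, ENNReal.ofReal_add (by positivity)
    (by positivity), ENNReal.ofReal_mul hq, ENNReal.ofReal_mul hq1]

end Loss

/-! ### The mean squared error -/

section MeanSquaredError

variable {nx ny : ℕ} {S : LinGaussSystem nx ny} {Ω : Type*}
  {S₀ : Ω → StateIdx nx ny → ℝ} {W : ℕ → Ω → StateIdx nx ny → ℝ} {ε : ℕ → Ω → ℝ}
  [MeasurableSpace Ω] {μ : Measure Ω} [IsProbabilityMeasure μ] {k : ℕ}

theorem lintegral_dist_sq_fst {b : Belief nx ny k} (hb : b.cov.PosSemidef) (c : Fin nx → ℝ) :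
    ∫⁻ v, ENNReal.ofReal (((fun i => v (Sum.inl i)) - c) ⬝ᵥ ((fun i => v (Sum.inl i)) - c))
        ∂(gaussianVec b.mean b.cov) =
      ENNReal.ofReal (b.cov.toBlocks₁₁.trace + (b.x - c) ⬝ᵥ (b.x - c)) := by
  have h := gaussianVec_map b.mean hb (embX (Fin nx) (Fin (k + 1) × Fin ny))ᵀ 0
  rw [transpose_transpose, embX_transpose_mul_mul, embX_transpose_mulVec] at h
  have hpsd : b.cov.toBlocks₁₁.PosSemidef := hb.submatrix Sum.inl
  have h' := lintegral_dist_sq_gaussianVec b.x hpsd c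
  rw [← h', show b.x = (fun i => b.mean (Sum.inl i)) + 0 by rw [add_zero]; rfl, ← h,
    lintegral_map]
  · simp only [embX_transpose_mulVec, add_zero]
  · exact (measurable_dotProduct (measurable_id.sub measurable_const)
      (measurable_id.sub measurable_const)).ennreal_ofReal
  · simp only [embX_transpose_mulVec]
    fun_prop

/-- The mean squared error of an estimate of the state at one stage. -/
theorem stageIntegral_dist_sq {b : Belief nx ny k} (hb : b.cov.PosDef) (a : StageParam nx)
    (c : Obs nx → Fin nx → ℝ) :
    stageIntegral b a (fun o v => ENNReal.ofReal
        (((fun i => v (Sum.inl i)) - c o) ⬝ᵥ ((fun i => v (Sum.inl i)) - c o))) =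
      ENNReal.ofReal (silentProb b.x b.cov a) * ENNReal.ofReal (silentError b a +
        ((b.update a (Sum.inr ())).x - c (Sum.inr ())) ⬝ᵥ
          ((b.update a (Sum.inr ())).x - c (Sum.inr ()))) +
      ∫⁻ x, ENNReal.ofReal (1 - a.discardProb x) * ENNReal.ofReal
        ((x - c (Sum.inl x)) ⬝ᵥ (x - c (Sum.inl x))) ∂(gaussianVec b.x b.cov.toBlocks₁₁) := by
  unfold stageIntegral
  rw [lintegral_dist_sq_fst (Belief.update_silent_posDef hb a).posSemidef]
  congr 1
  refine lintegral_congr fun x => ?_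
  rw [lintegral_dist_sq_fst (Belief.update_sent_posSemidef hb a x), Belief.update_sent_cov,
    toBlocks_fromBlocks₁₁, trace_zero, zero_add]
  rfl

theorem IsDriving.lintegral_error (hd : IsDriving S μ S₀ W ε) (p : Policy nx) (k : ℕ)
    {e : (Fin (k + 1) → Obs nx) → Fin nx → ℝ} (he : Measurable e) :
    ∫⁻ ω, ENNReal.ofReal ((S.X S₀ W k ω - e (S.output S₀ W ε p (k + 1) ω)) ⬝ᵥ
        (S.X S₀ W k ω - e (S.output S₀ W ε p (k + 1) ω))) ∂μ =
      ∫⁻ z, stageIntegral (S.predBelief p k z) (p.act k z) (fun o v => ENNReal.ofReal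
        (((fun i => v (Sum.inl i)) - e (Fin.snoc (α := fun _ => Obs nx) z o)) ⬝ᵥ
          ((fun i => v (Sum.inl i)) - e (Fin.snoc (α := fun _ => Obs nx) z o))))
        ∂(μ.map (S.output S₀ W ε p k)) := by
  have hm : Measurable fun q : (Fin (k + 1) → Obs nx) × (HistIdx nx ny k → ℝ) =>
      (fun i => q.2 (Sum.inl i)) - e q.1 := by
    have : Measurable fun q : (Fin (k + 1) → Obs nx) × (HistIdx nx ny k → ℝ) =>
      fun i => q.2 (Sum.inl i) := by fun_prop
    exact this.sub (he.comp measurable_fst)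
  exact hd.lintegral_output_succ_XYhist p k (measurable_dotProduct hm hm).ennreal_ofReal

/-- The mean squared error of the filtered mean. -/
theorem IsDriving.lintegral_error_filtBelief (hd : IsDriving S μ S₀ W ε) (p : Policy nx) (k : ℕ) :
    ∫⁻ ω, ENNReal.ofReal
        ((S.X S₀ W k ω - (S.filtBelief p k (S.output S₀ W ε p (k + 1) ω)).x) ⬝ᵥ
        (S.X S₀ W k ω - (S.filtBelief p k (S.output S₀ W ε p (k + 1) ω)).x)) ∂μ =
      ∫⁻ z, ENNReal.ofReal (silentProb (S.predBelief p k z).x (S.predBelief p k z).cov (p.act k z))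
        * ENNReal.ofReal (silentError (S.predBelief p k z) (p.act k z))
        ∂(μ.map (S.output S₀ W ε p k)) := by
  rw [hd.lintegral_error p k (measurableBelief_filtBelief S p k).x]
  refine lintegral_congr fun z => ?_
  rw [stageIntegral_dist_sq (predBelief_posDef S p k z)]
  have h : ∀ x, (S.filtBelief p k (Fin.snoc (α := fun _ => Obs nx) z (Sum.inl x))).x = x := by
    intro x; rw [filtBelief_snoc]; rfl
  simp only [h, sub_self, dotProduct_zero, ENNReal.ofReal_zero, mul_zero, lintegral_zero, add_zero]
  simp [filtBelief_snoc]

/-- The filtered mean minimizes the mean squared error. -/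
theorem IsDriving.lintegral_error_filtBelief_le (hd : IsDriving S μ S₀ W ε) (p : Policy nx) (k : ℕ)
    {e : (Fin (k + 1) → Obs nx) → Fin nx → ℝ} (he : Measurable e) :
    ∫⁻ ω, ENNReal.ofReal
        ((S.X S₀ W k ω - (S.filtBelief p k (S.output S₀ W ε p (k + 1) ω)).x) ⬝ᵥ
        (S.X S₀ W k ω - (S.filtBelief p k (S.output S₀ W ε p (k + 1) ω)).x)) ∂μ ≤
      ∫⁻ ω, ENNReal.ofReal ((S.X S₀ W k ω - e (S.output S₀ W ε p (k + 1) ω)) ⬝ᵥ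
        (S.X S₀ W k ω - e (S.output S₀ W ε p (k + 1) ω))) ∂μ := by
  rw [hd.lintegral_error p k he, hd.lintegral_error_filtBelief p k]
  refine lintegral_mono fun z => ?_
  dsimp only
  rw [stageIntegral_dist_sq (predBelief_posDef S p k z)]
  refine le_add_right (mul_le_mul_right (ENNReal.ofReal_le_ofReal ?_) _)
  exact le_add_of_nonneg_right (Finset.sum_nonneg fun i _ => mul_self_nonneg _)

end MeanSquaredError

/-! ### The entropy of an autonomous private process -/

section Entropy

variable {nx ny k : ℕ}

/-- The coordinates of `Y^{k+1}` are those of `Y^k` and those of `Y_{k+1}`. -/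
noncomputable def histEquiv (ny k : ℕ) :
    (Fin (k + 1) × Fin ny) ⊕ Fin ny ≃ Fin (k + 2) × Fin ny :=
  Equiv.ofBijective (Sum.elim (fun tj => (tj.1.castSucc, tj.2)) fun j => (Fin.last (k + 1), j)) <| by
    constructor
    · rintro (⟨t, i⟩ | i) (⟨s, j⟩ | j) h <;>
        simp_all [Fin.castSucc_ne_last, (Fin.castSucc_ne_last _).symm]
    · rintro ⟨t, i⟩
      induction t using Fin.lastCases with
      | last => exact ⟨Sum.inr i, rfl⟩
      | cast t => exact ⟨Sum.inl (t, i), rfl⟩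

@[simp]
theorem histEquiv_inl (t : Fin (k + 1)) (i : Fin ny) :
    histEquiv ny k (Sum.inl (t, i)) = (t.castSucc, i) := rfl

@[simp]
theorem histEquiv_inr (i : Fin ny) : histEquiv ny k (Sum.inr i) = (Fin.last (k + 1), i) := rfl

theorem stepNoise_toBlocks₂₂_submatrix (Q : Matrix (StateIdx nx ny) (StateIdx nx ny) ℝ) :
    (stepNoise Q k).toBlocks₂₂.submatrix (histEquiv ny k) (histEquiv ny k) =
      fromBlocks 0 0 0 Q.toBlocks₂₂ := by
  ext (⟨t, i⟩ | i) (⟨s, j⟩ | j) <;>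
    simp [stepNoise, toBlocks₂₂, (Fin.castSucc_lt_last _).ne]

/-- If `Y` evolves autonomously, then a prediction step adds the same amount to the entropy of the
private history under every belief. -/
theorem det_predict_toBlocks₂₂ (S : LinGaussSystem nx ny) (hA : S.A.toBlocks₂₁ = 0)
    (b : Belief nx ny k) :
    (S.predict b).cov.toBlocks₂₂.det = b.cov.toBlocks₂₂.det * S.Q.toBlocks₂₂.det := by
  have hA' : ∀ i j, S.A (Sum.inr i) (Sum.inl j) = 0 := fun i j => congrFun (congrFun hA i) j
  set M := stepMatrix S.A k with hM
  have h21 : M.toBlocks₂₁ = 0 := by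
    ext ⟨s, i⟩ j
    simp [hM, toBlocks₂₁, stepMatrix, hA']
  have h22 : (M * b.cov * Mᵀ).toBlocks₂₂ = M.toBlocks₂₂ * b.cov.toBlocks₂₂ * M.toBlocks₂₂ᵀ := by
    conv_lhs => rw [← fromBlocks_toBlocks M, ← fromBlocks_toBlocks b.cov, h21,
      fromBlocks_transpose, fromBlocks_multiply, fromBlocks_multiply, toBlocks_fromBlocks₂₂]
    simp
  obtain ⟨B, hB⟩ : ∃ B : Matrix (Fin ny) (Fin (k + 1) × Fin ny) ℝ,
      M.toBlocks₂₂.submatrix (histEquiv ny k) id = fromRows 1 B := by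
    refine ⟨fun i j => M.toBlocks₂₂ (histEquiv ny k (Sum.inr i)) j, ?_⟩
    ext (⟨t, i⟩ | i) ⟨s, j⟩
    · by_cases h : t = s ∧ i = j
      · obtain ⟨rfl, rfl⟩ := h
        refine Eq.trans ?_ (one_apply_eq _).symm
        simp [hM, toBlocks₂₂, stepMatrix, (Fin.castSucc_lt_last _).ne]
      · refine Eq.trans ?_ (one_apply_ne (by simpa using h)).symm
        simp [hM, toBlocks₂₂, stepMatrix, (Fin.castSucc_lt_last _).ne, h]
    · rfl
  -- up to a unimodular congruence the new covariance is block diagonal, with blocks `P^{yy}`, `Q^{yy}`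
  have hsub : (S.predict b).cov.toBlocks₂₂.submatrix (histEquiv ny k) (histEquiv ny k) =
      fromBlocks 1 0 B 1 * fromBlocks b.cov.toBlocks₂₂ 0 0 S.Q.toBlocks₂₂ *
        (fromBlocks 1 0 B 1)ᵀ := by
    have h1 : (S.predict b).cov.toBlocks₂₂ =
        (M * b.cov * Mᵀ).toBlocks₂₂ + (stepNoise S.Q k).toBlocks₂₂ := rfl
    have h2 : (M.toBlocks₂₂ * b.cov.toBlocks₂₂ * M.toBlocks₂₂ᵀ).submatrix (histEquiv ny k)
        (histEquiv ny k) = M.toBlocks₂₂.submatrix (histEquiv ny k) id * b.cov.toBlocks₂₂ *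
          (M.toBlocks₂₂.submatrix (histEquiv ny k) id)ᵀ := rfl
    rw [h1, h22, submatrix_add, Pi.add_apply, Pi.add_apply, stepNoise_toBlocks₂₂_submatrix, h2, hB,
      transpose_fromRows, fromRows_mul, fromRows_mul_fromCols, fromBlocks_add,
      fromBlocks_transpose, fromBlocks_multiply, fromBlocks_multiply]
    simp
  rw [← det_submatrix_equiv_self (histEquiv ny k), hsub, det_mul, det_mul, det_transpose,
    det_fromBlocks_zero₁₂, det_fromBlocks_zero₁₂]
  simp

theorem entropyY_predict (S : LinGaussSystem nx ny) (hA : S.A.toBlocks₂₁ = 0)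
    {b : Belief nx ny k} (hb : b.cov.toBlocks₂₂.PosDef) :
    (S.predict b).entropyY = b.entropyY + Real.log (Real.sqrt S.Q.toBlocks₂₂.det) := by
  unfold Belief.entropyY
  rw [det_predict_toBlocks₂₂ S hA, Real.sqrt_mul hb.det_pos.le, Real.log_mul
    (Real.sqrt_pos.mpr hb.det_pos).ne' (Real.sqrt_pos.mpr S.Q_posDef.toBlocks₂₂.det_pos).ne']

/-- The belief about `(X_k, Y^k)` without observations. -/
def priorBelief (S : LinGaussSystem nx ny) : (k : ℕ) → Belief nx ny k
  | 0 => S.initBelief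
  | k + 1 => S.predict (priorBelief S k)

theorem priorBelief_posDef (S : LinGaussSystem nx ny) (k : ℕ) :
    (priorBelief S k).cov.PosDef := by
  induction k with
  | zero => exact initBelief_posDef S
  | succ k ih => exact predict_posDef S ih.posSemidef ih.toBlocks₂₂

theorem filtBelief_toBlocks₂₂_posDef (S : LinGaussSystem nx ny) (p : Policy nx) (k : ℕ)
    (z : Fin (k + 1) → Obs nx) : (S.filtBelief p k z).cov.toBlocks₂₂.PosDef :=
  Belief.update_toBlocks₂₂_posDef (predBelief_posDef S p k _) _ _

/-- The total information gained about `Y^k` along an output history. -/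
noncomputable def totalInfoGain (S : LinGaussSystem nx ny) (p : Policy nx) (k : ℕ)
    (z : Fin (k + 1) → Obs nx) : ℝ :=
  (priorBelief S k).entropyY - (S.filtBelief p k z).entropyY

theorem totalInfoGain_zero (S : LinGaussSystem nx ny) (p : Policy nx) (z : Fin 0 → Obs nx)
    (o : Obs nx) : totalInfoGain S p 0 (Fin.snoc (α := fun _ => Obs nx) z o) =
      infoGain (S.predBelief p 0 z) (p.act 0 z) o := by
  rw [totalInfoGain, filtBelief_snoc]
  rfl

/-- Chain rule for an autonomous private process. -/
theorem totalInfoGain_succ (S : LinGaussSystem nx ny) (hA : S.A.toBlocks₂₁ = 0) (p : Policy nx)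
    (k : ℕ) (z : Fin (k + 1) → Obs nx) (o : Obs nx) :
    totalInfoGain S p (k + 1) (Fin.snoc (α := fun _ => Obs nx) z o) = totalInfoGain S p k z +
      infoGain (S.predBelief p (k + 1) z) (p.act (k + 1) z) o := by
  have h1 : (S.predBelief p (k + 1) z).entropyY = (S.filtBelief p k z).entropyY +
      Real.log (Real.sqrt S.Q.toBlocks₂₂.det) :=
    entropyY_predict S hA (filtBelief_toBlocks₂₂_posDef S p k z)
  have h2 : (priorBelief S (k + 1)).entropyY = (priorBelief S k).entropyY +
      Real.log (Real.sqrt S.Q.toBlocks₂₂.det) :=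
    entropyY_predict S hA (priorBelief_posDef S k).toBlocks₂₂
  rw [totalInfoGain, totalInfoGain, infoGain, filtBelief_snoc, h1, h2]
  ring

theorem totalInfoGain_nonneg (S : LinGaussSystem nx ny) (hA : S.A.toBlocks₂₁ = 0) (p : Policy nx)
    (k : ℕ) (z : Fin (k + 1) → Obs nx) : 0 ≤ totalInfoGain S p k z := by
  induction k with
  | zero =>
    rw [← Fin.snoc_init_self z, totalInfoGain_zero]
    exact infoGain_nonneg (predBelief_posDef S p 0 _) _ _
  | succ k ih =>
    rw [← Fin.snoc_init_self z, totalInfoGain_succ S hA]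
    exact add_nonneg (ih _) (infoGain_nonneg (predBelief_posDef S p _ _) _ _)

theorem measurable_entropyY {α : Type*} [MeasurableSpace α] {b : α → Belief nx ny k}
    (hb : MeasurableBelief b) : Measurable fun z => (b z).entropyY := by
  have h : EntryMeasurable fun z => (b z).cov.toBlocks₂₂ := fun i j => hb.cov _ _
  exact h.det.sqrt.log

theorem measurable_totalInfoGain (S : LinGaussSystem nx ny) (p : Policy nx) (k : ℕ) :
    Measurable (totalInfoGain S p k) :=
  measurable_const.sub (measurable_entropyY (measurableBelief_filtBelief S p k))

end Entropy

section ExpectedGain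

variable {nx ny : ℕ} {S : LinGaussSystem nx ny} {Ω : Type*}
  {S₀ : Ω → StateIdx nx ny → ℝ} {W : ℕ → Ω → StateIdx nx ny → ℝ} {ε : ℕ → Ω → ℝ}
  [MeasurableSpace Ω] {μ : Measure Ω} [IsProbabilityMeasure μ] {k : ℕ}

theorem stageIntegral_const {b : Belief nx ny k} (a : StageParam nx) (c : Obs nx → ℝ≥0∞) :
    stageIntegral b a (fun o _ => c o) =
      ENNReal.ofReal (silentProb b.x b.cov a) * c (Sum.inr ()) +
      ∫⁻ x, ENNReal.ofReal (1 - a.discardProb x) * c (Sum.inl x)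
        ∂(gaussianVec b.x b.cov.toBlocks₁₁) := by
  simp [stageIntegral]

/-- Expectations of functions of `Z^k`. -/
theorem IsDriving.lintegral_output_succ (hd : IsDriving S μ S₀ W ε) (p : Policy nx) (k : ℕ)
    {h : (Fin (k + 1) → Obs nx) → ℝ≥0∞} (hh : Measurable h) :
    ∫⁻ ω, h (S.output S₀ W ε p (k + 1) ω) ∂μ =
      ∫⁻ z, (ENNReal.ofReal (silentProb (S.predBelief p k z).x (S.predBelief p k z).cov
            (p.act k z)) * h (Fin.snoc (α := fun _ => Obs nx) z (Sum.inr ())) +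
        ∫⁻ x, ENNReal.ofReal (1 - (p.act k z).discardProb x) *
            h (Fin.snoc (α := fun _ => Obs nx) z (Sum.inl x))
          ∂(gaussianVec (S.predBelief p k z).x (S.predBelief p k z).cov.toBlocks₁₁))
        ∂(μ.map (S.output S₀ W ε p k)) := by
  rw [hd.lintegral_output_succ_XYhist p k (h := fun q => h q.1) (hh.comp measurable_fst)]
  refine lintegral_congr fun z => ?_
  exact stageIntegral_const _ fun o => h (Fin.snoc (α := fun _ => Obs nx) z o)

theorem StageParam.measurable_one_sub_discardProb (a : StageParam nx) :
    Measurable fun x => ENNReal.ofReal (1 - a.discardProb x) :=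
  (measurable_const.sub a.measurable_discardProb).ennreal_ofReal

theorem stage_infoGain {b : Belief nx ny k} (hb : b.cov.PosDef) (a : StageParam nx) :
    ENNReal.ofReal (silentProb b.x b.cov a) * ENNReal.ofReal (infoGain b a (Sum.inr ())) +
      ∫⁻ x, ENNReal.ofReal (1 - a.discardProb x) * ENNReal.ofReal (infoGain b a (Sum.inl x))
        ∂(gaussianVec b.x b.cov.toBlocks₁₁) =
    ENNReal.ofReal (silentProb b.x b.cov a) * ENNReal.ofReal (infoGain b a (Sum.inr ())) +
      ENNReal.ofReal (1 - silentProb b.x b.cov a) * ENNReal.ofReal (infoGain b a (Sum.inl 0)) := by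
  have h : ∀ x, infoGain b a (Sum.inl x) = infoGain b a (Sum.inl 0) := fun x => rfl
  simp_rw [h]
  rw [lintegral_mul_const _ a.measurable_one_sub_discardProb,
    lintegral_one_sub_discardProb hb]

/-- The expected information gain of a stage, which is the second term of the one-step loss. -/
noncomputable def meanInfoGain (b : Belief nx ny k) (a : StageParam nx) : ℝ≥0∞ :=
  ENNReal.ofReal (silentProb b.x b.cov a) * ENNReal.ofReal (infoGain b a (Sum.inr ())) +
    ENNReal.ofReal (1 - silentProb b.x b.cov a) * ENNReal.ofReal (infoGain b a (Sum.inl 0))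

theorem IsDriving.lintegral_totalInfoGain (hd : IsDriving S μ S₀ W ε) (hA : S.A.toBlocks₂₁ = 0)
    (p : Policy nx) (k : ℕ) :
    ∫⁻ ω, ENNReal.ofReal (totalInfoGain S p k (S.output S₀ W ε p (k + 1) ω)) ∂μ =
      ∑ j ∈ Finset.range (k + 1), ∫⁻ z, meanInfoGain (S.predBelief p j z) (p.act j z)
        ∂(μ.map (S.output S₀ W ε p j)) := by
  induction k with
  | zero =>
    rw [hd.lintegral_output_succ p 0 (measurable_totalInfoGain S p 0).ennreal_ofReal]
    simp only [totalInfoGain_zero, zero_add, Finset.sum_range_one]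
    refine lintegral_congr fun z => ?_
    exact stage_infoGain (predBelief_posDef S p 0 z) _
  | succ k ih =>
    rw [Finset.sum_range_succ, ← ih, hd.lintegral_output_succ p (k + 1)
      (measurable_totalInfoGain S p (k + 1)).ennreal_ofReal]
    have hom := hd.measurable_output p (k + 1)
    rw [← lintegral_map (f := fun z => ENNReal.ofReal (totalInfoGain S p k z))
      (measurable_totalInfoGain S p k).ennreal_ofReal hom,
      ← lintegral_add_left (measurable_totalInfoGain S p k).ennreal_ofReal]
    refine lintegral_congr fun z => ?_
    have hb := predBelief_posDef S p (k + 1) z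
    have h0 := totalInfoGain_nonneg S hA p k z
    have hg := infoGain_nonneg hb (p.act (k + 1) z)
    simp only [totalInfoGain_succ S hA, ENNReal.ofReal_add h0 (hg _)]
    simp_rw [mul_add]
    rw [lintegral_add_left ((p.act (k + 1) z).measurable_one_sub_discardProb.mul_const _),
      lintegral_mul_const _ (p.act (k + 1) z).measurable_one_sub_discardProb, lintegral_one_sub_discardProb hb,
      meanInfoGain, ← stage_infoGain hb, add_add_add_comm, ← add_mul, ← ENNReal.ofReal_add
      (silentProb_nonneg _ _ _) (sub_nonneg.mpr (silentProb_le_one _ hb _))]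
    simp

end ExpectedGain

/-! ### Mutual information -/

section KullbackLeibler

/-- If the log-likelihood ratio is the sum of a nonnegative function and an integrable function of
mean zero, then the divergence is the integral of the former, also when it is infinite. -/
theorem klDiv_withDensity_eq_lintegral {γ : Type*} [MeasurableSpace γ] {J ν : Measure γ}
    [IsProbabilityMeasure J] [IsProbabilityMeasure ν] {ρ : γ → ℝ} (hρ : Measurable ρ)
    (hpos : ∀ x, 0 < ρ x) (hJ : J = ν.withDensity fun x => ENNReal.ofReal (ρ x)) {i s : γ → ℝ}
    (hi : Measurable i) (hi0 : ∀ x, 0 ≤ i x) (hs : Integrable s J) (hs0 : ∫ x, s x ∂J = 0)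
    (hlog : ∀ x, Real.log (ρ x) = i x + s x) :
    InformationTheory.klDiv J ν = ∫⁻ x, ENNReal.ofReal (i x) ∂J := by
  have hac : J ≪ ν := hJ ▸ withDensity_absolutelyContinuous _ _
  have hrn : J.rnDeriv ν =ᵐ[J] fun x => ENNReal.ofReal (ρ x) := by
    refine hac.ae_le ?_
    rw [hJ]
    exact Measure.rnDeriv_withDensity _ hρ.ennreal_ofReal
  have hllr : llr J ν =ᵐ[J] fun x => i x + s x := by
    filter_upwards [hrn] with x hx
    rw [llr, hx, ENNReal.toReal_ofReal (hpos x).le, hlog]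
  by_cases hint : Integrable i J
  · rw [InformationTheory.klDiv_of_ac_of_integrable hac ((integrable_congr hllr).mpr
      (hint.add hs)), integral_congr_ae hllr, integral_add hint hs, hs0]
    simp only [add_zero, probReal_univ, add_sub_cancel_right]
    exact ofReal_integral_eq_lintegral_ofReal hint (.of_forall hi0)
  · rw [InformationTheory.klDiv_of_not_integrable]
    · by_contra h
      exact hint ((lintegral_ofReal_ne_top_iff_integrable hi.aestronglyMeasurable
        (.of_forall hi0)).mp (Ne.symm h))
    · rw [integrable_congr hllr]
      intro h
      refine hint ((h.sub hs).congr (.of_forall fun x => ?_))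
      simp

/-- Change of measure between two nondegenerate Gaussian laws. -/
theorem lintegral_gaussianVec_div {ι : Type*} [Fintype ι] [DecidableEq ι] (m m' : ι → ℝ)
    {P P' : Matrix ι ι ℝ} (hP : P.PosDef) (hP' : P'.PosDef) {h : (ι → ℝ) → ℝ≥0∞}
    (hh : Measurable h) :
    ∫⁻ v, ENNReal.ofReal (gaussianDensity m P v / gaussianDensity m' P' v) * h v
      ∂(gaussianVec m' P') = ∫⁻ v, h v ∂(gaussianVec m P) := by
  have h1 := measurable_gaussianDensity m P
  have h2 := measurable_gaussianDensity m' P'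
  have h3 : Measurable fun v =>
      ENNReal.ofReal (gaussianDensity m P v / gaussianDensity m' P' v) * h v :=
    (h1.div h2).ennreal_ofReal.mul hh
  rw [gaussianVec_eq_withDensity m hP, gaussianVec_eq_withDensity m' hP',
    lintegral_withDensity_eq_lintegral_mul _ h2.ennreal_ofReal h3,
    lintegral_withDensity_eq_lintegral_mul _ h1.ennreal_ofReal hh]
  refine lintegral_congr fun v => ?_
  have hv := gaussianDensity_pos hP' m' v
  simp only [Pi.mul_apply]
  rw [← mul_assoc, ← ENNReal.ofReal_mul hv.le, mul_div_cancel₀ _ hv.ne']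

theorem log_gaussianDensity {ι : Type*} [Fintype ι] [DecidableEq ι] (m : ι → ℝ)
    {P : Matrix ι ι ℝ} (hP : P.PosDef) (v : ι → ℝ) :
    Real.log (gaussianDensity m P v) = -Real.log (Real.sqrt (2 * Real.pi) ^ Fintype.card ι) -
      Real.log (Real.sqrt P.det) - 1 / 2 * ((v - m) ⬝ᵥ (P⁻¹ *ᵥ (v - m))) := by
  have h1 : Real.sqrt (2 * Real.pi) ^ Fintype.card ι ≠ 0 := by positivity
  have h2 : Real.sqrt P.det ≠ 0 := (Real.sqrt_pos.mpr hP.det_pos).ne'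
  rw [gaussianDensity, Real.log_mul (inv_ne_zero (mul_ne_zero h1 h2)) (Real.exp_ne_zero _),
    Real.log_inv, Real.log_mul h1 h2, Real.log_exp]
  ring

theorem mahalanobis_nonneg {ι : Type*} [Fintype ι] [DecidableEq ι] {P : Matrix ι ι ℝ}
    (hP : P.PosDef) (v : ι → ℝ) : 0 ≤ v ⬝ᵥ (P⁻¹ *ᵥ v) := by
  simpa using hP.inv.posSemidef.dotProduct_mulVec_nonneg v

/-- The Mahalanobis distance has the same mean under every nondegenerate Gaussian law. -/
theorem lintegral_mahalanobis {ι : Type*} [Fintype ι] [DecidableEq ι] (m : ι → ℝ)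
    {P : Matrix ι ι ℝ} (hP : P.PosDef) :
    ∫⁻ v, ENNReal.ofReal ((v - m) ⬝ᵥ (P⁻¹ *ᵥ (v - m))) ∂(gaussianVec m P) = Fintype.card ι := by
  obtain ⟨h1, h2⟩ := integral_quadratic_gaussianVec m hP.posSemidef P⁻¹
  rw [← ofReal_integral_eq_lintegral_ofReal h1, h2, nonsing_inv_mul _ hP.det_pos.ne'.isUnit,
    trace_one]
  · simp
  · exact .of_forall fun v => mahalanobis_nonneg hP _

end KullbackLeibler

section Leakage

variable {nx ny : ℕ} {S : LinGaussSystem nx ny} {Ω : Type*}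
  {S₀ : Ω → StateIdx nx ny → ℝ} {W : ℕ → Ω → StateIdx nx ny → ℝ} {ε : ℕ → Ω → ℝ}
  [MeasurableSpace Ω] {μ : Measure Ω} [IsProbabilityMeasure μ] {k : ℕ}

theorem IsDriving.map_XYhist (hd : IsDriving S μ S₀ W ε) (p : Policy nx) (k : ℕ) :
    μ.map (S.XYhist S₀ W k) = gaussianVec (priorBelief S k).mean (priorBelief S k).cov := by
  induction k with
  | zero => exact hd.map_XYhist_zero
  | succ k ih =>
    have hvm := hd.measurable_XYhist k
    haveI := Measure.isProbabilityMeasure_map (μ := μ) hvm.aemeasurable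
    haveI := Measure.isProbabilityMeasure_map (μ := μ) (hd.measurable_noise k).aemeasurable
    refine Measure.ext_of_lintegral _ fun h hh => ?_
    have hind := (indepFun_iff_map_prod_eq_prod_map_map hvm.aemeasurable
      (hd.measurable_noise k).aemeasurable).mp
      ((hd.indepFun_noise p k).comp measurable_snd measurable_id)
    have hG : Measurable fun q : (HistIdx nx ny k → ℝ) × (StateIdx nx ny → ℝ) =>
        h (stepMatrix S.A k *ᵥ q.1 + noiseEmb nx ny k *ᵥ q.2) :=
      hh.comp (((EntryMeasurable.const _).mulVec measurable_fst).add
        ((EntryMeasurable.const _).mulVec measurable_snd))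
    rw [lintegral_map hh (hd.measurable_XYhist (k + 1))]
    simp_rw [XYhist_succ]
    rw [← lintegral_map hG (hvm.prodMk (hd.measurable_noise k)), hind,
      lintegral_prod _ hG.aemeasurable, hd.law_noise k, ih]
    exact lintegral_predict S (priorBelief_posDef S k).posSemidef hh

theorem lintegral_gaussianVec_snd {b : Belief nx ny k} (hb : b.cov.PosSemidef)
    {h : (Fin (k + 1) × Fin ny → ℝ) → ℝ≥0∞} (hh : Measurable h) :
    ∫⁻ v, h (fun j => v (Sum.inr j)) ∂(gaussianVec b.mean b.cov) =
      ∫⁻ y, h y ∂(gaussianVec b.y b.cov.toBlocks₂₂) := by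
  set M : Matrix (Fin (k + 1) × Fin ny) (HistIdx nx ny k) ℝ := fromCols 0 1 with hM
  have hMv : ∀ v, M *ᵥ v = fun j => v (Sum.inr j) := fun v => by
    ext j
    simp [hM, mulVec, dotProduct, one_apply]
  have h1 := gaussianVec_map b.mean hb M 0
  have h2 : M * b.cov * Mᵀ = b.cov.toBlocks₂₂ := by
    ext i j
    simp [hM, mul_apply, one_apply, toBlocks₂₂]
  rw [h2, hMv, add_zero] at h1
  change _ = ∫⁻ y, h y ∂(gaussianVec (fun j => b.mean (Sum.inr j)) b.cov.toBlocks₂₂)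
  rw [← h1, lintegral_map hh]
  · simp only [hMv, add_zero]
  · simp only [hMv, add_zero]
    fun_prop

/-- The kernel of filtered Gaussian laws of the private history. -/
noncomputable def filtKernel (S : LinGaussSystem nx ny) (p : Policy nx) (k : ℕ) :
    Kernel (Fin (k + 1) → Obs nx) (Fin (k + 1) × Fin ny → ℝ) :=
  gaussianKernel (fun z => (S.filtBelief p k z).y) (fun z => (S.filtBelief p k z).cov.toBlocks₂₂)
    (measurableBelief_filtBelief S p k).y
    (fun _ _ => (measurableBelief_filtBelief S p k).cov _ _)
    (filtBelief_toBlocks₂₂_posDef S p k)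

theorem filtKernel_apply (p : Policy nx) (k : ℕ) (z : Fin (k + 1) → Obs nx) :
    filtKernel S p k z =
      gaussianVec (S.filtBelief p k z).y (S.filtBelief p k z).cov.toBlocks₂₂ := rfl

instance (p : Policy nx) (k : ℕ) : IsMarkovKernel (filtKernel S p k) :=
  ⟨fun z => by rw [filtKernel_apply]; infer_instance⟩

/-- The joint law of the output and the private history. -/
theorem IsDriving.lintegral_output_Y (hd : IsDriving S μ S₀ W ε) (p : Policy nx) (k : ℕ)
    {h : (Fin (k + 1) → Obs nx) × (Fin (k + 1) × Fin ny → ℝ) → ℝ≥0∞} (hh : Measurable h) :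
    ∫⁻ ω, h (S.output S₀ W ε p (k + 1) ω, fun tj => S.Y S₀ W tj.1 ω tj.2) ∂μ =
      ∫⁻ z, ∫⁻ y, h (z, y) ∂(gaussianVec (S.filtBelief p k z).y
        (S.filtBelief p k z).cov.toBlocks₂₂) ∂(μ.map (S.output S₀ W ε p (k + 1))) := by
  have hK : Measurable fun z => ∫⁻ y, h (z, y) ∂(filtKernel S p k z) :=
    hh.lintegral_kernel_prod_right' (κ := filtKernel S p k)
  simp_rw [← filtKernel_apply]
  rw [lintegral_map hK (hd.measurable_output p (k + 1)), hd.lintegral_output_succ p k hK]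
  have hv : Measurable fun q : (Fin (k + 1) → Obs nx) × (HistIdx nx ny k → ℝ) =>
      (q.1, fun j => q.2 (Sum.inr j)) := by fun_prop
  refine (hd.lintegral_output_succ_XYhist p k (hh.comp hv)).trans (lintegral_congr fun z => ?_)
  rw [← stageIntegral_const (p.act k z) fun o =>
    ∫⁻ y, h (Fin.snoc (α := fun _ => Obs nx) z o, y) ∂(filtKernel S p k (Fin.snoc z o))]
  have hb := predBelief_posDef S p k z
  have h1 : ∀ o, ∫⁻ v, h (Fin.snoc (α := fun _ => Obs nx) z o, fun j => v (Sum.inr j))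
      ∂(gaussianVec ((S.predBelief p k z).update (p.act k z) o).mean
        ((S.predBelief p k z).update (p.act k z) o).cov) =
      ∫⁻ v, ∫⁻ y, h (Fin.snoc (α := fun _ => Obs nx) z o, y) ∂(filtKernel S p k (Fin.snoc z o))
      ∂(gaussianVec ((S.predBelief p k z).update (p.act k z) o).mean
        ((S.predBelief p k z).update (p.act k z) o).cov) := fun o => by
    rw [lintegral_const, measure_univ, mul_one, filtKernel_apply, filtBelief_snoc]
    exact lintegral_gaussianVec_snd (Belief.update_posSemidef hb _ o)
      (h := fun y => h (Fin.snoc (α := fun _ => Obs nx) z o, y))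
      (hh.comp (measurable_const.prodMk measurable_id))
  simp only [stageIntegral, Function.comp_apply, h1]

theorem IsDriving.lintegral_Y (hd : IsDriving S μ S₀ W ε) (p : Policy nx) (k : ℕ)
    {h : (Fin (k + 1) × Fin ny → ℝ) → ℝ≥0∞} (hh : Measurable h) :
    ∫⁻ ω, h (fun tj => S.Y S₀ W tj.1 ω tj.2) ∂μ =
      ∫⁻ y, h y ∂(gaussianVec (priorBelief S k).y (priorBelief S k).cov.toBlocks₂₂) := by
  rw [← lintegral_gaussianVec_snd (priorBelief_posDef S k).posSemidef hh, ← hd.map_XYhist p,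
    lintegral_map _ (hd.measurable_XYhist k)]
  · rfl
  · exact hh.comp (by fun_prop)

/-- The leakage is the expected total information gain. -/
theorem IsDriving.leakage_eq (hd : IsDriving S μ S₀ W ε) (hA : S.A.toBlocks₂₁ = 0)
    (p : Policy nx) (k : ℕ) :
    S.leakage S₀ W ε μ k p =
      ∫⁻ ω, ENNReal.ofReal (totalInfoGain S p k (S.output S₀ W ε p (k + 1) ω)) ∂μ := by
  have hom := hd.measurable_output p (k + 1)
  have hYm : Measurable fun ω => fun t : Fin (k + 1) => S.Y S₀ W t ω :=
    measurable_pi_lambda _ fun t => measurable_Y S hd.measurable_init fun j _ => hd.measurable_noise j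
  have hpm := hom.prodMk hYm
  haveI := Measure.isProbabilityMeasure_map (μ := μ) hom.aemeasurable
  haveI := Measure.isProbabilityMeasure_map (μ := μ) hYm.aemeasurable
  haveI := Measure.isProbabilityMeasure_map (μ := μ) hpm.aemeasurable
  have hposF := filtBelief_toBlocks₂₂_posDef S p k
  have hposP := (priorBelief_posDef S k).toBlocks₂₂
  obtain ⟨F, hF⟩ : ∃ F : ((Fin (k + 1) → Obs nx) × (Fin (k + 1) → Fin ny → ℝ)) → ℝ, F = fun q =>
    gaussianDensity (S.filtBelief p k q.1).y (S.filtBelief p k q.1).cov.toBlocks₂₂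
      (fun tj => q.2 tj.1 tj.2) := ⟨_, rfl⟩
  obtain ⟨G, hG⟩ : ∃ G : (Fin (k + 1) → Fin ny → ℝ) → ℝ, G = fun y =>
    gaussianDensity (priorBelief S k).y (priorBelief S k).cov.toBlocks₂₂
      (fun tj => y tj.1 tj.2) := ⟨_, rfl⟩
  have hunc : Measurable fun (y : Fin (k + 1) → Fin ny → ℝ) (tj : Fin (k + 1) × Fin ny) =>
      y tj.1 tj.2 := by fun_prop
  have hcur : Measurable fun (y : Fin (k + 1) × Fin ny → ℝ) (t : Fin (k + 1)) (j : Fin ny) =>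
      y (t, j) := by fun_prop
  have hbF : MeasurableBelief fun q : (Fin (k + 1) → Obs nx) × (Fin (k + 1) → Fin ny → ℝ) =>
      S.filtBelief p k q.1 :=
    ⟨(measurableBelief_filtBelief S p k).mean.comp measurable_fst,
      fun i j => ((measurableBelief_filtBelief S p k).cov i j).comp measurable_fst⟩
  have hFm : Measurable F := by
    rw [hF]
    exact measurable_gaussianDensity_comp hbF.y (fun _ _ => hbF.cov _ _)
      (hunc.comp measurable_snd)
  have hGm : Measurable G := by
    rw [hG]
    exact (measurable_gaussianDensity _ _).comp hunc
  have hF0 : ∀ q, 0 < F q := fun q => by rw [hF]; exact gaussianDensity_pos (hposF _) _ _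
  have hG0 : ∀ y, 0 < G y := fun y => by rw [hG]; exact gaussianDensity_pos hposP _ _
  -- the two Mahalanobis distances in the log-likelihood ratio
  obtain ⟨A, hAq⟩ : ∃ A : ((Fin (k + 1) → Obs nx) × (Fin (k + 1) → Fin ny → ℝ)) → ℝ, A = fun q =>
    ((fun tj => q.2 tj.1 tj.2) - (S.filtBelief p k q.1).y) ⬝ᵥ
      ((S.filtBelief p k q.1).cov.toBlocks₂₂⁻¹ *ᵥ
        ((fun tj => q.2 tj.1 tj.2) - (S.filtBelief p k q.1).y)) := ⟨_, rfl⟩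
  obtain ⟨B, hBq⟩ : ∃ B : ((Fin (k + 1) → Obs nx) × (Fin (k + 1) → Fin ny → ℝ)) → ℝ, B = fun q =>
    ((fun tj => q.2 tj.1 tj.2) - (priorBelief S k).y) ⬝ᵥ
      ((priorBelief S k).cov.toBlocks₂₂⁻¹ *ᵥ
        ((fun tj => q.2 tj.1 tj.2) - (priorBelief S k).y)) := ⟨_, rfl⟩
  have hAm : Measurable A := by
    have h1 : Measurable fun q : (Fin (k + 1) → Obs nx) × (Fin (k + 1) → Fin ny → ℝ) =>
        (fun tj : Fin (k + 1) × Fin ny => q.2 tj.1 tj.2) - (S.filtBelief p k q.1).y :=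
      (hunc.comp measurable_snd).sub hbF.y
    have h2 : EntryMeasurable fun q : (Fin (k + 1) → Obs nx) × (Fin (k + 1) → Fin ny → ℝ) =>
        (S.filtBelief p k q.1).cov.toBlocks₂₂ := fun _ _ => hbF.cov _ _
    rw [hAq]
    exact measurable_dotProduct h1 (h2.inv.mulVec h1)
  have hBm : Measurable B := by
    have h1 : Measurable fun q : (Fin (k + 1) → Obs nx) × (Fin (k + 1) → Fin ny → ℝ) =>
        (fun tj : Fin (k + 1) × Fin ny => q.2 tj.1 tj.2) - (priorBelief S k).y :=
      (hunc.comp measurable_snd).sub measurable_const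
    rw [hBq]
    exact measurable_dotProduct h1 ((EntryMeasurable.const _).mulVec h1)
  have hA0 : ∀ q, 0 ≤ A q := fun q => by
    rw [hAq]; exact mahalanobis_nonneg (hposF q.1) _
  have hB0 : ∀ q, 0 ≤ B q := fun q => by
    rw [hBq]; exact mahalanobis_nonneg hposP _
  obtain ⟨J, hJ⟩ : ∃ J, J = μ.map fun ω =>
    (S.output S₀ W ε p (k + 1) ω, fun t : Fin (k + 1) => S.Y S₀ W t ω) := ⟨_, rfl⟩
  haveI : IsProbabilityMeasure J := hJ ▸ inferInstance
  have hcurP : Measurable fun q : (Fin (k + 1) → Obs nx) × (Fin (k + 1) × Fin ny → ℝ) =>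
      (q.1, fun (t : Fin (k + 1)) (j : Fin ny) => q.2 (t, j)) :=
    measurable_fst.prodMk (hcur.comp measurable_snd)
  have hJint : ∀ h : (Fin (k + 1) → Obs nx) × (Fin (k + 1) → Fin ny → ℝ) → ℝ≥0∞, Measurable h →
      ∫⁻ q, h q ∂J = ∫⁻ z, ∫⁻ y, h (z, fun t j => y (t, j)) ∂(gaussianVec (S.filtBelief p k z).y
        (S.filtBelief p k z).cov.toBlocks₂₂) ∂(μ.map (S.output S₀ W ε p (k + 1))) := by
    intro h hh
    rw [hJ, lintegral_map hh hpm]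
    exact hd.lintegral_output_Y p k (hh.comp hcurP)
  have hYint : ∀ h : (Fin (k + 1) → Fin ny → ℝ) → ℝ≥0∞, Measurable h →
      ∫⁻ y, h y ∂(μ.map fun ω => fun t : Fin (k + 1) => S.Y S₀ W t ω) =
        ∫⁻ y, h (fun t j => y (t, j))
          ∂(gaussianVec (priorBelief S k).y (priorBelief S k).cov.toBlocks₂₂) := by
    intro h hh
    rw [lintegral_map hh hYm]
    exact hd.lintegral_Y p k (hh.comp hcur)
  -- both distances have the mean `(k + 1) ny`, the number of coordinates, so their difference has
  -- mean zero
  have hAint : ∫⁻ q, ENNReal.ofReal (A q) ∂J = (Fintype.card (Fin (k + 1) × Fin ny) : ℕ) := by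
    rw [hJint _ hAm.ennreal_ofReal]
    have h1 : ∀ z, ∫⁻ y, ENNReal.ofReal (A (z, fun t j => y (t, j)))
        ∂(gaussianVec (S.filtBelief p k z).y (S.filtBelief p k z).cov.toBlocks₂₂) =
        (Fintype.card (Fin (k + 1) × Fin ny) : ℕ) := fun z => by
      rw [hAq]
      exact lintegral_mahalanobis _ (hposF z)
    rw [lintegral_congr h1, lintegral_const, measure_univ, mul_one]
  have hBint : ∫⁻ q, ENNReal.ofReal (B q) ∂J = (Fintype.card (Fin (k + 1) × Fin ny) : ℕ) := by
    rw [hJ, lintegral_map hBm.ennreal_ofReal hpm, ← lintegral_mahalanobis (priorBelief S k).y hposP]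
    rw [← hd.lintegral_Y p k, hBq]
    exact (measurable_dotProduct (measurable_id.sub measurable_const)
      ((EntryMeasurable.const _).mulVec (measurable_id.sub measurable_const))).ennreal_ofReal
  have hAI : Integrable A J := (lintegral_ofReal_ne_top_iff_integrable hAm.aestronglyMeasurable
    (.of_forall hA0)).mp (hAint ▸ ENNReal.natCast_ne_top _)
  have hBI : Integrable B J := (lintegral_ofReal_ne_top_iff_integrable hBm.aestronglyMeasurable
    (.of_forall hB0)).mp (hBint ▸ ENNReal.natCast_ne_top _)
  -- the density of the joint law with respect to the product of its marginals: posterior over prior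
  have hdens : J = ((μ.map (S.output S₀ W ε p (k + 1))).prod
      (μ.map fun ω => fun t : Fin (k + 1) => S.Y S₀ W t ω)).withDensity
      fun q => ENNReal.ofReal (F q / G q.2) := by
    refine Measure.ext_of_lintegral _ fun h hh => ?_
    have hr : Measurable fun q : (Fin (k + 1) → Obs nx) × (Fin (k + 1) → Fin ny → ℝ) =>
      ENNReal.ofReal (F q / G q.2) := (hFm.div (hGm.comp measurable_snd)).ennreal_ofReal
    rw [hJint h hh, lintegral_withDensity_eq_lintegral_mul _ hr hh,
      lintegral_prod _ (hr.mul hh).aemeasurable]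
    refine lintegral_congr fun z => ?_
    have hrz : Measurable fun y => ((fun q => ENNReal.ofReal (F q / G q.2)) * h) (z, y) :=
      (hr.mul hh).comp (measurable_const.prodMk measurable_id)
    rw [hYint _ hrz]
    have h1 := lintegral_gaussianVec_div (S.filtBelief p k z).y (priorBelief S k).y (hposF z) hposP
      (h := fun y => h (z, fun t j => y (t, j)))
      (hh.comp (measurable_const.prodMk hcur))
    rw [← h1, hF, hG]
    rfl
  rw [LinGaussSystem.leakage, ← hJ, klDiv_withDensity_eq_lintegral
    (ρ := fun q => F q / G q.2) (hFm.div (hGm.comp measurable_snd)) (fun q => div_pos (hF0 q) (hG0 q.2)) hdens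
    (i := fun q => totalInfoGain S p k q.1) (s := fun q => 1 / 2 * B q - 1 / 2 * A q)
    ((measurable_totalInfoGain S p k).comp measurable_fst)
    (fun q => totalInfoGain_nonneg S hA p k q.1)
    ((hBI.const_mul _).sub (hAI.const_mul _)), hJ, lintegral_map _ hpm]
  · exact ((measurable_totalInfoGain S p k).comp measurable_fst).ennreal_ofReal
  · rw [integral_sub (hBI.const_mul _) (hAI.const_mul _), integral_const_mul, integral_const_mul,
      integral_eq_lintegral_of_nonneg_ae (.of_forall hA0) hAm.aestronglyMeasurable,
      integral_eq_lintegral_of_nonneg_ae (.of_forall hB0) hBm.aestronglyMeasurable, hAint, hBint,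
      sub_self]
  · intro q
    rw [Real.log_div (hF0 q).ne' (hG0 q.2).ne', hF, hG, log_gaussianDensity _ (hposF q.1),
      log_gaussianDensity _ hposP, hAq, hBq, totalInfoGain, Belief.entropyY, Belief.entropyY]
    ring

section

variable {α : Type*} [MeasurableSpace α] {b : α → Belief nx ny k} {a : α → StageParam nx}

theorem measurable_silentProb_comp (hb : MeasurableBelief b)
    (hf : EntryMeasurable fun z => (a z).f) (hg : Measurable fun z => (a z).g) :
    Measurable fun z => silentProb (b z).x (b z).cov (a z) := by
  have h11 : EntryMeasurable fun z => (b z).cov.toBlocks₁₁ := fun _ _ => hb.cov _ _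
  have hd : Measurable fun z => (a z).g - (b z).x := hg.sub hb.x
  exact (hf.det.div (hf.add h11).det).sqrt.mul (measurable_const.mul
    (measurable_dotProduct hd ((hf.add h11).inv.mulVec hd))).exp

theorem measurable_silentError (hb : MeasurableBelief b)
    (hf : EntryMeasurable fun z => (a z).f) (hg : Measurable fun z => (a z).g) :
    Measurable fun z => silentError (b z) (a z) := by
  unfold silentError Matrix.trace
  exact Finset.measurable_sum _ fun _ _ => (hb.update_silent hf hg).cov _ _

theorem measurable_infoGain_silent (hb : MeasurableBelief b)
    (hf : EntryMeasurable fun z => (a z).f) (hg : Measurable fun z => (a z).g) :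
    Measurable fun z => infoGain (b z) (a z) (Sum.inr ()) :=
  (measurable_entropyY hb).sub (measurable_entropyY (hb.update_silent hf hg))

theorem measurable_infoGain_sent (hb : MeasurableBelief b) (x : Fin nx → ℝ) :
    Measurable fun z => infoGain (b z) (a z) (Sum.inl x) :=
  (measurable_entropyY hb).sub (measurable_entropyY (hb.update_sent a measurable_const))

theorem measurable_meanInfoGain (hb : MeasurableBelief b)
    (hf : EntryMeasurable fun z => (a z).f) (hg : Measurable fun z => (a z).g) :
    Measurable fun z => meanInfoGain (b z) (a z) := by
  have hq := measurable_silentProb_comp hb hf hg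
  exact (hq.ennreal_ofReal.mul (measurable_infoGain_silent hb hf hg).ennreal_ofReal).add
    ((measurable_const.sub hq).ennreal_ofReal.mul (measurable_infoGain_sent hb 0).ennreal_ofReal)

theorem measurable_oneStepLoss (lam : ℝ) (hb : MeasurableBelief b) (hb0 : ∀ z, (b z).cov.PosDef)
    (hf : EntryMeasurable fun z => (a z).f) (hg : Measurable fun z => (a z).g) :
    Measurable fun z => oneStepLoss lam (b z).x (b z).cov (a z) := by
  have hq := measurable_silentProb_comp hb hf hg
  simp_rw [fun z => oneStepLoss_eq lam (hb0 z) (a z) 0]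
  exact (hq.mul (measurable_silentError hb hf hg)).add (measurable_const.mul
    ((hq.mul (measurable_infoGain_silent hb hf hg)).add
      ((measurable_const.sub hq).mul (measurable_infoGain_sent hb 0))))

end

/-- If `Y` is autonomous, then the objective at the filtered mean is the total loss. -/
theorem IsDriving.objective_eq_totalLoss (hd : IsDriving S μ S₀ W ε) (hA : S.A.toBlocks₂₁ = 0)
    {lam : ℝ} (hlam : 0 ≤ lam) (K : ℕ) (p : Policy nx) {r : Recon nx}
    (hr : ∀ k z, r.est k z = (S.filtBelief p k z).x) :
    S.objective S₀ W ε μ lam K p r = S.totalLoss S₀ W ε μ lam K p := by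
  unfold LinGaussSystem.objective LinGaussSystem.totalLoss
  simp only [hr]
  rw [hd.leakage_eq hA, hd.lintegral_totalInfoGain hA, Finset.mul_sum, ← Finset.sum_add_distrib]
  refine Finset.sum_congr rfl fun k _ => ?_
  have hf : EntryMeasurable fun z => (p.act k z).f := fun i j => p.measurable_f k i j
  have hb := measurableBelief_predBelief S p k
  have hb0 := predBelief_posDef S p k
  rw [hd.lintegral_error_filtBelief p k, ← lintegral_map
    (f := fun z => ENNReal.ofReal (oneStepLoss lam (S.predBelief p k z).x (S.predBelief p k z).cov
      (p.act k z))) (measurable_oneStepLoss lam hb hb0 hf (p.measurable_g k)).ennreal_ofReal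
    (hd.measurable_output p k), ← lintegral_const_mul _
    (measurable_meanInfoGain hb hf (p.measurable_g k)), ← lintegral_add_left]
  · refine lintegral_congr fun z => ?_
    rw [ofReal_oneStepLoss hlam (hb0 z) _ 0, meanInfoGain]
  · exact (measurable_silentProb_comp hb hf (p.measurable_g k)).ennreal_ofReal.mul
      (measurable_silentError hb hf (p.measurable_g k)).ennreal_ofReal

theorem IsDriving.objective_filtBelief_le (hd : IsDriving S μ S₀ W ε) {lam : ℝ} (K : ℕ)
    (p : Policy nx) {r : Recon nx} (hr : ∀ k z, r.est k z = (S.filtBelief p k z).x)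
    (r' : Recon nx) : S.objective S₀ W ε μ lam K p r ≤ S.objective S₀ W ε μ lam K p r' := by
  unfold LinGaussSystem.objective
  gcongr ?_ + _
  refine Finset.sum_le_sum fun k _ => ?_
  simp only [hr]
  exact hd.lintegral_error_filtBelief_le p k (r'.measurable_est k)

end Leakage

/-! ### The value function of the predicted covariance -/

section Value

variable {nx ny k : ℕ}

/-- The predicted covariance after a silent stage with shape `f`. -/
noncomputable def silentNext (S : LinGaussSystem nx ny)
    (P : Matrix (HistIdx nx ny k) (HistIdx nx ny k) ℝ) (f : Matrix (Fin nx) (Fin nx) ℝ) :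
    Matrix (HistIdx nx ny (k + 1)) (HistIdx nx ny (k + 1)) ℝ :=
  stepMatrix S.A k * ((P * fromBlocks f⁻¹ 0 0 0 + 1)⁻¹ * P) * (stepMatrix S.A k)ᵀ +
    stepNoise S.Q k

/-- The predicted covariance after a transmission. -/
noncomputable def sentNext (S : LinGaussSystem nx ny)
    (P : Matrix (HistIdx nx ny k) (HistIdx nx ny k) ℝ) :
    Matrix (HistIdx nx ny (k + 1)) (HistIdx nx ny (k + 1)) ℝ :=
  stepMatrix S.A k * (fromBlocks 0 0 0
    (P.toBlocks₂₂ - P.toBlocks₂₁ * P.toBlocks₁₁⁻¹ * P.toBlocks₁₂) :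
      Matrix (HistIdx nx ny k) (HistIdx nx ny k) ℝ) * (stepMatrix S.A k)ᵀ + stepNoise S.Q k

theorem predict_update_silent_cov (S : LinGaussSystem nx ny) (b : Belief nx ny k)
    (a : StageParam nx) :
    (S.predict (b.update a (Sum.inr ()))).cov = silentNext S b.cov a.f := rfl

theorem predict_update_sent_cov (S : LinGaussSystem nx ny) (b : Belief nx ny k)
    (a : StageParam nx) (x : Fin nx → ℝ) :
    (S.predict (b.update a (Sum.inl x))).cov = sentNext S b.cov := rfl

theorem silentNext_posDef (S : LinGaussSystem nx ny)
    {P : Matrix (HistIdx nx ny k) (HistIdx nx ny k) ℝ} (hP : P.PosDef) (a : StageParam nx) :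
    (silentNext S P a.f).PosDef :=
  predict_update_posDef S (b := ⟨0, P⟩) hP a (Sum.inr ())

theorem sentNext_posDef (S : LinGaussSystem nx ny)
    {P : Matrix (HistIdx nx ny k) (HistIdx nx ny k) ℝ} (hP : P.PosDef) :
    (sentNext S P).PosDef :=
  predict_update_posDef S (b := ⟨0, P⟩) hP ⟨1, 0, PosDef.one⟩ (Sum.inl 0)

/-- The right-hand side of the optimality equation for a continuation value `v` that depends on the
predicted covariance only. -/
noncomputable def stageCost (S : LinGaussSystem nx ny) (lam : ℝ)
    (v : Matrix (HistIdx nx ny (k + 1)) (HistIdx nx ny (k + 1)) ℝ → ℝ≥0∞) (x : Fin nx → ℝ)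
    (P : Matrix (HistIdx nx ny k) (HistIdx nx ny k) ℝ) (a : StageParam nx) : ℝ≥0∞ :=
  ENNReal.ofReal (oneStepLoss lam x P a) +
    (ENNReal.ofReal (silentProb x P a) * v (silentNext S P a.f) +
      ENNReal.ofReal (1 - silentProb x P a) * v (sentNext S P))

/-- The covariance after a transmission does not depend on the transmitted state, so that the
expectation in the optimality equation reduces to the probabilities of the two outcomes. -/
theorem bellman_eq_stageCost (S : LinGaussSystem nx ny) (lam : ℝ)
    {V : (Fin nx → ℝ) → Matrix (HistIdx nx ny (k + 1)) (HistIdx nx ny (k + 1)) ℝ → ℝ≥0∞}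
    {v : Matrix (HistIdx nx ny (k + 1)) (HistIdx nx ny (k + 1)) ℝ → ℝ≥0∞}
    (hV : ∀ x P, P.PosDef → V x P = v P) {b : Belief nx ny k} (hb : b.cov.PosDef)
    (a : StageParam nx) : S.bellman lam V b a = stageCost S lam v b.x b.cov a := by
  have h := fun o => hV (S.predict (b.update a o)).x _ (predict_update_posDef S hb a o)
  unfold LinGaussSystem.bellman stageCost
  simp only [h]
  simp only [predict_update_silent_cov, predict_update_sent_cov]
  rw [lintegral_add_left (a.measurable_discardProb.ennreal_ofReal.mul_const _),
    lintegral_mul_const _ a.measurable_discardProb.ennreal_ofReal,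
    lintegral_mul_const _ a.measurable_one_sub_discardProb, lintegral_discardProb hb,
    lintegral_one_sub_discardProb hb]

/-- The parameters with the centre moved by `x`. -/
def StageParam.shift (a : StageParam nx) (x : Fin nx → ℝ) : StageParam nx :=
  ⟨a.f, a.g + x, a.f_posDef⟩

/-- The stage cost depends on the predicted mean and the centre through their difference only. -/
theorem stageCost_shift (S : LinGaussSystem nx ny) (lam : ℝ)
    (v : Matrix (HistIdx nx ny (k + 1)) (HistIdx nx ny (k + 1)) ℝ → ℝ≥0∞) (x : Fin nx → ℝ)
    (P : Matrix (HistIdx nx ny k) (HistIdx nx ny k) ℝ) (a : StageParam nx) :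
    stageCost S lam v x P (a.shift x) = stageCost S lam v 0 P a := by
  have h : silentProb x P (a.shift x) = silentProb 0 P a := by
    simp [silentProb, StageParam.shift]
  simp only [stageCost, oneStepLoss, h]
  rfl

theorem silentProb_shift (x : Fin nx → ℝ) (P : Matrix (HistIdx nx ny k) (HistIdx nx ny k) ℝ)
    (a : StageParam nx) : silentProb x P (a.shift x) = silentProb 0 P a := by
  simp [silentProb, StageParam.shift]

theorem StageParam.shift_neg_shift (a : StageParam nx) (x : Fin nx → ℝ) :
    (a.shift (-x)).shift x = a := by
  cases a; simp [StageParam.shift]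

theorem iInf_stageCost (S : LinGaussSystem nx ny) (lam : ℝ)
    (v : Matrix (HistIdx nx ny (k + 1)) (HistIdx nx ny (k + 1)) ℝ → ℝ≥0∞) (x : Fin nx → ℝ)
    (P : Matrix (HistIdx nx ny k) (HistIdx nx ny k) ℝ) :
    ⨅ a, stageCost S lam v x P a = ⨅ a, stageCost S lam v 0 P a := by
  refine le_antisymm (le_iInf fun a => ?_) (le_iInf fun a => ?_)
  · rw [← stageCost_shift S lam v x]; exact iInf_le _ _
  · rw [← a.shift_neg_shift x, stageCost_shift]; exact iInf_le _ _

/-- The optimal cost of the last `n` stages, from time `k` on, as a function of the predicted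
covariance. -/
noncomputable def costToGo (S : LinGaussSystem nx ny) (lam : ℝ) :
    ℕ → (k : ℕ) → Matrix (HistIdx nx ny k) (HistIdx nx ny k) ℝ → ℝ≥0∞
  | 0, _, _ => 0
  | n + 1, k, P => ⨅ a : StageParam nx, stageCost S lam (costToGo S lam n (k + 1)) 0 P a

theorem costToGo_le_stageCost (S : LinGaussSystem nx ny) (lam : ℝ) (n : ℕ) (x : Fin nx → ℝ)
    (P : Matrix (HistIdx nx ny k) (HistIdx nx ny k) ℝ) (a : StageParam nx) :
    costToGo S lam (n + 1) k P ≤ stageCost S lam (costToGo S lam n (k + 1)) x P a := by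
  rw [costToGo, ← iInf_stageCost S lam _ x]
  exact iInf_le _ _

theorem costToGo_ne_top (S : LinGaussSystem nx ny) (lam : ℝ) (n : ℕ) :
    ∀ {k : ℕ} {P : Matrix (HistIdx nx ny k) (HistIdx nx ny k) ℝ}, P.PosDef →
      costToGo S lam n k P ≠ ∞ := by
  induction n with
  | zero => intro k P _; simp [costToGo]
  | succ n ih =>
    intro k P hP
    refine ne_top_of_le_ne_top ?_ (costToGo_le_stageCost S lam n 0 P ⟨1, 0, PosDef.one⟩)
    exact ENNReal.add_ne_top.mpr ⟨ENNReal.ofReal_ne_top, ENNReal.add_ne_top.mpr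
      ⟨ENNReal.mul_ne_top ENNReal.ofReal_ne_top (ih (silentNext_posDef S hP _)),
        ENNReal.mul_ne_top ENNReal.ofReal_ne_top (ih (sentNext_posDef S hP))⟩⟩

theorem solvesBellman_costToGo (S : LinGaussSystem nx ny) (lam : ℝ) (K : ℕ) :
    S.SolvesBellman lam K fun k _ P => costToGo S lam (K + 1 - k) k P := by
  refine ⟨fun x P => by simp [costToGo], fun k hk b hb => ?_⟩
  obtain ⟨n, hn⟩ : ∃ n, K + 1 - k = n + 1 := ⟨K - k, by omega⟩
  have hn' : K + 1 - (k + 1) = n := by omega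
  simp only [hn, hn', costToGo]
  rw [← iInf_stageCost S lam _ b.x]
  exact iInf_congr fun a => (bellman_eq_stageCost S lam (v := costToGo S lam n (k + 1))
    (fun _ _ _ => rfl) hb a).symm

/-- At positive definite covariances the optimality equation has only one solution. -/
theorem LinGaussSystem.SolvesBellman.eq_costToGo {S : LinGaussSystem nx ny}
    {lam : ℝ} {K : ℕ}
    {V : (k : ℕ) → (Fin nx → ℝ) → Matrix (HistIdx nx ny k) (HistIdx nx ny k) ℝ → ℝ≥0∞}
    (hV : S.SolvesBellman lam K V) (n : ℕ) : ∀ {k : ℕ}, n + k = K + 1 → ∀ (x : Fin nx → ℝ)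
      (P : Matrix (HistIdx nx ny k) (HistIdx nx ny k) ℝ), P.PosDef →
      V k x P = costToGo S lam n k P := by
  induction n with
  | zero =>
    intro k hk x P _
    obtain rfl : k = K + 1 := by omega
    rw [hV.1, costToGo]
  | succ n ih =>
    intro k hk x P hP
    have h := hV.2 k (by omega) ⟨Sum.elim x 0, P⟩ hP
    have hx : (⟨Sum.elim x 0, P⟩ : Belief nx ny k).x = x := rfl
    rw [hx] at h
    rw [h, costToGo, ← iInf_stageCost S lam _ x]
    exact iInf_congr fun a => bellman_eq_stageCost S lam (ih (by omega)) (b := ⟨Sum.elim x 0, P⟩)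
      hP a

end Value

/-! ### Semicontinuity of the value function -/

section Semicontinuity

open Topology

/-- Positive definite matrices, as a subspace of the space of doubly indexed families. -/
abbrev PDMatrix (ι : Type*) := {P : ι → ι → ℝ // (Matrix.of P).PosDef}

/-- The matrix of an element of `PDMatrix`. -/
def PDMatrix.mat {ι : Type*} (P : PDMatrix ι) : Matrix ι ι ℝ := Matrix.of P.1

theorem PDMatrix.posDef {ι : Type*} (P : PDMatrix ι) : P.mat.PosDef := P.2

theorem PDMatrix.continuous_mat {ι : Type*} : Continuous (PDMatrix.mat (ι := ι)) :=
  continuous_subtype_val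

variable {X : Type*} [TopologicalSpace X] {ι : Type*} [Fintype ι] [DecidableEq ι]

theorem continuous_matrix_inv {M : X → Matrix ι ι ℝ} (hM : Continuous M)
    (h0 : ∀ z, (M z).det ≠ 0) : Continuous fun z => (M z)⁻¹ := by
  have h : (fun z => (M z)⁻¹) = fun z => (M z).det⁻¹ • (M z).adjugate := by
    ext z : 1
    rw [Matrix.inv_def, Ring.inverse_eq_inv']
  rw [h]
  exact (hM.matrix_det.inv₀ h0).smul hM.matrix_adjugate

theorem upperSemicontinuous_continuous_mul {c w : X → ℝ≥0∞} (hc : Continuous c)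
    (hw : UpperSemicontinuous w) (hc0 : ∀ x, c x ≠ ∞) (hw0 : ∀ x, w x ≠ ∞) :
    UpperSemicontinuous fun x => c x * w x := by
  intro x y hy
  have h1 : ∀ᶠ q in 𝓝 (c x) ×ˢ 𝓝 (w x), q.1 * q.2 < y := by
    exact (ENNReal.Tendsto.mul Filter.tendsto_fst (.inr (hw0 x)) Filter.tendsto_snd (.inr (hc0 x))).eventually
      (gt_mem_nhds hy)
  obtain ⟨pa, ha, pb, hb, hab⟩ := Filter.eventually_prod_iff.mp h1
  obtain ⟨u, hu, hub⟩ := exists_Ico_subset_of_mem_nhds hb ⟨∞, (hw0 x).lt_top⟩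
  obtain ⟨w1, hw1, hw1u⟩ := exists_between hu
  filter_upwards [hc.continuousAt.eventually ha, hw x w1 hw1] with x' h2 h3
  exact (mul_le_mul_right h3.le _).trans_lt (hab h2 (hub ⟨hw1.le, hw1u⟩))

variable {nx ny k : ℕ}

/-- The parameters of a stage as a topological space: pairs of a shape and a centre. -/
abbrev ActionSpace (nx : ℕ) := PDMatrix (Fin nx) × (Fin nx → ℝ)

/-- The parameters that correspond to a point of the action space. -/
def ActionSpace.param (a : ActionSpace nx) : StageParam nx := ⟨a.1.mat, a.2, a.1.posDef⟩

theorem ActionSpace.param_surjective : Function.Surjective (ActionSpace.param (nx := nx)) :=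
  fun a => ⟨(⟨a.f, a.f_posDef⟩, a.g), rfl⟩

instance : Nonempty (ActionSpace nx) := ⟨(⟨fun i j => (1 : Matrix _ _ ℝ) i j, PosDef.one⟩, 0)⟩

variable {P : X → Matrix (HistIdx nx ny k) (HistIdx nx ny k) ℝ} {a : X → ActionSpace nx}

theorem continuous_f (ha : Continuous a) : Continuous fun z => (a z).param.f :=
  PDMatrix.continuous_mat.comp ha.fst

theorem continuous_toBlocks₁₁ {m n : Type*} {P : X → Matrix (m ⊕ n) (m ⊕ n) ℝ}
    (hP : Continuous P) : Continuous fun z => (P z).toBlocks₁₁ :=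
  hP.matrix_submatrix Sum.inl Sum.inl

theorem continuous_toBlocks₂₂ {m n : Type*} {P : X → Matrix (m ⊕ n) (m ⊕ n) ℝ}
    (hP : Continuous P) : Continuous fun z => (P z).toBlocks₂₂ :=
  hP.matrix_submatrix Sum.inr Sum.inr

theorem continuous_silentCov (hP : Continuous P) (hP0 : ∀ z, (P z).PosDef) (ha : Continuous a) :
    Continuous fun z => (P z * fromBlocks (a z).param.f⁻¹ 0 0 0 + 1)⁻¹ * P z := by
  have hf := continuous_f ha
  have hi := continuous_matrix_inv hf fun z => (a z).param.f_posDef.det_pos.ne'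
  exact (continuous_matrix_inv ((hP.matrix_mul (hi.matrix_fromBlocks continuous_const
    continuous_const continuous_const)).add continuous_const)
    fun z => (silent_gain_isUnit (hP0 z) (a z).param.f_posDef).ne_zero).matrix_mul hP

theorem continuous_schur (hP : Continuous P) (hP0 : ∀ z, (P z).PosDef) :
    Continuous fun z => (P z).toBlocks₂₂ -
      (P z).toBlocks₂₁ * (P z).toBlocks₁₁⁻¹ * (P z).toBlocks₁₂ :=
  (continuous_toBlocks₂₂ hP).sub (((hP.matrix_submatrix Sum.inr Sum.inl).matrix_mul
    (continuous_matrix_inv (continuous_toBlocks₁₁ hP) fun z => (hP0 z).toBlocks₁₁.det_pos.ne')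
    ).matrix_mul (hP.matrix_submatrix Sum.inl Sum.inr))

theorem continuous_silentNext (S : LinGaussSystem nx ny) (hP : Continuous P)
    (hP0 : ∀ z, (P z).PosDef) (ha : Continuous a) :
    Continuous fun z => silentNext S (P z) (a z).param.f :=
  ((continuous_const.matrix_mul (continuous_silentCov hP hP0 ha)).matrix_mul
    continuous_const).add continuous_const

theorem continuous_sentNext (S : LinGaussSystem nx ny) (hP : Continuous P)
    (hP0 : ∀ z, (P z).PosDef) : Continuous fun z => sentNext S (P z) :=
  ((continuous_const.matrix_mul (continuous_const.matrix_fromBlocks continuous_const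
    continuous_const (continuous_schur hP hP0))).matrix_mul
    continuous_const).add continuous_const

theorem continuous_silentProb (hP : Continuous P) (hP0 : ∀ z, (P z).PosDef) (ha : Continuous a) :
    Continuous fun z => silentProb 0 (P z) (a z).param := by
  have hf := continuous_f ha
  have hs := hf.add (continuous_toBlocks₁₁ hP)
  have hs0 : ∀ z, ((a z).param.f + (P z).toBlocks₁₁).det ≠ 0 := fun z =>
    ((a z).param.f_posDef.add (hP0 z).toBlocks₁₁).det_pos.ne'
  have hg : Continuous fun z => (a z).param.g - 0 := ha.snd.sub continuous_const
  exact (hf.matrix_det.div hs.matrix_det hs0).sqrt.mul (Real.continuous_exp.comp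
    (continuous_const.mul (hg.dotProduct ((continuous_matrix_inv hs hs0).matrix_mulVec hg))))

theorem continuous_log_sqrt_det {M : X → Matrix ι ι ℝ} (hM : Continuous M)
    (h0 : ∀ z, (M z).PosDef) : Continuous fun z => Real.log (Real.sqrt (M z).det) :=
  hM.matrix_det.sqrt.log fun z => (Real.sqrt_pos.mpr (h0 z).det_pos).ne'

theorem continuous_oneStepLoss (lam : ℝ) (hP : Continuous P) (hP0 : ∀ z, (P z).PosDef)
    (ha : Continuous a) : Continuous fun z => oneStepLoss lam 0 (P z) (a z).param := by
  have hq := continuous_silentProb hP hP0 ha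
  have hc := continuous_silentCov hP hP0 ha
  have h := fun z => oneStepLoss_eq lam (b := ⟨0, P z⟩) (hP0 z) (a z).param 0
  change ∀ z, oneStepLoss lam 0 (P z) (a z).param = _ at h
  simp_rw [h]
  have h22 := continuous_log_sqrt_det (continuous_toBlocks₂₂ hP) fun z => (hP0 z).toBlocks₂₂
  have hs := continuous_log_sqrt_det (continuous_toBlocks₂₂ hc)
    fun z => (silent_cov_posDef (hP0 z) (a z).param.f_posDef).toBlocks₂₂
  have ht := continuous_log_sqrt_det (continuous_schur hP hP0) fun z => schur_posDef (hP0 z)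
  exact (hq.mul (continuous_toBlocks₁₁ hc).matrix_trace).add (continuous_const.mul
    ((hq.mul (h22.sub hs)).add ((continuous_const.sub hq).mul (h22.sub ht))))

theorem upperSemicontinuous_stageCost (S : LinGaussSystem nx ny) (lam : ℝ)
    {v : Matrix (HistIdx nx ny (k + 1)) (HistIdx nx ny (k + 1)) ℝ → ℝ≥0∞}
    (hv : UpperSemicontinuous fun P : PDMatrix (HistIdx nx ny (k + 1)) => v P.mat)
    (hv0 : ∀ P, P.PosDef → v P ≠ ∞) (hP : Continuous P) (hP0 : ∀ z, (P z).PosDef)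
    (ha : Continuous a) :
    UpperSemicontinuous fun z => stageCost S lam v 0 (P z) (a z).param := by
  have hq := continuous_silentProb hP hP0 ha
  have h1 : Continuous fun z => (⟨fun i j => silentNext S (P z) (a z).param.f i j,
      silentNext_posDef S (hP0 z) (a z).param⟩ : PDMatrix (HistIdx nx ny (k + 1))) :=
    Continuous.subtype_mk (continuous_silentNext S hP hP0 ha) _
  have h2 : Continuous fun z => (⟨fun i j => sentNext S (P z) i j,
      sentNext_posDef S (hP0 z)⟩ : PDMatrix (HistIdx nx ny (k + 1))) :=
    Continuous.subtype_mk (continuous_sentNext S hP hP0) _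
  refine (ENNReal.continuous_ofReal.comp
    (continuous_oneStepLoss lam hP hP0 ha)).upperSemicontinuous.add
    (UpperSemicontinuous.add ?_ ?_)
  · exact upperSemicontinuous_continuous_mul (ENNReal.continuous_ofReal.comp hq)
      (hv.comp h1) (fun _ => ENNReal.ofReal_ne_top)
      fun z => hv0 _ (silentNext_posDef S (hP0 z) (a z).param)
  · exact upperSemicontinuous_continuous_mul (ENNReal.continuous_ofReal.comp
      (continuous_const.sub hq)) (hv.comp h2) (fun _ => ENNReal.ofReal_ne_top)
      fun z => hv0 _ (sentNext_posDef S (hP0 z))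

/-- The value function is an infimum of upper semicontinuous functions, one for each choice of the
parameters. -/
theorem upperSemicontinuous_costToGo (S : LinGaussSystem nx ny) (lam : ℝ) (n : ℕ) : ∀ k,
    UpperSemicontinuous fun P : PDMatrix (HistIdx nx ny k) => costToGo S lam n k P.mat := by
  induction n with
  | zero => intro k; exact upperSemicontinuous_const
  | succ n ih =>
    intro k
    refine upperSemicontinuous_iInf fun a => ?_
    obtain ⟨a, rfl⟩ := ActionSpace.param_surjective a
    exact upperSemicontinuous_stageCost S lam (ih (k + 1)) (fun P => costToGo_ne_top S lam n)
      PDMatrix.continuous_mat PDMatrix.posDef (a := fun _ => a) continuous_const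

/-- Measurability of the value function needs no attainment of the infima, only semicontinuity. -/
theorem measurable_costToGo (S : LinGaussSystem nx ny) (lam : ℝ) (n : ℕ) {α : Type*}
    [MeasurableSpace α] {P : α → Matrix (HistIdx nx ny k) (HistIdx nx ny k) ℝ}
    (hP : EntryMeasurable P) (hP0 : ∀ z, (P z).PosDef) :
    Measurable fun z => costToGo S lam n k (P z) := by
  have h : Measurable fun z => (⟨fun i j => P z i j, hP0 z⟩ : PDMatrix (HistIdx nx ny k)) :=
    Measurable.subtype_mk (measurable_pi_lambda _ fun i => measurable_pi_lambda _ fun j => hP i j)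
  exact (upperSemicontinuous_costToGo S lam n k).measurable.comp h

end Semicontinuity

/-! ### Measurable nearly optimal feedback laws -/

section Selector

variable {nx ny k : ℕ}

/-- A positive definite matrix is a positive semidefinite one with nonzero determinant. -/
theorem measurableSet_posDef (ι : Type*) [Fintype ι] [DecidableEq ι] :
    MeasurableSet {P : ι → ι → ℝ | (Matrix.of P).PosDef} := by
  have hof : Continuous fun P : ι → ι → ℝ => Matrix.of P := continuous_id
  have h : {P : ι → ι → ℝ | (Matrix.of P).PosDef} =
      ({P | (Matrix.of P)ᴴ = Matrix.of P} ∩ ⋂ x : ι → ℝ, {P | 0 ≤ star x ⬝ᵥ (Matrix.of P *ᵥ x)}) ∩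
        {P | (Matrix.of P).det = 0}ᶜ := by
    ext P
    simp only [Set.mem_inter_iff, Set.mem_iInter, Set.mem_ofPred_eq, Set.mem_compl_iff]
    refine ⟨fun h => ⟨⟨h.1, h.posSemidef.dotProduct_mulVec_nonneg⟩, h.det_pos.ne'⟩, fun h => ?_⟩
    exact (PosSemidef.of_dotProduct_mulVec_nonneg h.1.1 h.1.2).posDef_iff_det_ne_zero.mpr h.2
  rw [h]
  refine MeasurableSet.inter (IsClosed.measurableSet ?_) (IsClosed.measurableSet ?_).compl
  · refine (isClosed_eq hof.matrix_conjTranspose hof).inter (isClosed_iInter fun x => ?_)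
    exact isClosed_le continuous_const
      (continuous_const.dotProduct (hof.matrix_mulVec continuous_const))
  · exact isClosed_eq hof.matrix_det continuous_const

/-- Nearly optimal parameters can be chosen as a measurable function of the covariance: the stage
cost is upper semicontinuous, so that it is enough to search a countable dense set. -/
theorem exists_measurable_stageCost_le (S : LinGaussSystem nx ny) (lam : ℝ) (n k : ℕ)
    {δ : ℝ≥0∞} (hδ : δ ≠ 0) :
    ∃ s : (HistIdx nx ny k → HistIdx nx ny k → ℝ) → ActionSpace nx, Measurable s ∧
      ∀ P : PDMatrix (HistIdx nx ny k),
        stageCost S lam (costToGo S lam n (k + 1)) 0 P.mat (s P.1).param ≤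
          costToGo S lam (n + 1) k P.mat + δ := by
  classical
  set d := TopologicalSpace.denseSeq (ActionSpace nx) with hd
  have husc : UpperSemicontinuous fun q : PDMatrix (HistIdx nx ny k) × ActionSpace nx =>
      stageCost S lam (costToGo S lam n (k + 1)) 0 q.1.mat q.2.param :=
    upperSemicontinuous_stageCost S lam (upperSemicontinuous_costToGo S lam n (k + 1))
      (fun P => costToGo_ne_top S lam n) (PDMatrix.continuous_mat.comp continuous_fst)
      (fun q => q.1.posDef) continuous_snd
  have hex : ∀ P : PDMatrix (HistIdx nx ny k), ∃ i,
      stageCost S lam (costToGo S lam n (k + 1)) 0 P.mat (d i).param <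
        costToGo S lam (n + 1) k P.mat + δ := by
    intro P
    have hlt : costToGo S lam (n + 1) k P.mat < costToGo S lam (n + 1) k P.mat + δ :=
      ENNReal.lt_add_right (costToGo_ne_top S lam (n + 1) P.posDef) hδ
    have hlt' : (⨅ a, stageCost S lam (costToGo S lam n (k + 1)) 0 P.mat a) <
        costToGo S lam (n + 1) k P.mat + δ := hlt
    obtain ⟨a, ha⟩ := iInf_lt_iff.mp hlt'
    obtain ⟨a, rfl⟩ := ActionSpace.param_surjective a
    have hopen := (husc.comp (Continuous.prodMk_right P)).isOpen_preimage
      (costToGo S lam (n + 1) k P.mat + δ)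
    obtain ⟨i, hb⟩ := (TopologicalSpace.denseRange_denseSeq (ActionSpace nx)).exists_mem_open
      hopen ⟨a, ha⟩
    exact ⟨i, hb⟩
  have hsel : Measurable fun P : PDMatrix (HistIdx nx ny k) => d (Nat.find (hex P)) := by
    refine Measurable.find (f := fun i _ => d i) (fun i => measurable_const) (fun i => ?_) hex
    refine measurableSet_lt ?_ ?_
    · exact (husc.comp (Continuous.prodMk_left (d i))).measurable
    · exact (upperSemicontinuous_costToGo S lam (n + 1) k).measurable.add measurable_const
  obtain ⟨s, hs, hsP⟩ := (MeasurableEmbedding.subtype_coe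
    (measurableSet_posDef (HistIdx nx ny k))).exists_measurable_extend hsel fun _ => inferInstance
  refine ⟨s, hs, fun P => ?_⟩
  have h := congrFun hsP P
  simp only [Function.comp_apply] at h
  rw [h]
  exact (Nat.find_spec (hex P)).le

theorem exists_feedback_stageCost_le (S : LinGaussSystem nx ny) (lam : ℝ) (K : ℕ)
    {δ : ℝ≥0∞} (hδ : δ ≠ 0) : ∃ φ : Feedback nx ny, ∀ (k : ℕ) (b : Belief nx ny k),
      b.cov.PosDef → stageCost S lam (costToGo S lam (K - k) (k + 1)) b.x b.cov
        (φ.act k b.x b.cov) ≤ costToGo S lam (K - k + 1) k b.cov + δ := by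
  choose s hs hsP using fun k => exists_measurable_stageCost_le S lam (K - k) k hδ
  refine ⟨⟨fun k x P => (s k fun i j => P i j).param.shift x, fun k i j => ?_, fun k => ?_⟩,
    fun k b hb => ?_⟩
  · have h1 : Measurable fun P => (s k P).1.1 i j :=
      (measurable_pi_apply j).comp ((measurable_pi_apply i).comp
        (measurable_subtype_coe.comp (measurable_fst.comp (hs k))))
    exact h1.comp measurable_snd
  · exact (measurable_snd.comp ((hs k).comp measurable_snd)).add measurable_fst
  · rw [stageCost_shift]
    exact hsP k ⟨fun i j => b.cov i j, hb⟩

end Selector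

/-! ### Verification -/

section Verification

variable {nx ny : ℕ} {S : LinGaussSystem nx ny} {Ω : Type*}
  {S₀ : Ω → StateIdx nx ny → ℝ} {W : ℕ → Ω → StateIdx nx ny → ℝ} {ε : ℕ → Ω → ℝ}
  [MeasurableSpace Ω] {μ : Measure Ω} [IsProbabilityMeasure μ] {k : ℕ}

/-- The amount by which the parameters `a` miss the infimum in the optimality equation when `n`
further stages follow. -/
noncomputable def excess (S : LinGaussSystem nx ny) (lam : ℝ) (n : ℕ) (b : Belief nx ny k)
    (a : StageParam nx) : ℝ≥0∞ :=
  stageCost S lam (costToGo S lam n (k + 1)) b.x b.cov a - costToGo S lam (n + 1) k b.cov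

theorem costToGo_add_excess (S : LinGaussSystem nx ny) (lam : ℝ) (n : ℕ) (b : Belief nx ny k)
    (a : StageParam nx) : costToGo S lam (n + 1) k b.cov + excess S lam n b a =
      stageCost S lam (costToGo S lam n (k + 1)) b.x b.cov a :=
  add_tsub_cancel_of_le (costToGo_le_stageCost S lam n b.x b.cov a)

theorem measurable_stageCost (lam : ℝ) (n : ℕ) {α : Type*} [MeasurableSpace α]
    {b : α → Belief nx ny k} {a : α → StageParam nx} (hb : MeasurableBelief b)
    (hb0 : ∀ z, (b z).cov.PosDef) (hf : EntryMeasurable fun z => (a z).f)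
    (hg : Measurable fun z => (a z).g) :
    Measurable fun z => stageCost S lam (costToGo S lam n (k + 1)) (b z).x (b z).cov (a z) := by
  have hq := measurable_silentProb_comp hb hf hg
  exact (measurable_oneStepLoss lam hb hb0 hf hg).ennreal_ofReal.add
    ((hq.ennreal_ofReal.mul (measurable_costToGo S lam n
      ((hb.update_silent hf hg).predict S).cov fun z => silentNext_posDef S (hb0 z) (a z))).add
    ((measurable_const.sub hq).ennreal_ofReal.mul (measurable_costToGo S lam n
      ((hb.update_sent a measurable_const (x := fun _ => 0)).predict S).cov
        fun z => sentNext_posDef S (hb0 z))))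

theorem measurable_excess (S : LinGaussSystem nx ny) (lam : ℝ) (n : ℕ) (p : Policy nx) (k : ℕ) :
    Measurable fun z => excess S lam n (S.predBelief p k z) (p.act k z) := by
  have hb := measurableBelief_predBelief S p k
  have hb0 := predBelief_posDef S p k
  exact (measurable_stageCost lam n hb hb0 (fun i j => p.measurable_f k i j)
    (p.measurable_g k)).sub (measurable_costToGo S lam (n + 1) hb.cov hb0)

/-- One step of the verification argument: averaging `costToGo_add_excess` over the output replaces
the continuation value by the value of the next predicted covariance. -/
theorem IsDriving.lintegral_loss_add_costToGo (hd : IsDriving S μ S₀ W ε) (lam : ℝ) (p : Policy nx)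
    (n k : ℕ) :
    ∫⁻ ω, ENNReal.ofReal (oneStepLoss lam (S.predBelief p k (S.output S₀ W ε p k ω)).x
        (S.predBelief p k (S.output S₀ W ε p k ω)).cov (p.act k (S.output S₀ W ε p k ω))) ∂μ +
      ∫⁻ z, costToGo S lam n (k + 1) (S.predBelief p (k + 1) z).cov
        ∂(μ.map (S.output S₀ W ε p (k + 1))) =
    ∫⁻ z, costToGo S lam (n + 1) k (S.predBelief p k z).cov ∂(μ.map (S.output S₀ W ε p k)) +
      ∫⁻ z, excess S lam n (S.predBelief p k z) (p.act k z) ∂(μ.map (S.output S₀ W ε p k)) := by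
  have hb := measurableBelief_predBelief S p k
  have hb0 := predBelief_posDef S p k
  have hl := (measurable_oneStepLoss lam hb hb0 (fun i j => p.measurable_f k i j)
    (p.measurable_g k)).ennreal_ofReal
  have hc := measurable_costToGo S lam n (measurableBelief_predBelief S p (k + 1)).cov
    (predBelief_posDef S p (k + 1))
  rw [← lintegral_add_left (measurable_costToGo S lam (n + 1) hb.cov hb0),
    lintegral_map hc (hd.measurable_output p (k + 1)), hd.lintegral_output_succ p k hc,
    ← lintegral_map (f := fun z => ENNReal.ofReal (oneStepLoss lam (S.predBelief p k z).x
      (S.predBelief p k z).cov (p.act k z))) hl (hd.measurable_output p k),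
    ← lintegral_add_left hl]
  refine lintegral_congr fun z => ?_
  rw [costToGo_add_excess]
  simp only [predBelief_snoc]
  simp only [predict_update_silent_cov, predict_update_sent_cov]
  rw [lintegral_mul_const _ (p.act k z).measurable_one_sub_discardProb,
    lintegral_one_sub_discardProb (hb0 z)]
  rfl

/-- The total loss is the optimal value plus the expected excesses of all stages. -/
theorem IsDriving.totalLoss_eq (hd : IsDriving S μ S₀ W ε) (lam : ℝ) (K : ℕ) (p : Policy nx) :
    S.totalLoss S₀ W ε μ lam K p = costToGo S lam (K + 1) 0 S.initBelief.cov +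
      ∑ k ∈ Finset.range (K + 1), ∫⁻ z, excess S lam (K - k) (S.predBelief p k z) (p.act k z)
        ∂(μ.map (S.output S₀ W ε p k)) := by
  have key : ∀ j ≤ K + 1, ∑ k ∈ Finset.range j, ∫⁻ ω, ENNReal.ofReal (oneStepLoss lam
      (S.predBelief p k (S.output S₀ W ε p k ω)).x (S.predBelief p k (S.output S₀ W ε p k ω)).cov
      (p.act k (S.output S₀ W ε p k ω))) ∂μ +
      ∫⁻ z, costToGo S lam (K + 1 - j) j (S.predBelief p j z).cov ∂(μ.map (S.output S₀ W ε p j)) =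
      costToGo S lam (K + 1) 0 S.initBelief.cov +
        ∑ k ∈ Finset.range j, ∫⁻ z, excess S lam (K - k) (S.predBelief p k z) (p.act k z)
        ∂(μ.map (S.output S₀ W ε p k)) := by
    intro j hj
    induction j with
    | zero =>
      haveI := Measure.isProbabilityMeasure_map (μ := μ) (hd.measurable_output p 0).aemeasurable
      simp [LinGaussSystem.predBelief]
    | succ j ih =>
      have h1 : K + 1 - (j + 1) = K - j := by omega
      have h2 : K + 1 - j = K - j + 1 := by omega
      rw [Finset.sum_range_succ, Finset.sum_range_succ, add_assoc, h1,
        hd.lintegral_loss_add_costToGo lam p (K - j) j, ← add_assoc, ← h2, ih (by omega), add_assoc]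
  have h := key (K + 1) le_rfl
  rw [← h]
  simp [LinGaussSystem.totalLoss, costToGo]

theorem IsDriving.costToGo_le_totalLoss (hd : IsDriving S μ S₀ W ε) (lam : ℝ) (K : ℕ)
    (p : Policy nx) :
    costToGo S lam (K + 1) 0 S.initBelief.cov ≤ S.totalLoss S₀ W ε μ lam K p := by
  rw [hd.totalLoss_eq]
  exact le_self_add

/-- Feedback laws come arbitrarily close to the optimal value. -/
theorem IsDriving.exists_feedback_totalLoss_le (hd : IsDriving S μ S₀ W ε) (lam : ℝ) (K : ℕ)
    {δ : ℝ≥0∞} (hδ : δ ≠ 0) : ∃ (φ : Feedback nx ny) (p : Policy nx), S.IsGeneratedBy p φ ∧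
      S.totalLoss S₀ W ε μ lam K p ≤
        costToGo S lam (K + 1) 0 S.initBelief.cov + (K + 1 : ℕ) * δ := by
  obtain ⟨φ, hφ⟩ := exists_feedback_stageCost_le S lam K hδ
  obtain ⟨p, hp⟩ := exists_isGeneratedBy S φ
  refine ⟨φ, p, hp, ?_⟩
  rw [hd.totalLoss_eq]
  gcongr
  calc _ ≤ ∑ k ∈ Finset.range (K + 1), δ := by
        refine Finset.sum_le_sum fun k _ => ?_
        haveI := Measure.isProbabilityMeasure_map (μ := μ) (hd.measurable_output p k).aemeasurable
        calc _ ≤ ∫⁻ _, δ ∂(μ.map (S.output S₀ W ε p k)) := by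
              refine lintegral_mono fun z => ?_
              rw [hp k z]
              exact tsub_le_iff_left.mpr (hφ k _ (predBelief_posDef S p k z))
          _ = δ := by simp
    _ = _ := by simp

theorem IsDriving.iInf_feedback_totalLoss (hd : IsDriving S μ S₀ W ε) (lam : ℝ) (K : ℕ) :
    ⨅ p : {p : Policy nx // ∃ φ : Feedback nx ny, S.IsGeneratedBy p φ},
      S.totalLoss S₀ W ε μ lam K p.1 = costToGo S lam (K + 1) 0 S.initBelief.cov := by
  refine le_antisymm ?_ (le_iInf fun p => hd.costToGo_le_totalLoss lam K p.1)
  refine ENNReal.le_of_forall_pos_le_add fun η hη _ => ?_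
  have hK : ((K + 1 : ℕ) : ℝ≥0∞) ≠ 0 := by simp
  obtain ⟨φ, p, hp, hle⟩ := hd.exists_feedback_totalLoss_le lam K
    (δ := (η : ℝ≥0∞) / ((K + 1 : ℕ) : ℝ≥0∞)) (ENNReal.div_ne_zero.mpr
      ⟨by simpa using hη.ne', ENNReal.natCast_ne_top _⟩)
  rw [ENNReal.mul_div_cancel hK (ENNReal.natCast_ne_top _)] at hle
  exact iInf_le_of_le ⟨p, φ, hp⟩ hle

theorem IsDriving.iInf_totalLoss (hd : IsDriving S μ S₀ W ε) (lam : ℝ) (K : ℕ) :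
    ⨅ p : Policy nx, S.totalLoss S₀ W ε μ lam K p =
      costToGo S lam (K + 1) 0 S.initBelief.cov := by
  refine le_antisymm ?_ (le_iInf fun p => hd.costToGo_le_totalLoss lam K p)
  rw [← hd.iInf_feedback_totalLoss]
  exact le_iInf fun p => iInf_le _ p.1

/-- A policy is optimal if and only if almost surely no stage has an excess. -/
theorem IsDriving.forall_totalLoss_le_iff (hd : IsDriving S μ S₀ W ε) (lam : ℝ) (K : ℕ)
    (p : Policy nx) :
    (∀ q : Policy nx, S.totalLoss S₀ W ε μ lam K p ≤ S.totalLoss S₀ W ε μ lam K q) ↔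
      ∀ k ≤ K, ∀ᵐ z ∂(μ.map (S.output S₀ W ε p k)),
        excess S lam (K - k) (S.predBelief p k z) (p.act k z) = 0 := by
  have h0 := costToGo_ne_top S lam (K + 1) (initBelief_posDef S)
  rw [← le_iInf_iff, hd.iInf_totalLoss, hd.totalLoss_eq]
  have h1 : ∀ s : ℝ≥0∞, costToGo S lam (K + 1) 0 S.initBelief.cov + s ≤
      costToGo S lam (K + 1) 0 S.initBelief.cov ↔ s = 0 := fun s => by
    conv_lhs => rw [← add_zero (costToGo S lam (K + 1) 0 S.initBelief.cov), add_assoc, zero_add]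
    rw [ENNReal.add_le_add_iff_left h0, nonpos_iff_eq_zero]
  rw [h1, Finset.sum_eq_zero_iff]
  refine forall_congr' fun k => ?_
  rw [Finset.mem_range, Nat.lt_succ_iff, lintegral_eq_zero_iff (measurable_excess S lam _ p k)]
  rfl

/-- Attaining the infimum in the optimality equation means having no excess, whichever solution of the
equation is taken. -/
theorem isMinOn_bellman_iff {lam : ℝ} {K : ℕ}
    {V : (k : ℕ) → (Fin nx → ℝ) → Matrix (HistIdx nx ny k) (HistIdx nx ny k) ℝ → ℝ≥0∞}
    (hV : S.SolvesBellman lam K V) {k : ℕ} (hk : k ≤ K) {b : Belief nx ny k} (hb : b.cov.PosDef)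
    (a : StageParam nx) :
    IsMinOn (S.bellman lam (V (k + 1)) b) Set.univ a ↔ excess S lam (K - k) b a = 0 := by
  have h : ∀ a', S.bellman lam (V (k + 1)) b a' =
      stageCost S lam (costToGo S lam (K - k) (k + 1)) b.x b.cov a' := fun a' =>
    bellman_eq_stageCost S lam (hV.eq_costToGo (K - k) (by omega)) hb a'
  rw [isMinOn_univ_iff, excess, tsub_eq_zero_iff_le, costToGo, ← iInf_stageCost S lam _ b.x,
    le_iInf_iff]
  simp only [h]

end Verification

/-! ### Optimal feedback laws -/

section OptimalFeedback

variable {nx ny : ℕ} {S : LinGaussSystem nx ny} {Ω : Type*}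
  {S₀ : Ω → StateIdx nx ny → ℝ} {W : ℕ → Ω → StateIdx nx ny → ℝ} {ε : ℕ → Ω → ℝ}
  [MeasurableSpace Ω] {μ : Measure Ω} [IsProbabilityMeasure μ] {k : ℕ}

theorem silentProb_pos (x : Fin nx → ℝ) {P : Matrix (HistIdx nx ny k) (HistIdx nx ny k) ℝ}
    (hP : P.PosDef) (a : StageParam nx) : 0 < silentProb x P a :=
  mul_pos (Real.sqrt_pos.mpr (div_pos a.f_posDef.det_pos
    (a.f_posDef.add hP.toBlocks₁₁).det_pos)) (Real.exp_pos _)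

/-- A property that holds almost surely at time `k + 1` holds, for almost every past, after a silent
stage and, unless silence is certain, after the transmission of some state. -/
theorem IsDriving.ae_output_of_succ (hd : IsDriving S μ S₀ W ε) (p : Policy nx) (k : ℕ)
    {R : (Fin (k + 1) → Obs nx) → Prop} (hR : ∀ᵐ z ∂(μ.map (S.output S₀ W ε p (k + 1))), R z) :
    ∀ᵐ z ∂(μ.map (S.output S₀ W ε p k)), R (Fin.snoc (α := fun _ => Obs nx) z (Sum.inr ())) ∧
      (silentProb (S.predBelief p k z).x (S.predBelief p k z).cov (p.act k z) ≠ 1 →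
        ∃ x, R (Fin.snoc (α := fun _ => Obs nx) z (Sum.inl x))) := by
  -- the exceptional set need not be measurable; a measurable null set covers it
  set N := toMeasurable (μ.map (S.output S₀ W ε p (k + 1))) {z | ¬ R z} with hN
  have hNm : MeasurableSet N := measurableSet_toMeasurable _ _
  have hN0 : μ.map (S.output S₀ W ε p (k + 1)) N = 0 := by
    rw [hN, measure_toMeasurable]; exact hR
  have hNR : ∀ z, z ∉ N → R z := fun z hz => by
    by_contra h
    exact hz (subset_toMeasurable _ _ h)
  have hh : Measurable (N.indicator (1 : (Fin (k + 1) → Obs nx) → ℝ≥0∞)) :=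
    measurable_one.indicator hNm
  have hb := measurableBelief_predBelief S p k
  have hb0 := predBelief_posDef S p k
  have hf : EntryMeasurable fun z => (p.act k z).f := fun i j => p.measurable_f k i j
  have h1 := hd.lintegral_output_succ p k hh
  rw [← lintegral_map hh (hd.measurable_output p (k + 1)), lintegral_indicator_one hNm, hN0] at h1
  have hm1 : Measurable fun z => ENNReal.ofReal (silentProb (S.predBelief p k z).x
      (S.predBelief p k z).cov (p.act k z)) *
      N.indicator (1 : (Fin (k + 1) → Obs nx) → ℝ≥0∞)
        (Fin.snoc (α := fun _ => Obs nx) z (Sum.inr ())) :=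
    (measurable_silentProb_comp hb hf (p.measurable_g k)).ennreal_ofReal.mul
      (hh.comp (measurable_snoc_comp measurable_id measurable_const))
  have hm2 : Measurable fun z => ∫⁻ x, ENNReal.ofReal (1 - (p.act k z).discardProb x) *
      N.indicator (1 : (Fin (k + 1) → Obs nx) → ℝ≥0∞)
        (Fin.snoc (α := fun _ => Obs nx) z (Sum.inl x))
      ∂(gaussianVec (S.predBelief p k z).x (S.predBelief p k z).cov.toBlocks₁₁) := by
    have hg : Measurable fun q : (Fin k → Obs nx) × (Fin nx → ℝ) =>
        ENNReal.ofReal (1 - (p.act k q.1).discardProb q.2) *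
          N.indicator (1 : (Fin (k + 1) → Obs nx) → ℝ≥0∞)
            (Fin.snoc (α := fun _ => Obs nx) q.1 (Sum.inl q.2)) :=
      (measurable_const.sub (measurable_discardProb_comp
        (fun i j => (p.measurable_f k i j).comp measurable_fst)
        ((p.measurable_g k).comp measurable_fst) measurable_snd)).ennreal_ofReal.mul
        (hh.comp (measurable_snoc_comp measurable_fst (measurable_inl.comp measurable_snd)))
    let κ : Kernel (Fin k → Obs nx) (Fin nx → ℝ) := gaussianKernel
      (fun z => (S.predBelief p k z).x) (fun z => (S.predBelief p k z).cov.toBlocks₁₁) hb.x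
      (fun _ _ => hb.cov _ _) fun z => (hb0 z).toBlocks₁₁
    haveI : IsMarkovKernel κ :=
      ⟨fun z => inferInstanceAs (IsProbabilityMeasure (gaussianVec _ _))⟩
    exact hg.lintegral_kernel_prod_right' (κ := κ)
  filter_upwards [(lintegral_eq_zero_iff (hm1.add hm2)).mp h1.symm] with z hz
  obtain ⟨hz1, hz2⟩ := add_eq_zero.mp hz
  refine ⟨hNR _ fun hmem => ?_, fun hq => ?_⟩
  · have := silentProb_pos (S.predBelief p k z).x (hb0 z) (p.act k z)
    simp only [Set.indicator_of_mem hmem, Pi.one_apply, mul_one, ENNReal.ofReal_eq_zero] at hz1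
    exact this.not_ge hz1
  · by_contra! hno
    have hmem : ∀ x, Fin.snoc (α := fun _ => Obs nx) z (Sum.inl x) ∈ N := fun x => by
      by_contra h
      exact hno x (hNR _ h)
    have hz2' : ∫⁻ x, ENNReal.ofReal (1 - (p.act k z).discardProb x) ∂(gaussianVec
        (S.predBelief p k z).x (S.predBelief p k z).cov.toBlocks₁₁) = 0 := by
      rw [← hz2]
      exact lintegral_congr fun x => by rw [Set.indicator_of_mem (hmem x)]; simp
    rw [lintegral_one_sub_discardProb (hb0 z), ENNReal.ofReal_eq_zero, sub_nonpos] at hz2'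
    exact hq (le_antisymm (silentProb_le_one _ (hb0 z) _) hz2')

/-- A measurable property that holds, for almost every past, after a silent stage and, unless
silence is certain, after every transmission holds almost surely. -/
theorem IsDriving.ae_output_succ (hd : IsDriving S μ S₀ W ε) (p : Policy nx) (k : ℕ)
    {R : (Fin (k + 1) → Obs nx) → Prop} (hRm : MeasurableSet {z | R z})
    (hR : ∀ᵐ z ∂(μ.map (S.output S₀ W ε p k)),
      R (Fin.snoc (α := fun _ => Obs nx) z (Sum.inr ())) ∧
      (silentProb (S.predBelief p k z).x (S.predBelief p k z).cov (p.act k z) ≠ 1 →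
        ∀ x, R (Fin.snoc (α := fun _ => Obs nx) z (Sum.inl x)))) :
    ∀ᵐ z ∂(μ.map (S.output S₀ W ε p (k + 1))), R z := by
  have hNm := hRm.compl
  have hh : Measurable ({z | R z}ᶜ.indicator (1 : (Fin (k + 1) → Obs nx) → ℝ≥0∞)) :=
    measurable_one.indicator hNm
  have hb0 := predBelief_posDef S p k
  rw [ae_iff]
  change μ.map _ {z | R z}ᶜ = 0
  rw [← lintegral_indicator_one hNm, lintegral_map hh (hd.measurable_output p (k + 1)),
    hd.lintegral_output_succ p k hh]
  refine lintegral_eq_zero_of_ae_eq_zero ?_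
  filter_upwards [hR] with z hz
  have h1 : Fin.snoc (α := fun _ => Obs nx) z (Sum.inr ()) ∉ {z | R z}ᶜ := not_not.mpr hz.1
  rw [Set.indicator_of_notMem h1, mul_zero, zero_add]
  by_cases hq : silentProb (S.predBelief p k z).x (S.predBelief p k z).cov (p.act k z) = 1
  · refine le_antisymm ?_ zero_le
    calc _ ≤ ∫⁻ x, ENNReal.ofReal (1 - (p.act k z).discardProb x) ∂(gaussianVec
          (S.predBelief p k z).x (S.predBelief p k z).cov.toBlocks₁₁) := by
          refine lintegral_mono fun x => ?_
          refine mul_le_of_le_one_right' ?_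
          exact Set.indicator_le_self' (fun _ _ => zero_le) _
      _ = 0 := by rw [lintegral_one_sub_discardProb (hb0 z), hq]; simp
  · have h2 : ∀ x, Fin.snoc (α := fun _ => Obs nx) z (Sum.inl x) ∉ {z | R z}ᶜ :=
      fun x => not_not.mpr (hz.2 hq x)
    simp [Set.indicator_of_notMem (h2 _)]

/-- The infima in the optimality equation are attained at the predicted covariance `P` and, after
suitable minimizing choices, at all covariances that are reached from it in the last `n` stages. -/
def Attains (S : LinGaussSystem nx ny) (lam : ℝ) :
    ℕ → (k : ℕ) → Matrix (HistIdx nx ny k) (HistIdx nx ny k) ℝ → Prop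
  | 0, _, _ => True
  | n + 1, k, P => ∃ a : StageParam nx,
      stageCost S lam (costToGo S lam n (k + 1)) 0 P a = costToGo S lam (n + 1) k P ∧
      Attains S lam n (k + 1) (silentNext S P a.f) ∧
      (silentProb 0 P a ≠ 1 → Attains S lam n (k + 1) (sentNext S P))

theorem stageCost_eq_of_excess_eq_zero {lam : ℝ} {n : ℕ} {b : Belief nx ny k} {a : StageParam nx}
    (h : excess S lam n b a = 0) :
    stageCost S lam (costToGo S lam n (k + 1)) b.x b.cov a = costToGo S lam (n + 1) k b.cov := by
  rw [← costToGo_add_excess, h, add_zero]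

/-- An optimal policy attains the infima along its covariances. -/
theorem IsDriving.ae_attains (hd : IsDriving S μ S₀ W ε) (lam : ℝ) (K : ℕ) (p : Policy nx)
    (hp : ∀ k ≤ K, ∀ᵐ z ∂(μ.map (S.output S₀ W ε p k)),
      excess S lam (K - k) (S.predBelief p k z) (p.act k z) = 0) (n : ℕ) :
    ∀ k, n + k = K + 1 → ∀ᵐ z ∂(μ.map (S.output S₀ W ε p k)),
      Attains S lam n k (S.predBelief p k z).cov := by
  induction n with
  | zero => intro k _; exact .of_forall fun z => trivial
  | succ n ih =>
    intro k hk
    obtain rfl : n = K - k := by omega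
    filter_upwards [hp k (by omega), hd.ae_output_of_succ p k (ih (k + 1) (by omega))] with z h1 h2
    have hsh := (p.act k z).shift_neg_shift (S.predBelief p k z).x
    refine ⟨(p.act k z).shift (-(S.predBelief p k z).x), ?_, ?_, fun hq => ?_⟩
    · rw [← stageCost_shift S lam _ (S.predBelief p k z).x, hsh]
      exact stageCost_eq_of_excess_eq_zero h1
    · have := h2.1
      rwa [predBelief_snoc, predict_update_silent_cov] at this
    · rw [← silentProb_shift (S.predBelief p k z).x, hsh] at hq
      obtain ⟨x, hx⟩ := h2.2 hq
      rwa [predBelief_snoc, predict_update_sent_cov] at hx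

open Classical in
/-- A minimizing choice at the covariance `P`, centred at `0`. -/
noncomputable def bestParam (S : LinGaussSystem nx ny) (lam : ℝ) (K k : ℕ)
    (P : Matrix (HistIdx nx ny k) (HistIdx nx ny k) ℝ) : StageParam nx :=
  if h : Attains S lam (K - k + 1) k P then h.choose else ⟨1, 0, PosDef.one⟩

/-- The covariances that are reached from the initial one under the choices `bestParam`, as long as
the infima are attained. -/
noncomputable def reachable (S : LinGaussSystem nx ny) (lam : ℝ) (K : ℕ) :
    (k : ℕ) → Set (Matrix (HistIdx nx ny k) (HistIdx nx ny k) ℝ)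
  | 0 => {S.initBelief.cov}
  | k + 1 => (fun P => silentNext S P (bestParam S lam K k P).f) '' reachable S lam K k ∪
      sentNext S '' reachable S lam K k

theorem countable_reachable (S : LinGaussSystem nx ny) (lam : ℝ) (K : ℕ) :
    ∀ k, (reachable S lam K k).Countable
  | 0 => Set.countable_singleton _
  | k + 1 => ((countable_reachable S lam K k).image _).union
      ((countable_reachable S lam K k).image _)

open Classical in
/-- The feedback law that takes the minimizing choice at the reachable covariances. Since there are
only countably many of these, measurability is automatic. -/
noncomputable def bestFeedback (S : LinGaussSystem nx ny) (lam : ℝ) (K : ℕ) : Feedback nx ny where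
  act k x P := (if P ∈ reachable S lam K k then bestParam S lam K k P else
    ⟨1, 0, PosDef.one⟩).shift x
  measurable_f k i j := by
    have h : Measurable fun P : HistIdx nx ny k → HistIdx nx ny k → ℝ =>
        (if Matrix.of P ∈ reachable S lam K k then bestParam S lam K k (Matrix.of P) else
          ⟨1, 0, PosDef.one⟩).f i j := by
      refine (measurable_const (a := (1 : Matrix (Fin nx) (Fin nx) ℝ) i j)).measurable_of_countable_ne
        ((countable_reachable S lam K k).mono fun P hP => ?_)
      by_contra hmem
      have hmem' : Matrix.of P ∉ reachable S lam K k := hmem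
      exact hP (by rw [if_neg hmem'])
    exact h.comp measurable_snd
  measurable_g k := by
    have h : Measurable fun P : HistIdx nx ny k → HistIdx nx ny k → ℝ =>
        (if Matrix.of P ∈ reachable S lam K k then bestParam S lam K k (Matrix.of P) else
          ⟨1, 0, PosDef.one⟩).g := by
      refine (measurable_const (a := (0 : Fin nx → ℝ))).measurable_of_countable_ne
        ((countable_reachable S lam K k).mono fun P hP => ?_)
      by_contra hmem
      have hmem' : Matrix.of P ∉ reachable S lam K k := hmem
      exact hP (by rw [if_neg hmem'])
    exact (h.comp measurable_snd).add measurable_fst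

/-- If the infima are attained from the initial covariance on, then `bestFeedback` has no excess. -/
theorem IsDriving.ae_excess_bestFeedback (hd : IsDriving S μ S₀ W ε) (lam : ℝ) (K : ℕ)
    (h0 : Attains S lam (K + 1) 0 S.initBelief.cov) {p : Policy nx}
    (hp : S.IsGeneratedBy p (bestFeedback S lam K)) :
    ∀ k ≤ K, ∀ᵐ z ∂(μ.map (S.output S₀ W ε p k)),
      excess S lam (K - k) (S.predBelief p k z) (p.act k z) = 0 := by
  -- where the infima are attained at a reachable covariance, the policy takes a minimizer
  have hact : ∀ k z, (S.predBelief p k z).cov ∈ reachable S lam K k →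
      p.act k z = (bestParam S lam K k (S.predBelief p k z).cov).shift (S.predBelief p k z).x :=
    fun k z hz => by rw [hp k z, bestFeedback]; simp only [if_pos hz]
  have hbest : ∀ (k : ℕ) (P : Matrix (HistIdx nx ny k) (HistIdx nx ny k) ℝ),
      Attains S lam (K - k + 1) k P →
      stageCost S lam (costToGo S lam (K - k) (k + 1)) 0 P (bestParam S lam K k P) =
        costToGo S lam (K - k + 1) k P ∧
      Attains S lam (K - k) (k + 1) (silentNext S P (bestParam S lam K k P).f) ∧
      (silentProb 0 P (bestParam S lam K k P) ≠ 1 →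
        Attains S lam (K - k) (k + 1) (sentNext S P)) := fun k P h => by
    rw [bestParam, dif_pos h]; exact h.choose_spec
  have key : ∀ k ≤ K, ∀ᵐ z ∂(μ.map (S.output S₀ W ε p k)),
      (S.predBelief p k z).cov ∈ reachable S lam K k ∩
        {P | Attains S lam (K - k + 1) k P} := by
    intro k hk
    induction k with
    | zero => exact .of_forall fun z => ⟨rfl, h0⟩
    | succ k ih =>
      have hk1 : K - (k + 1) + 1 = K - k := by omega
      rw [hk1]
      refine hd.ae_output_succ p k ?_ ?_
      -- a countable set of covariances is measurable, although `Attains` need not be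
      · have hm : Measurable fun z => fun i j => (S.predBelief p (k + 1) z).cov i j :=
          measurable_pi_lambda _ fun i => measurable_pi_lambda _ fun j =>
            (measurableBelief_predBelief S p (k + 1)).cov i j
        have hc : (reachable S lam K (k + 1) ∩ {P | Attains S lam (K - k) (k + 1) P} :
            Set (HistIdx nx ny (k + 1) → HistIdx nx ny (k + 1) → ℝ)).Countable :=
          (countable_reachable S lam K (k + 1)).mono Set.inter_subset_left
        exact hm hc.measurableSet
      · filter_upwards [ih (by omega)] with z hz
        obtain ⟨-, h2, h3⟩ := hbest k _ hz.2
        have ha := hact k z hz.1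
        have haf : (p.act k z).f = (bestParam S lam K k (S.predBelief p k z).cov).f := by
          rw [ha]; rfl
        refine ⟨?_, fun hq x => ?_⟩
        · rw [predBelief_snoc, predict_update_silent_cov, haf]
          exact ⟨.inl ⟨_, hz.1, rfl⟩, h2⟩
        · rw [predBelief_snoc, predict_update_sent_cov]
          rw [ha, silentProb_shift] at hq
          exact ⟨.inr ⟨_, hz.1, rfl⟩, h3 hq⟩
  intro k hk
  filter_upwards [key k hk] with z hz
  rw [excess, tsub_eq_zero_iff_le, hact k z hz.1, stageCost_shift]
  exact (hbest k _ hz.2).1.le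

/-- If an optimal policy exists, then an optimal feedback law exists. -/
theorem IsDriving.exists_optimal_feedback (hd : IsDriving S μ S₀ W ε) (lam : ℝ) (K : ℕ)
    {p : Policy nx}
    (hp : ∀ q : Policy nx, S.totalLoss S₀ W ε μ lam K p ≤ S.totalLoss S₀ W ε μ lam K q) :
    ∃ (φ : Feedback nx ny) (p : Policy nx), S.IsGeneratedBy p φ ∧
      ∀ q : Policy nx, S.totalLoss S₀ W ε μ lam K p ≤ S.totalLoss S₀ W ε μ lam K q := by
  obtain ⟨q, hq⟩ := exists_isGeneratedBy S (bestFeedback S lam K)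
  refine ⟨_, q, hq, (hd.forall_totalLoss_le_iff lam K q).mpr ?_⟩
  refine hd.ae_excess_bestFeedback lam K ?_ hq
  haveI := Measure.isProbabilityMeasure_map (μ := μ) (hd.measurable_output p 0).aemeasurable
  obtain ⟨z, hz⟩ := (hd.ae_attains lam K p ((hd.forall_totalLoss_le_iff lam K p).mp hp)
    (K + 1) 0 rfl).exists
  exact hz

end OptimalFeedback

end PrivacySampling

open PrivacySampling
theorem mainTheorem3 {nx ny : ℕ} (S : LinGaussSystem nx ny) (lam : ℝ) (hlam : 0 < lam) (K : ℕ)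
    {Ω : Type*} [MeasurableSpace Ω] (μ : Measure Ω) [IsProbabilityMeasure μ]
    (S₀ : Ω → StateIdx nx ny → ℝ) (W : ℕ → Ω → StateIdx nx ny → ℝ) (ε : ℕ → Ω → ℝ)
    (hdrive : IsDriving S μ S₀ W ε) :
    -- the belief recursion computes the conditional law of `(X_k, Y^k)` given `Z^{k-1}`
    (∀ (p : Policy nx) (k : ℕ), k ≤ K →
      ∀ᵐ z ∂(μ.map (S.output S₀ W ε p k)),
        condDistrib (S.XYhist S₀ W k) (S.output S₀ W ε p k) μ z =
          gaussianVec (S.predBelief p k z).mean (S.predBelief p k z).cov) ∧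
    -- if `Y` is autonomous, then the total loss of a policy is the minimum over all
    -- reconstructions of the objective, and the filtered mean is a minimizer
    (S.A.toBlocks₂₁ = 0 → ∀ p : Policy nx, ∃ r : Recon nx,
      (∀ k z, r.est k z = (S.filtBelief p k z).x) ∧
      S.objective S₀ W ε μ lam K p r = S.totalLoss S₀ W ε μ lam K p ∧
      ∀ r' : Recon nx, S.objective S₀ W ε μ lam K p r ≤ S.objective S₀ W ε μ lam K p r') ∧
    -- the one-step loss is nonnegative
    (∀ (k : ℕ) (x : Fin nx → ℝ) (P : Matrix (HistIdx nx ny k) (HistIdx nx ny k) ℝ)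
      (a : StageParam nx), P.PosDef → 0 ≤ oneStepLoss lam x P a) ∧
    -- every feedback law generates a policy
    (∀ φ : Feedback nx ny, ∃ p : Policy nx, S.IsGeneratedBy p φ) ∧
    -- the optimality equation has a solution that depends on `(x̃_{k|k-1}, P_{k|k-1})` only
    (∃ V, S.SolvesBellman lam K V) ∧
    ∀ V, S.SolvesBellman lam K V →
      -- it is finite
      (∀ k ≤ K, ∀ x P, P.PosDef → V k x P ≠ ∞) ∧
      -- it gives the optimal value
      (⨅ p : Policy nx, S.totalLoss S₀ W ε μ lam K p) = V 0 S.initBelief.x S.initBelief.cov ∧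
      -- a policy is optimal if and only if it solves the optimality equation along its outputs
      (∀ p : Policy nx,
        (∀ q : Policy nx, S.totalLoss S₀ W ε μ lam K p ≤ S.totalLoss S₀ W ε μ lam K q) ↔
        ∀ k ≤ K, ∀ᵐ z ∂(μ.map (S.output S₀ W ε p k)),
          IsMinOn (S.bellman lam (V (k + 1)) (S.predBelief p k z)) Set.univ (p.act k z)) ∧
      -- feedback laws in `(x̃_{k|k-1}, P_{k|k-1})` suffice
      (⨅ p : {p : Policy nx // ∃ φ : Feedback nx ny, S.IsGeneratedBy p φ},
        S.totalLoss S₀ W ε μ lam K p.1) = V 0 S.initBelief.x S.initBelief.cov ∧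
      ((∃ p : Policy nx, ∀ q : Policy nx,
          S.totalLoss S₀ W ε μ lam K p ≤ S.totalLoss S₀ W ε μ lam K q) →
        ∃ (φ : Feedback nx ny) (p : Policy nx), S.IsGeneratedBy p φ ∧
          ∀ q : Policy nx, S.totalLoss S₀ W ε μ lam K p ≤ S.totalLoss S₀ W ε μ lam K q) := by
  refine ⟨fun p k _ => hdrive.condDistrib_XYhist p k, fun hA p => ?_,
    fun k x P a hP => oneStepLoss_nonneg hlam.le x hP a, exists_isGeneratedBy S,
    ⟨_, solvesBellman_costToGo S lam K⟩, fun V hV => ?_⟩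
  · obtain ⟨r, hr⟩ : ∃ r : Recon nx, ∀ k z, r.est k z = (S.filtBelief p k z).x :=
      ⟨⟨fun k z => (S.filtBelief p k z).x, fun k => (measurableBelief_filtBelief S p k).x⟩,
        fun _ _ => rfl⟩
    exact ⟨r, hr, hdrive.objective_eq_totalLoss hA hlam.le K p hr,
      hdrive.objective_filtBelief_le K p hr⟩
  · have h0 := hV.eq_costToGo (K + 1) rfl S.initBelief.x S.initBelief.cov (initBelief_posDef S)
    refine ⟨fun k hk x P hP => ?_, ?_, fun p => ?_, ?_, fun ⟨p, hp⟩ =>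
      hdrive.exists_optimal_feedback lam K hp⟩
    · rw [hV.eq_costToGo (K + 1 - k) (by omega) x P hP]
      exact costToGo_ne_top S lam _ hP
    · rw [h0, hdrive.iInf_totalLoss]
    · rw [hdrive.forall_totalLoss_le_iff]
      refine forall_congr' fun k => forall_congr' fun hk => ?_
      simp only [isMinOn_bellman_iff hV hk (predBelief_posDef S p k _)]
    · rw [h0, hdrive.iInf_feedback_totalLoss]
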